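/- Let $\sigma\in\{1,-1\}$, $T>0$, and let $q(x,t)$ be a classical solution on $\mathbb R\times[0,T]$ of the derivative nonlinear Schrödinger equation $$iq_t+q_{xx}-i(rq^2)_x=0,\qquad r=\sigma\bar q,\qquad q(x,0)=q_0(x),$$ such that $q,q_x,q_{xx}$ are continuous and bounded by $C/(1+x^2)$ uniformly in $t\in[0,T]$. (The case $\sigma=-1$ is $iq_t+q_{xx}+i(|q|^2q)_x=0$; the two signs are exchanged by $x\mapsto -x$.) Direct scattering of $q_0$. Put $\sigma_3=\mathrm{diag}(1,-1)$, $e^{w\hat\sigma_3}A=e^{w\sigma_3}Ae^{-w\sigma_3}$, $r_0=\sigma\bar q_0$, $\delta(x)=\frac12\int_{+\infty}^x q_0r_0\,dy$ and $$V_1(x,k)=\begin{pmatrix}-\frac i2 r_0q_0& kq_0e^{-2i\delta}\\ kr_0e^{2i\delta}&\frac i2r_0q_0\end{pmatrix}.$$ Let $\mu_1,\mu_2$ be the bounded continuous solutions of $$\mu_j(x,k)=I+\int_{\pm\infty}^x e^{-ik^2(x-y)\hat\sigma_3}\big(V_1(y,k)\mu_j(y,k)\big)\,dy,$$ with $+\infty$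 for $j=1$ and $-\infty$ for $j=2$; the second column of $\mu_1$ and the first column of $\mu_2$ are defined for $\operatorname{Im}k^2\ge0$, the other two columns for $\operatorname{Im}k^2\le0$. For $k^2\in\mathbb R$ let $S(k)=\mu_1(0,k)^{-1}\mu_2(0,k)$ and $r(k)=S_{21}(k)/S_{11}(k)$. For $\operatorname{Im}k^2\ge0$ let $a(k)$ be the determinant of the matrix formed by the first column of $\mu_2(0,k)$ and the second column of $\mu_1(0,k)$ (so $a=S_{11}$ when $k^2\in\mathbb R$). Assume that $a(k)\neq0$ for all $k$ with $\operatorname{Im}k^2\ge0$. Then $r(k)/k$ depends only on $\lambda=k^2\in\mathbb R\setminus\{0\}$ and extends to a continuous function $\rho$ of $\lambda\in\mathbb R$. For every $x\in\mathbb R$ and $t\in[0,T]$ the following Riemann–Hilbert problem has exactly one solution: find a $2\times2$ matrix function $N(\lambda)=N(x,t,\lambda)$, analytic in $\mathbb C\setminus\mathbb R$, with limits $N_\pm(\lambda)$ at each $\lambda\in\mathbb R$ from the upper ($+$) and lower ($-$) half plane, such that $$N_+(\lambda)=N_-(\lambda)\,e^{-i(\lambda x+2\lambda^2t)\hat\sigma_3}\begin{pmatrix}1-\sigma\lambda|\rho(\lambda)|^2&-\sigma\overline{\rho(\lambda)}\\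 \lambda\rho(\lambda)&1\end{pmatrix},\qquad \lambda\in\mathbb R,$$ and $N(\lambda)\to I$ as $\lambda\to\infty$, $\lambda\notin\mathbb R$. The limit $$\tilde q(x,t)=2i\lim_{\lambda\to\infty,\ \lambda\notin\mathbb R}\lambda N_{12}(x,t,\lambda)$$ exists, $|\tilde q(\cdot,t)|^2$ is integrable on $(x,\infty)$, and $$q(x,t)=\tilde q(x,t)\,\exp\Big(i\sigma\int_{+\infty}^x|\tilde q(y,t)|^2\,dy\Big).$$ -/

import Mathlib

open MeasureTheory Filter Topology Complex
open scoped ComplexConjugate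

noncomputable section

namespace DNLS

/-- `q` is a classical solution on `ℝ × [0,T]` of the derivative nonlinear Schrödinger equation
`i q_t + q_xx - i (r q²)_x = 0`, `r = σ q̄`, with initial value `q₀`: the function and its first
two `x`-derivatives are jointly continuous and decay like `(1 + x²)⁻¹`, uniformly in time.
The first argument of `q` is the position `x`, the second the time `t`. -/
structure IsSolution (σ T : ℝ) (q₀ : ℝ → ℂ) (q : ℝ → ℝ → ℂ) : Prop where
  smooth : ∀ t ∈ Set.Icc 0 T, ContDiff ℝ 2 (fun x => q x t)
  continuousOn : ∀ j ≤ 2, ContinuousOn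
    (fun p : ℝ × ℝ => iteratedDeriv j (fun x => q x p.2) p.1) (Set.univ ×ˢ Set.Icc 0 T)
  decay : ∃ C : ℝ, ∀ j ≤ 2, ∀ t ∈ Set.Icc 0 T, ∀ x : ℝ,
    ‖iteratedDeriv j (fun y => q y t) x‖ ≤ C / (1 + x ^ 2)
  differentiable_time : ∀ x : ℝ, ∀ t ∈ Set.Icc 0 T,
    DifferentiableWithinAt ℝ (fun s => q x s) (Set.Icc 0 T) t
  equation : ∀ x : ℝ, ∀ t ∈ Set.Icc 0 T,
    I * derivWithin (fun s => q x s) (Set.Icc 0 T) t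
      + iteratedDeriv 2 (fun y => q y t) x
      - I * deriv (fun y => (σ * conj (q y t)) * q y t ^ 2) x = 0
  initial : ∀ x : ℝ, q x 0 = q₀ x

/-- `∫_{+∞}^x Δ`, the integral of the one-form `Δ = (1/2) u r dx` with `r = σ ū`. -/
def phase (σ : ℝ) (u : ℝ → ℂ) (x : ℝ) : ℂ :=
  -∫ y in Set.Ioi x, (1 / 2) * u y * (σ * conj (u y))

/-- The coefficient `V₁` of the `x`-part `μ_x + i k² [σ₃, μ] = V₁ μ` of the Lax pair,
for the potential `u` at a fixed time. -/
def V₁ (σ : ℝ) (u : ℝ → ℂ) (k : ℂ) (x : ℝ) : Matrix (Fin 2) (Fin 2) ℂ :=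
  !![-(I / 2) * (σ * conj (u x)) * u x, k * u x * exp (-2 * I * phase σ u x);
     k * (σ * conj (u x)) * exp (2 * I * phase σ u x), (I / 2) * (σ * conj (u x)) * u x]

/-- Diagonal entries of `σ₃ = diag (1, -1)`. -/
def pauli (i : Fin 2) : ℂ := if i = 0 then 1 else -1

/-- `exp (w σ̂₃) A = exp (w σ₃) A exp (-w σ₃)`. -/
def conjExp (w : ℂ) (A : Matrix (Fin 2) (Fin 2) ℂ) : Matrix (Fin 2) (Fin 2) ℂ :=
  Matrix.diagonal (fun i => exp (w * pauli i)) * A * Matrix.diagonal (fun i => exp (-w * pauli i))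

/-- `m` is the `j`-th column of `μ₁`: the bounded continuous solution of the `j`-th column of
`μ₁(x) = 1 + ∫_{+∞}^x e^{-i k² (x - y) σ̂₃} (V₁ μ₁)(y) dy`. -/
def IsJostColumn₁ (σ : ℝ) (u : ℝ → ℂ) (k : ℂ) (j : Fin 2) (m : ℝ → Fin 2 → ℂ) : Prop :=
  Continuous m ∧ (∃ C : ℝ, ∀ x, ‖m x‖ ≤ C) ∧
    ∀ (x : ℝ) (i : Fin 2), m x i = (1 : Matrix (Fin 2) (Fin 2) ℂ) i j -
      ∫ y in Set.Ioi x, exp (-I * k ^ 2 * ((x : ℂ) - y) * (pauli i - pauli j)) *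
        ((V₁ σ u k y).mulVec (m y)) i

/-- `m` is the `j`-th column of `μ₂`: the bounded continuous solution of the `j`-th column of
`μ₂(x) = 1 + ∫_{-∞}^x e^{-i k² (x - y) σ̂₃} (V₁ μ₂)(y) dy`. -/
def IsJostColumn₂ (σ : ℝ) (u : ℝ → ℂ) (k : ℂ) (j : Fin 2) (m : ℝ → Fin 2 → ℂ) : Prop :=
  Continuous m ∧ (∃ C : ℝ, ∀ x, ‖m x‖ ≤ C) ∧
    ∀ (x : ℝ) (i : Fin 2), m x i = (1 : Matrix (Fin 2) (Fin 2) ℂ) i j +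
      ∫ y in Set.Iic x, exp (-I * k ^ 2 * ((x : ℂ) - y) * (pauli i - pauli j)) *
        ((V₁ σ u k y).mulVec (m y)) i

/-- The Jost solution `μ₁`, normalized at `x = +∞`, as a matrix. Its first column is meaningful
for `Im k² ≤ 0` and its second column for `Im k² ≥ 0`. -/
def μ₁ (σ : ℝ) (u : ℝ → ℂ) (k : ℂ) (x : ℝ) : Matrix (Fin 2) (Fin 2) ℂ :=
  Matrix.of fun i j => Classical.epsilon (IsJostColumn₁ σ u k j) x i

/-- The Jost solution `μ₂`, normalized at `x = -∞`, as a matrix. Its first column is meaningful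
for `Im k² ≥ 0` and its second column for `Im k² ≤ 0`. -/
def μ₂ (σ : ℝ) (u : ℝ → ℂ) (k : ℂ) (x : ℝ) : Matrix (Fin 2) (Fin 2) ℂ :=
  Matrix.of fun i j => Classical.epsilon (IsJostColumn₂ σ u k j) x i

/-- The scattering matrix, for `k² ∈ ℝ`: the value at `x = 0`, `t = 0` of the relation
`μ₂ = μ₁ e^{-i (k² x + 2 k⁴ t) σ̂₃} S(k)`. -/
def S (σ : ℝ) (u : ℝ → ℂ) (k : ℂ) : Matrix (Fin 2) (Fin 2) ℂ :=
  (μ₁ σ u k 0)⁻¹ * μ₂ σ u k 0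

/-- The function `a(k) = det (μ₂⁽¹⁾, μ₁⁽²⁾)` on the closed region `Im k² ≥ 0`, that is,
the continuation of the entry `S₁₁` from `k² ∈ ℝ` to this region. -/
def a (σ : ℝ) (u : ℝ → ℂ) (k : ℂ) : ℂ :=
  μ₂ σ u k 0 0 0 * μ₁ σ u k 0 1 1 - μ₂ σ u k 0 1 0 * μ₁ σ u k 0 0 1

/-- The reflection coefficient `r(k) = b(k) / a(k) = S₂₁ / S₁₁`, for `k² ∈ ℝ`. -/
def r (σ : ℝ) (u : ℝ → ℂ) (k : ℂ) : ℂ := S σ u k 1 0 / S σ u k 0 0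

/-- The matrix `J_N`. -/
def JN (σ : ℝ) (ρ : ℝ → ℂ) (l : ℝ) : Matrix (Fin 2) (Fin 2) ℂ :=
  !![1 - σ * l * (‖ρ l‖ : ℂ) ^ 2, -σ * conj (ρ l); l * ρ l, 1]

/-- `N` solves the Riemann–Hilbert problem on the real line with parameters `(x, t)`: it is
analytic off `ℝ`, has boundary values from the upper (`+`) and lower (`-`) half plane at every
real point, related by `N₊ = N₋ e^{-i (l x + 2 l² t) σ̂₃} J_N`, and tends to the identity
at infinity. The values of `N` on `ℝ` play no role. -/
structure IsRHSolution (σ : ℝ) (ρ : ℝ → ℂ) (x t : ℝ) (N : ℂ → Matrix (Fin 2) (Fin 2) ℂ) :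
    Prop where
  analytic : ∀ i j, DifferentiableOn ℂ (fun z => N z i j) {z | z.im ≠ 0}
  jump : ∀ l : ℝ, ∃ Nplus Nminus : Matrix (Fin 2) (Fin 2) ℂ,
    Tendsto N (𝓝[{z | 0 < z.im}] (l : ℂ)) (𝓝 Nplus) ∧
    Tendsto N (𝓝[{z | z.im < 0}] (l : ℂ)) (𝓝 Nminus) ∧
    Nplus = Nminus * conjExp (-I * (l * x + 2 * l ^ 2 * t)) (JN σ ρ l)
  infinity : Tendsto N (cocompact ℂ ⊓ 𝓟 {z | z.im ≠ 0}) (𝓝 1)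

end DNLS

end

open scoped BoundedContinuousFunction

noncomputable section

namespace DNLS

/-! Uniqueness is Liouville's theorem. The jump matrix has determinant one, so `det N` does not jump
across ℝ and equals 1. For two solutions the product of `N` with the adjugate of `N'` does not jump
either, hence extends to an entire function with limit I at infinity.

Existence and reconstruction come from an explicit solution, built from Jost functions of the
gauge-transformed potential Q = q e^{-2iδ} at time t. With z = k², the first column of μ₂ is (f, k
g) and the second column of μ₁ is (k c, d), where f, g, c, d depend on k only through z. The system
for (f, g) has a coefficient growing with z. The combination h = 2izg + σQ̄f removes it: (f, h)
solves a Volterra system in which z occurs only in a bounded exponential (`exists_volterra_system`,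
`exists_isJost`). One integration by parts then bounds z h and z (f - 1), so that 2izg → -σQ̄. The
column at +∞ is the mirror image of this one under x ↦ -x, z ↦ -z̄, σ ↦ -σ, and it satisfies 2izc →
Q.

Let A and B be the Wronskians `wronskianA` and `wronskianB`. On the real line (f, g) equals A times
the conjugated right column (d̄, σc̄), plus an oscillating multiple B of the right column itself.
Division by A turns this into the required jump with ρ = B/A at time zero. Multiplication from the
left by the triangular matrix with lower left entry σQ̄/(2i) supplies the normalization I in the
λ-plane. The assumption on a(k) says that A has no zeros, so the quotients are analytic above the
axis; Schwarz reflection gives the lower half plane (`upperSolution_eq`, `isRHSolution_of_isJost`).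
The limit of 2izc identifies q̃ with Q, and |Q| = |q| allows the gauge to be inverted in terms of
q̃.

Time enters only through A, which is constant, and B, which acquires the factor e^{4iλ²t}. No time
equation for the Jost functions is needed. The time variation of a Wronskian is an integral over x
of the variation of the potential between a row and a column solution; by the zero curvature
identity this integrand is an exact x-derivative, so only limits at ±∞ survive
(`wronskian_evolution`). Undoing the gauge costs the factor exp((i/2)∫σ|q|²), whose constancy
follows by comparing A → 1 at two times. -/

/-! ### Removing the real line: Morera and Liouville. -/

/-- A continuous function which is holomorphic off the real line is entire. -/
theorem differentiable_of_continuous_of_differentiableOn_im_ne_zero {f : ℂ → ℂ}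
    (hf : Continuous f) (hd : DifferentiableOn ℂ f {z | z.im ≠ 0}) : Differentiable ℂ f := by
  have hdAt : ∀ z : ℂ, z.im ≠ 0 → DifferentiableAt ℂ f z := fun z hz =>
    hd.differentiableAt ((isOpen_ne_fun Complex.continuous_im continuous_const).mem_nhds hz)
  have hrect : ∀ z w : ℂ, (∀ v ∈ (Set.Ioo (min z.im w.im) (max z.im w.im)), v ≠ 0) →
      wedgeIntegral z w f + wedgeIntegral w z f = 0 := by
    intro z w h0
    rw [wedgeIntegral_add_wedgeIntegral_eq]
    refine integral_boundary_rect_eq_zero_of_continuousOn_of_differentiableOn f z w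
      hf.continuousOn fun v hv => (hdAt v (h0 _ hv.2)).differentiableWithinAt
  rw [← differentiableOn_univ]
  refine (isConservativeOn_and_continuousOn_iff_isDifferentiableOn isOpen_univ).1
    ⟨fun z w _ => ?_, hf.continuousOn⟩
  rw [← add_eq_zero_iff_eq_neg]
  -- The rectangle is cut along the real axis: each of the two pieces has its open interior off the
  -- axis, and the contributions of the cut cancel.
  have h1 := hrect z (w.re : ℂ) (by
    intro v hv; simp at hv; rintro rfl
    rcases hv with ⟨h1 | h1, h2 | h2⟩ <;> linarith)
  have h2 := hrect (z.re : ℂ) w (by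
    intro v hv; simp at hv; rintro rfl
    rcases hv with ⟨h1 | h1, h2 | h2⟩ <;> linarith)
  rw [wedgeIntegral_add_wedgeIntegral_eq] at h1 h2 ⊢
  have hv : ∀ a b c d : ℝ, IntervalIntegrable (fun y : ℝ => f (a + y * I)) volume c d := fun a b c d =>
    (Continuous.intervalIntegrable (by fun_prop) _ _)
  have e1 := intervalIntegral.integral_add_adjacent_intervals (hv w.re 0 z.im 0) (hv w.re 0 0 w.im)
  have e2 := intervalIntegral.integral_add_adjacent_intervals (hv z.re 0 z.im 0) (hv z.re 0 0 w.im)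
  simp only [smul_eq_mul, ofReal_re, ofReal_im, ofReal_zero, zero_mul, add_zero] at *
  rw [← e1, ← e2]
  linear_combination h1 + h2

/-- A function holomorphic off the real line, without jump across it and with a limit at
infinity, is constant. -/
theorem eq_const_of_no_jump {H : ℂ → ℂ} {c : ℂ} (hd : DifferentiableOn ℂ H {z | z.im ≠ 0})
    (hj : ∀ l : ℝ, ∃ h, Tendsto H (𝓝[{z | 0 < z.im}] (l : ℂ)) (𝓝 h) ∧
      Tendsto H (𝓝[{z | z.im < 0}] (l : ℂ)) (𝓝 h))
    (hinf : Tendsto H (cocompact ℂ ⊓ 𝓟 {z | z.im ≠ 0}) (𝓝 c)) {z : ℂ} (hz : z.im ≠ 0) :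
    H z = c := by
  set A : Set ℂ := {z | z.im ≠ 0} with hA
  have hAd : Dense A := by
    have : A = Complex.im ⁻¹' ({0}ᶜ : Set ℝ) := by ext; simp [hA]
    rw [this]
    exact (dense_compl_singleton (0 : ℝ)).preimage Complex.isOpenMap_im
  have hAsplit : A = {z : ℂ | 0 < z.im} ∪ {z | z.im < 0} := by
    ext z; exact ne_iff_lt_or_gt.trans or_comm
  have hlim : ∀ z : ℂ, ∃ y, Tendsto H (𝓝[A] z) (𝓝 y) := by
    intro z
    by_cases hz : z.im = 0
    · obtain ⟨h, h1, h2⟩ := hj z.re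
      have hzz : (z.re : ℂ) = z := by apply Complex.ext <;> simp [hz]
      rw [hzz] at h1 h2
      refine ⟨h, ?_⟩
      rw [hAsplit, nhdsWithin_union]
      exact h1.sup h2
    · exact ⟨H z, (hd z hz).continuousWithinAt⟩
  have hE : Continuous (extendFrom A H) := continuous_extendFrom hAd hlim
  have hEH : ∀ z ∈ A, extendFrom A H z = H z := fun z hz =>
    extendFrom_eq (subset_closure hz) (hd z hz).continuousWithinAt
  have hEd : Differentiable ℂ (extendFrom A H) :=
    differentiable_of_continuous_of_differentiableOn_im_ne_zero hE
      (hd.congr fun z hz => hEH z hz)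
  rw [← hEH z hz]
  refine hEd.apply_eq_of_tendsto_cocompact (c := c) z ?_
  rw [(Metric.nhds_basis_closedBall (x := c)).tendsto_right_iff]
  intro ε hε
  have h1 := ((Metric.nhds_basis_closedBall (x := c)).tendsto_right_iff.1 hinf) ε hε
  rw [eventually_inf_principal,
    ← Metric.cobounded_eq_cocompact,
    (Metric.hasBasis_cobounded_compl_closedBall (0 : ℂ)).eventually_iff] at h1
  obtain ⟨r, -, h1⟩ := h1
  rw [← Metric.cobounded_eq_cocompact,
    (Metric.hasBasis_cobounded_compl_closedBall (0 : ℂ)).eventually_iff]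
  refine ⟨r, trivial, fun w hw => ?_⟩
  -- The limit at infinity is known only off the axis; density of `A` and continuity of the
  -- extension carry the bound to real points.
  have hw' : w ∈ closure ((Metric.closedBall (0 : ℂ) r)ᶜ ∩ A) :=
    hAd.open_subset_closure_inter Metric.isClosed_closedBall.isOpen_compl hw
  have hcl : IsClosed (extendFrom A H ⁻¹' Metric.closedBall c ε) :=
    Metric.isClosed_closedBall.preimage hE
  refine hcl.closure_subset_iff.2 ?_ hw'
  rintro v ⟨hv1, hv2⟩
  have := h1 hv1 hv2
  simpa [hEH v hv2] using this

/-! ### Uniqueness for the Riemann–Hilbert problem. -/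

theorem det_conjExp (w : ℂ) (A : Matrix (Fin 2) (Fin 2) ℂ) : (conjExp w A).det = A.det := by
  simp only [conjExp, Matrix.det_mul, Matrix.det_diagonal, Fin.prod_univ_two]
  have : ∀ i, exp (w * pauli i) * exp (-w * pauli i) = 1 := fun i => by
    rw [← Complex.exp_add]; simp
  linear_combination A.det * (exp (w * pauli 1) * exp (-w * pauli 1)) * this 0 + A.det * this 1

theorem det_JN (σ : ℝ) (ρ : ℝ → ℂ) (l : ℝ) : (JN σ ρ l).det = 1 := by
  have : conj (ρ l) * ρ l = (‖ρ l‖ : ℂ) ^ 2 := by rw [Complex.conj_mul']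
  simp only [JN, Matrix.det_fin_two_of]
  linear_combination (σ : ℂ) * l * this

namespace IsRHSolution

variable {σ : ℝ} {ρ : ℝ → ℂ} {x t : ℝ} {N N' : ℂ → Matrix (Fin 2) (Fin 2) ℂ}

/-- The jump matrix is unimodular, so the determinant has equal boundary values from both sides and
Liouville applies. -/
theorem det_eq_one (hN : IsRHSolution σ ρ x t N) {z : ℂ} (hz : z.im ≠ 0) : (N z).det = 1 := by
  have hdet : Continuous fun M : Matrix (Fin 2) (Fin 2) ℂ => M.det := continuous_id.matrix_det
  refine eq_const_of_no_jump (H := fun z => (N z).det) ?_ ?_ ?_ hz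
  · simp only [Matrix.det_fin_two]
    exact ((hN.analytic 0 0).mul (hN.analytic 1 1)).sub ((hN.analytic 0 1).mul (hN.analytic 1 0))
  · intro l
    obtain ⟨P, M, hP, hM, h⟩ := hN.jump l
    refine ⟨P.det, (hdet.tendsto P).comp hP, ?_⟩
    have : P.det = M.det := by rw [h, Matrix.det_mul, det_conjExp, det_JN, mul_one]
    rw [this]
    exact (hdet.tendsto M).comp hM
  · have := (hdet.tendsto 1).comp hN.infinity
    rwa [Matrix.det_one] at this

theorem tendsto_mul_adjugate {F : Filter ℂ} {P P' : Matrix (Fin 2) (Fin 2) ℂ}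
    (h : Tendsto N F (𝓝 P)) (h' : Tendsto N' F (𝓝 P')) (i j : Fin 2) :
    Tendsto (fun z => (N z * (N' z).adjugate) i j) F (𝓝 ((P * P'.adjugate) i j)) := by
  have hadj : Continuous fun M : Matrix (Fin 2) (Fin 2) ℂ => M.adjugate :=
    continuous_id.matrix_adjugate
  have h1 : Tendsto (fun z => N z * (N' z).adjugate) F (𝓝 (P * P'.adjugate)) :=
    h.mul ((hadj.tendsto P').comp h')
  exact (tendsto_pi_nhds.1 (tendsto_pi_nhds.1 h1 i) j)

/-- The Riemann–Hilbert problem has at most one solution. -/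
theorem unique (hN : IsRHSolution σ ρ x t N) (hN' : IsRHSolution σ ρ x t N') {z : ℂ}
    (hz : z.im ≠ 0) : N z = N' z := by
  have key : ∀ i j, (N z * (N' z).adjugate) i j = (1 : Matrix (Fin 2) (Fin 2) ℂ) i j := by
    intro i j
    refine eq_const_of_no_jump (H := fun z => (N z * (N' z).adjugate) i j) ?_ ?_ ?_ hz
    · have hadj : ∀ a b, DifferentiableOn ℂ (fun z => (N' z).adjugate a b) {z | z.im ≠ 0} := by
        intro a b
        simp only [Matrix.adjugate_fin_two]
        fin_cases a <;> fin_cases b <;> simp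
        · exact hN'.analytic 1 1
        · exact hN'.analytic 0 1
        · exact hN'.analytic 1 0
        · exact hN'.analytic 0 0
      simp only [Matrix.mul_apply, Fin.sum_univ_two]
      exact ((hN.analytic i 0).mul (hadj 0 j)).add ((hN.analytic i 1).mul (hadj 1 j))
    · intro l
      obtain ⟨P, M, hP, hM, h⟩ := hN.jump l
      obtain ⟨P', M', hP', hM', h'⟩ := hN'.jump l
      refine ⟨(P * P'.adjugate) i j, tendsto_mul_adjugate hP hP' i j, ?_⟩
      -- The common jump J cancels through J · adj J = det J = 1.
      have : P * P'.adjugate = M * M'.adjugate := by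
        rw [h, h', Matrix.adjugate_mul_distrib, Matrix.mul_assoc, ← Matrix.mul_assoc (conjExp _ _),
          Matrix.mul_adjugate, det_conjExp, det_JN, one_smul, Matrix.one_mul]
      rw [this]
      exact tendsto_mul_adjugate hM hM' i j
    · have := tendsto_mul_adjugate hN.infinity hN'.infinity i j
      simpa using this
  have h1 : N z * (N' z).adjugate = 1 := by ext i j; exact key i j
  have h2 : (N' z).adjugate * N' z = 1 := by
    rw [Matrix.adjugate_mul, hN'.det_eq_one hz, one_smul]
  calc N z = N z * ((N' z).adjugate * N' z) := by rw [h2, mul_one]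
    _ = N' z := by rw [← mul_assoc, h1, one_mul]

end IsRHSolution

/-! ### The oscillating Volterra integral. -/

/-- The solution `∫_{-∞}^x e^{2 i lam (x - y)} φ(y) dy` of `v' = 2 i lam v + φ`. -/
def volterra (lam : ℂ) (φ : ℝ → ℂ) (x : ℝ) : ℂ :=
  ∫ y in Set.Iic x, exp (2 * I * lam * (x - y)) * φ y

theorem norm_exp_two_I_mul_le {lam : ℂ} (hl : 0 ≤ lam.im) {s : ℝ} (hs : 0 ≤ s) :
    ‖exp (2 * I * lam * s)‖ ≤ 1 := by
  rw [Complex.norm_exp]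
  simp
  positivity

theorem norm_kernel_le {lam : ℂ} (hl : 0 ≤ lam.im) {x y : ℝ} (h : y ≤ x) :
    ‖exp (2 * I * lam * (x - y))‖ ≤ 1 := by
  have := norm_exp_two_I_mul_le hl (sub_nonneg.2 h)
  simpa using this

theorem integrable_of_decay {φ : ℝ → ℂ} (hφ : Continuous φ) {C : ℝ}
    (hC : ∀ y, ‖φ y‖ ≤ C * (1 + y ^ 2)⁻¹) : Integrable φ :=
  (integrable_inv_one_add_sq.const_mul C).mono' hφ.aestronglyMeasurable (ae_of_all _ hC)

theorem integrableOn_kernel {lam : ℂ} (hl : 0 ≤ lam.im) {φ : ℝ → ℂ} (hφ : Integrable φ) (x : ℝ) :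
    IntegrableOn (fun y : ℝ => exp (2 * I * lam * (x - y)) * φ y) (Set.Iic x) := by
  refine (hφ.norm.integrableOn (s := Set.Iic x)).mono' ?_ ?_
  · exact (Continuous.aestronglyMeasurable (by fun_prop)).mul hφ.aestronglyMeasurable.restrict
  · refine (ae_restrict_iff' measurableSet_Iic).2 (ae_of_all _ fun y hy => ?_)
    rw [norm_mul]
    exact mul_le_of_le_one_left (norm_nonneg _) (norm_kernel_le hl hy)

theorem norm_volterra_le {lam : ℂ} (hl : 0 ≤ lam.im) {φ : ℝ → ℂ} {g : ℝ → ℝ} {x : ℝ}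
    (hg : IntegrableOn g (Set.Iic x)) (h : ∀ y, ‖φ y‖ ≤ g y) :
    ‖volterra lam φ x‖ ≤ ∫ y in Set.Iic x, g y := by
  refine norm_integral_le_of_norm_le hg ?_
  refine (ae_restrict_iff' measurableSet_Iic).2 (ae_of_all _ fun y hy => ?_)
  rw [norm_mul]
  exact (mul_le_of_le_one_left (norm_nonneg _) (norm_kernel_le hl hy)).trans (h y)

theorem norm_volterra_le_arctan {lam : ℂ} (hl : 0 ≤ lam.im) {φ : ℝ → ℂ} {C : ℝ}
    (hC : ∀ y, ‖φ y‖ ≤ C * (1 + y ^ 2)⁻¹) (x : ℝ) :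
    ‖volterra lam φ x‖ ≤ C * (Real.arctan x + Real.pi / 2) := by
  have := norm_volterra_le hl (x := x) (integrable_inv_one_add_sq.const_mul C).integrableOn hC
  rwa [integral_const_mul, integral_Iic_inv_one_add_sq] at this

theorem norm_volterra_le_pi {lam : ℂ} (hl : 0 ≤ lam.im) {φ : ℝ → ℂ} {C : ℝ}
    (hC : ∀ y, ‖φ y‖ ≤ C * (1 + y ^ 2)⁻¹) (x : ℝ) : ‖volterra lam φ x‖ ≤ C * Real.pi := by
  have hC0 : 0 ≤ C := by simpa using (norm_nonneg _).trans (hC 0)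
  refine (norm_volterra_le_arctan hl hC x).trans (mul_le_mul_of_nonneg_left ?_ hC0)
  linarith [Real.arctan_lt_pi_div_two x]

theorem tendsto_arctan_add_atBot (C : ℝ) :
    Tendsto (fun x : ℝ => C * (Real.arctan x + Real.pi / 2)) atBot (𝓝 0) := by
  have h : Tendsto Real.arctan atBot (𝓝 (-(Real.pi / 2))) :=
    Real.tendsto_arctan_atBot.mono_right nhdsWithin_le_nhds
  simpa using (h.add_const (Real.pi / 2)).const_mul C

theorem tendsto_volterra_atBot {lam : ℂ} (hl : 0 ≤ lam.im) {φ : ℝ → ℂ} {C : ℝ}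
    (hC : ∀ y, ‖φ y‖ ≤ C * (1 + y ^ 2)⁻¹) : Tendsto (volterra lam φ) atBot (𝓝 0) :=
  squeeze_zero_norm (norm_volterra_le_arctan hl hC) (tendsto_arctan_add_atBot C)

theorem tendsto_inv_one_add_sq_atBot : Tendsto (fun x : ℝ => (1 + x ^ 2)⁻¹) atBot (𝓝 0) := by
  refine tendsto_inv_atTop_zero.comp (tendsto_atTop_add_const_left _ _ ?_)
  exact (tendsto_pow_atTop two_ne_zero).comp tendsto_abs_atBot_atTop |>.congr fun x => sq_abs x

theorem tendsto_inv_one_add_sq_atTop : Tendsto (fun x : ℝ => (1 + x ^ 2)⁻¹) atTop (𝓝 0) :=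
  tendsto_inv_atTop_zero.comp
    (tendsto_atTop_add_const_left _ _ (tendsto_pow_atTop two_ne_zero))

/-- The integrand is the derivative of e^{L arctan y}/L, and the boundary term at -∞ is dropped. The
gain 1/L makes e^{L arctan x} the right weight for kernels decaying like (1 + y²)⁻¹. -/
theorem integral_Iic_exp_arctan {L : ℝ} (hL : 0 < L) (x : ℝ) :
    IntegrableOn (fun y => Real.exp (L * Real.arctan y) * (1 + y ^ 2)⁻¹) (Set.Iic x) ∧
    ∫ y in Set.Iic x, Real.exp (L * Real.arctan y) * (1 + y ^ 2)⁻¹ ≤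
      L⁻¹ * Real.exp (L * Real.arctan x) := by
  have hd : ∀ y ∈ Set.Iic x, HasDerivAt (fun y => L⁻¹ * Real.exp (L * Real.arctan y))
      (Real.exp (L * Real.arctan y) * (1 + y ^ 2)⁻¹) y := by
    intro y _
    refine ((((Real.hasDerivAt_arctan y).const_mul L).exp).const_mul L⁻¹).congr_deriv ?_
    field_simp
  have hintegr : IntegrableOn (fun y => Real.exp (L * Real.arctan y) * (1 + y ^ 2)⁻¹)
      (Set.Iic x) := by
    refine Integrable.integrableOn ?_
    refine (integrable_inv_one_add_sq.const_mul (Real.exp (L * (Real.pi / 2)))).mono'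
      (Continuous.aestronglyMeasurable ?_) (ae_of_all _ fun y => ?_)
    · have : ∀ y : ℝ, 1 + y ^ 2 ≠ 0 := fun y => by positivity
      fun_prop (disch := exact this _)
    · rw [Real.norm_of_nonneg (by positivity)]
      gcongr
      exact (Real.arctan_lt_pi_div_two y).le
  have hlim : Tendsto (fun y => L⁻¹ * Real.exp (L * Real.arctan y)) atBot
      (𝓝 (L⁻¹ * Real.exp (L * (-(Real.pi / 2))))) := by
    have h : Tendsto Real.arctan atBot (𝓝 (-(Real.pi / 2))) :=
      Real.tendsto_arctan_atBot.mono_right nhdsWithin_le_nhds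
    exact ((Real.continuous_exp.tendsto _).comp (h.const_mul L)).const_mul _
  refine ⟨hintegr, ?_⟩
  rw [integral_Iic_of_hasDerivAt_of_tendsto' hd hintegr hlim]
  have : 0 ≤ L⁻¹ * Real.exp (L * (-(Real.pi / 2))) := by positivity
  linarith

theorem norm_volterra_le_exp_arctan {lam : ℂ} (hl : 0 ≤ lam.im) {φ : ℝ → ℂ} {M L : ℝ}
    (hL : 0 < L) (h : ∀ y, ‖φ y‖ ≤ M * (Real.exp (L * Real.arctan y) * (1 + y ^ 2)⁻¹)) (x : ℝ) :
    ‖volterra lam φ x‖ ≤ M * (L⁻¹ * Real.exp (L * Real.arctan x)) := by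
  have hM : 0 ≤ M := by simpa using (norm_nonneg _).trans (h 0)
  obtain ⟨h1, h2⟩ := integral_Iic_exp_arctan hL x
  refine (norm_volterra_le hl (h1.const_mul M) h).trans ?_
  rw [integral_const_mul]
  exact mul_le_mul_of_nonneg_left h2 hM

/-- Dominated convergence, with the moving endpoint absorbed into an indicator so that the domain of
integration is fixed. -/
theorem continuous_volterra {P : Type*} [TopologicalSpace P] [FirstCountableTopology P]
    {lam : P → ℂ} (hl : Continuous lam) (him : ∀ p, 0 ≤ (lam p).im) {φ : P → ℝ → ℂ}
    (hφ : Continuous (Function.uncurry φ)) {C : ℝ} (hC : ∀ p y, ‖φ p y‖ ≤ C * (1 + y ^ 2)⁻¹) :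
    Continuous fun z : P × ℝ => volterra (lam z.1) (φ z.1) z.2 := by
  have hrw : ∀ z : P × ℝ, volterra (lam z.1) (φ z.1) z.2 =
      ∫ y, (Set.Iic z.2).indicator (fun y : ℝ => exp (2 * I * lam z.1 * (z.2 - y)) * φ z.1 y) y :=
    fun z => (integral_indicator measurableSet_Iic).symm
  have hφp : ∀ p, Continuous (φ p) := fun p => hφ.comp (by fun_prop : Continuous fun y => (p, y))
  simp_rw [hrw]
  refine continuous_iff_continuousAt.2 fun z₀ => ?_
  refine continuousAt_of_dominated (bound := fun y => C * (1 + y ^ 2)⁻¹) ?_ ?_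
    (integrable_inv_one_add_sq.const_mul C) ?_
  · refine Eventually.of_forall fun z => AEStronglyMeasurable.indicator ?_ measurableSet_Iic
    have := hφp z.1
    exact Continuous.aestronglyMeasurable (by fun_prop)
  · refine Eventually.of_forall fun z => ae_of_all _ fun y => ?_
    by_cases hy : y ∈ Set.Iic z.2
    · rw [Set.indicator_of_mem hy, norm_mul]
      exact (mul_le_of_le_one_left (norm_nonneg _) (norm_kernel_le (him _) hy)).trans (hC _ y)
    · rw [Set.indicator_of_notMem hy, norm_zero]
      exact (norm_nonneg _).trans (hC z.1 y)
  -- The indicator is locally constant in the parameter except at the endpoint itself, a null set.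
  · have hne : ∀ᵐ y : ℝ, y ≠ z₀.2 := by simp [ae_iff]
    filter_upwards [hne] with y hy
    have hφy : Continuous fun z : P × ℝ => φ z.1 y :=
      hφ.comp (by fun_prop : Continuous fun z : P × ℝ => (z.1, y))
    rcases lt_or_gt_of_ne hy with hy | hy
    · have hev : ∀ᶠ z : P × ℝ in 𝓝 z₀, y < z.2 :=
        (isOpen_lt continuous_const continuous_snd).mem_nhds hy
      refine ContinuousAt.congr (f := fun z : P × ℝ => exp (2 * I * lam z.1 * (z.2 - y)) * φ z.1 y)
        (by fun_prop) ?_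
      filter_upwards [hev] with z hz
      rw [Set.indicator_of_mem (Set.mem_Iic.2 hz.le)]
    · have hev : ∀ᶠ z : P × ℝ in 𝓝 z₀, z.2 < y :=
        (isOpen_lt continuous_snd continuous_const).mem_nhds hy
      refine ContinuousAt.congr (f := fun z : P × ℝ => (0 : ℂ)) continuousAt_const ?_
      filter_upwards [hev] with z hz
      rw [Set.indicator_of_notMem (by simpa using hz)]

theorem volterra_eq_exp_mul (lam : ℂ) (φ : ℝ → ℂ) (x : ℝ) :
    volterra lam φ x =
      exp (2 * I * lam * x) * ∫ y in Set.Iic x, exp (-(2 * I * lam * y)) * φ y := by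
  rw [volterra, ← integral_const_mul]
  congr 1; ext y
  rw [← mul_assoc, ← Complex.exp_add]
  ring_nf

/-- Factoring out e^{2i lam x} leaves the integral of a function of y alone, to which the
fundamental theorem of calculus applies. -/
theorem hasDerivAt_volterra {lam : ℂ} (hl : 0 ≤ lam.im) {φ : ℝ → ℂ} (hφ : Continuous φ)
    (hi : Integrable φ) (x : ℝ) :
    HasDerivAt (volterra lam φ) (2 * I * lam * volterra lam φ x + φ x) x := by
  set ψ : ℝ → ℂ := fun y => exp (-(2 * I * lam * y)) * φ y with hψ
  have hψc : Continuous ψ := by fun_prop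
  have hψi : ∀ b, IntegrableOn ψ (Set.Iic b) := by
    intro b
    have := (integrableOn_kernel hl hi b).const_mul (exp (-(2 * I * lam * b)))
    refine IntegrableOn.congr_fun this (fun y _ => ?_) measurableSet_Iic
    simp only [hψ, ← mul_assoc, ← Complex.exp_add]
    ring_nf
  have h1 : HasDerivAt (fun b => ∫ y in Set.Iic b, ψ y) (ψ x) x := by
    have h2 : (fun b => ∫ y in Set.Iic b, ψ y) =
        fun b => (∫ y in Set.Iic x, ψ y) + ∫ y in x..b, ψ y := by
      ext b
      rw [← intervalIntegral.integral_Iic_sub_Iic (hψi x) (hψi b)]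
      ring
    rw [h2]
    exact (intervalIntegral.integral_hasDerivAt_right (hψc.intervalIntegrable _ _)
      (hψc.stronglyMeasurableAtFilter _ _) hψc.continuousAt).const_add _
  have h3 : HasDerivAt (fun b : ℝ => exp (2 * I * lam * b)) (2 * I * lam * exp (2 * I * lam * x)) x := by
    have := ((hasDerivAt_id x).ofReal_comp.const_mul (2 * I * lam)).cexp
    simpa [mul_comm] using this
  have h4 := h3.mul h1
  have h5 : volterra lam φ = fun b : ℝ => exp (2 * I * lam * b) * ∫ y in Set.Iic b, ψ y :=
    funext fun b => volterra_eq_exp_mul lam φ b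
  rw [h5]
  refine h4.congr_deriv ?_
  have h6 : exp (2 * I * lam * x) * exp (-(2 * I * lam * x)) = 1 := by
    rw [← Complex.exp_add]; simp
  have h7 : ψ x = exp (-(2 * I * lam * x)) * φ x := rfl
  linear_combination φ x * h6 + exp (2 * I * lam * x) * h7

/-- A function solving `v' = 2 i lam v + φ` which tends to zero at `-∞` is `volterra lam φ`. -/
theorem eq_volterra_of_hasDerivAt {lam : ℂ} (hl : 0 ≤ lam.im) {φ v : ℝ → ℂ}
    (hi : Integrable φ) (hv : ∀ x, HasDerivAt v (2 * I * lam * v x + φ x) x)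
    (h0 : Tendsto v atBot (𝓝 0)) (x : ℝ) : v x = volterra lam φ x := by
  have hd : ∀ y ∈ Set.Iic x, HasDerivAt (fun y : ℝ => exp (2 * I * lam * (x - y)) * v y)
      (exp (2 * I * lam * (x - y)) * φ y) y := by
    intro y _
    have h3 : HasDerivAt (fun y : ℝ => exp (2 * I * lam * (x - y)))
        (-(2 * I * lam) * exp (2 * I * lam * (x - y))) y := by
      have := (((hasDerivAt_id y).ofReal_comp.const_sub (x : ℂ)).const_mul (2 * I * lam)).cexp
      refine this.congr_deriv ?_
      push_cast [id]
      ring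
    refine (h3.mul (hv y)).congr_deriv ?_
    ring
  have hlim : Tendsto (fun y : ℝ => exp (2 * I * lam * (x - y)) * v y) atBot (𝓝 0) := by
    refine squeeze_zero_norm' ?_ (tendsto_zero_iff_norm_tendsto_zero.1 h0)
    filter_upwards [eventually_le_atBot x] with y hy
    rw [norm_mul]
    exact mul_le_of_le_one_left (norm_nonneg _) (norm_kernel_le hl hy)
  have := integral_Iic_of_hasDerivAt_of_tendsto' hd (integrableOn_kernel hl hi x) hlim
  rw [volterra, this]
  simp

/-- Differentiation under the integral sign; holomorphy in z lets Cauchy's estimate replace any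
bound on the z-derivative of φ. -/
theorem differentiableOn_volterra {lam : ℂ → ℂ} (hlam : DifferentiableOn ℂ lam {z | 0 < z.im})
    (him : ∀ z : ℂ, 0 < z.im → 0 ≤ (lam z).im) {φ : ℂ → ℝ → ℂ} {x C : ℝ}
    (hφ : ∀ z, Continuous (φ z))
    (hC : ∀ z y, ‖φ z y‖ ≤ C * (1 + y ^ 2)⁻¹)
    (hd : ∀ y, DifferentiableOn ℂ (fun z => φ z y) {z | 0 < z.im}) :
    DifferentiableOn ℂ (fun z => volterra (lam z) (φ z) x) {z | 0 < z.im} := by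
  have hopen : IsOpen {z : ℂ | 0 < z.im} := isOpen_lt continuous_const Complex.continuous_im
  intro z₀ hz₀
  obtain ⟨r, hr, hball⟩ := Metric.isOpen_iff.1 hopen z₀ hz₀
  set F : ℂ → ℝ → ℂ := fun z y => exp (2 * I * lam z * (x - y)) * φ z y with hF
  have hFd : ∀ y, DifferentiableOn ℂ (fun z => F z y) {z | 0 < z.im} := fun y =>
    DifferentiableOn.mul (by fun_prop) (hd y)
  have hFb : ∀ z ∈ {z : ℂ | 0 < z.im}, ∀ y ∈ Set.Iic x, ‖F z y‖ ≤ C * (1 + y ^ 2)⁻¹ := by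
    intro z hz y hy
    simp only [hF, norm_mul]
    exact (mul_le_of_le_one_left (norm_nonneg _) (norm_kernel_le (him z hz) hy)).trans (hC z y)
  have hFm : ∀ z, Continuous (F z) := fun z => by have := hφ z; fun_prop
  have hr2 : 0 < r / 2 := by positivity
  have hFat : ∀ y, ∀ z ∈ Metric.ball z₀ (r / 2), HasDerivAt (fun z => F z y)
      (deriv (fun z => F z y) z) z := fun y z hz =>
    ((hFd y).differentiableAt (hopen.mem_nhds
      (hball (Metric.ball_subset_ball (by linarith) hz)))).hasDerivAt
  -- The derivative is measurable in y as a pointwise limit of the difference quotients with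
  -- increments 1/(n+1).
  have hmeas : AEStronglyMeasurable (fun y => deriv (fun z => F z y) z₀)
      (volume.restrict (Set.Iic x)) := by
    have hseq : Tendsto (fun n : ℕ => z₀ + (((n : ℝ) + 1)⁻¹ : ℝ)) atTop (𝓝[≠] z₀) := by
      refine tendsto_nhdsWithin_iff.2 ⟨?_, Eventually.of_forall fun n => ?_⟩
      · have h1 : Tendsto (fun n : ℕ => ((((n : ℝ) + 1)⁻¹ : ℝ) : ℂ)) atTop (𝓝 ((0 : ℝ) : ℂ)) := by
          refine (Complex.continuous_ofReal.tendsto 0).comp ?_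
          simpa using tendsto_one_div_add_atTop_nhds_zero_nat (𝕜 := ℝ)
        simpa using h1.const_add z₀
      · have : (((n : ℝ) + 1)⁻¹ : ℝ) ≠ 0 := by positivity
        have h2 := Complex.ofReal_ne_zero.2 this
        rw [Set.mem_compl_singleton_iff]
        exact fun h => h2 (by linear_combination h)
    refine aestronglyMeasurable_of_tendsto_ae atTop
      (f := fun (n : ℕ) y => slope (fun z => F z y) z₀ (z₀ + (((n : ℝ) + 1)⁻¹ : ℝ))) ?_ ?_
    · intro n
      simp only [slope, vsub_eq_sub, smul_eq_mul]
      refine Continuous.aestronglyMeasurable ?_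
      exact continuous_const.mul ((hFm _).sub (hFm _))
    · refine ae_of_all _ fun y => ?_
      exact (hasDerivAt_iff_tendsto_slope.1 (hFat y z₀ (Metric.mem_ball_self hr2))).comp hseq
  -- The bound is Cauchy's estimate on circles of radius r/4. Their centres lie in the ball of
  -- radius r/2, so the discs stay inside the ball of radius r contained in the upper half plane.
  have := hasDerivAt_integral_of_dominated_loc_of_deriv_le
    (μ := volume.restrict (Set.Iic x)) (F := F) (F' := fun z y => deriv (fun z => F z y) z)
    (x₀ := z₀) (bound := fun y => (C * (1 + y ^ 2)⁻¹) / (r / 4))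
    (Metric.ball_mem_nhds z₀ hr2) (Eventually.of_forall fun z => (hFm z).aestronglyMeasurable)
    ?_ hmeas ?_ ?_ ?_
  · exact this.2.differentiableAt.differentiableWithinAt
  · refine (integrable_inv_one_add_sq.const_mul C).integrableOn.mono'
      (hFm z₀).aestronglyMeasurable ?_
    exact (ae_restrict_iff' measurableSet_Iic).2 (ae_of_all _ fun y hy => hFb z₀ hz₀ y hy)
  · refine (ae_restrict_iff' measurableSet_Iic).2 (ae_of_all _ fun y hy z hz => ?_)
    have hsub : Metric.closedBall z (r / 4) ⊆ {z : ℂ | 0 < z.im} := by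
      intro w hw
      refine hball ?_
      rw [Metric.mem_ball] at hz ⊢
      rw [Metric.mem_closedBall] at hw
      linarith [dist_triangle w z z₀]
    refine norm_deriv_le_of_forall_mem_sphere_norm_le (by positivity) ?_ ?_
    · exact (hFd y).diffContOnCl_ball hsub
    · exact fun w hw => hFb w (hsub (Metric.sphere_subset_closedBall hw)) y hy
  · exact ((integrable_inv_one_add_sq.const_mul C).div_const _).integrableOn
  · exact ae_of_all _ fun y z hz => hFat y z hz

/-! ### The Volterra system as a weighted contraction. -/

/-- The retraction of the complex plane onto the closed upper half plane along the imaginary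
direction. -/
def clampUpper (z : ℂ) : ℂ := z.re + (max z.im 0 : ℝ) * I

theorem continuous_clampUpper : Continuous clampUpper := by
  unfold clampUpper
  fun_prop

theorem clampUpper_im_nonneg (z : ℂ) : 0 ≤ (clampUpper z).im := by simp [clampUpper]

theorem clampUpper_of_nonneg {z : ℂ} (hz : 0 ≤ z.im) : clampUpper z = z := by
  apply Complex.ext <;> simp [clampUpper, hz]

theorem volterra_sub {lam : ℂ} (hl : 0 ≤ lam.im) {φ ψ : ℝ → ℂ} (hφ : Integrable φ)
    (hψ : Integrable ψ) (x : ℝ) :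
    volterra lam φ x - volterra lam ψ x = volterra lam (fun y => φ y - ψ y) x := by
  rw [volterra, volterra, ← integral_sub (integrableOn_kernel hl hφ x)
    (integrableOn_kernel hl hψ x), volterra]
  congr 1; ext y; ring

/-- The weight `e^{L arctan x}`. -/
def weight (L : ℝ) (x : ℝ) : ℂ := (Real.exp (L * Real.arctan x) : ℝ)

theorem continuous_weight (L : ℝ) : Continuous (weight L) := by
  unfold weight
  fun_prop

theorem norm_weight (L x : ℝ) : ‖weight L x‖ = Real.exp (L * Real.arctan x) := by
  rw [weight, Complex.norm_real, Real.norm_of_nonneg (Real.exp_pos _).le]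

theorem weight_mul_weight_neg (L x : ℝ) : weight L x * weight (-L) x = 1 := by
  rw [weight, weight, ← Complex.ofReal_mul, ← Real.exp_add]
  simp

theorem norm_weight_le (L x : ℝ) : ‖weight L x‖ ≤ Real.exp (|L| * (Real.pi / 2)) := by
  rw [norm_weight]
  refine Real.exp_le_exp.2 ((le_abs_self _).trans ?_)
  rw [abs_mul]
  gcongr
  exact abs_le.2 ⟨(Real.neg_pi_div_two_lt_arctan x).le, (Real.arctan_lt_pi_div_two x).le⟩

/-- This is where the contraction constant 1/2 arises: with weight exponent 2C, the kernel mass C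
meets the gain 1/(2C). -/
theorem norm_weight_mul_volterra_le {lam : ℂ} (hl : 0 ≤ lam.im) {C B : ℝ} (hC : 0 < C)
    {c φ : ℝ → ℂ} (hc : ∀ y, ‖c y‖ ≤ C * (1 + y ^ 2)⁻¹) (hφ : ∀ y, ‖φ y‖ ≤ B) (x : ℝ) :
    ‖weight (-(2 * C)) x * volterra lam (fun y => c y * (weight (2 * C) y * φ y)) x‖ ≤ B / 2 := by
  have h := norm_volterra_le_exp_arctan hl (φ := fun y => c y * (weight (2 * C) y * φ y))
    (M := C * B) (L := 2 * C) (by positivity) (fun y => by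
      rw [norm_mul, norm_mul, norm_weight]
      calc ‖c y‖ * (Real.exp (2 * C * Real.arctan y) * ‖φ y‖)
          ≤ (C * (1 + y ^ 2)⁻¹) * (Real.exp (2 * C * Real.arctan y) * B) := by
            gcongr
            · exact hc y
            · exact hφ y
        _ = _ := by ring) x
  have h1 : ‖weight (-(2 * C)) x‖ * Real.exp (2 * C * Real.arctan x) = 1 := by
    rw [norm_weight, ← Real.exp_add]; simp
  rw [norm_mul]
  calc _ ≤ ‖weight (-(2 * C)) x‖ * (C * B * ((2 * C)⁻¹ * Real.exp (2 * C * Real.arctan x))) := by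
        gcongr
    _ = C * B * (2 * C)⁻¹ * (‖weight (-(2 * C)) x‖ * Real.exp (2 * C * Real.arctan x)) := by ring
    _ = B / 2 := by rw [h1]; field_simp

/-- The integral operator whose fixed point gives the weighted solution of the Volterra system. -/
def volterraMap (c₁ c₂ : ℝ → ℝ → ℂ) (C : ℝ) (n : (ℝ × ℂ) × ℝ → ℂ × ℂ) (w : (ℝ × ℂ) × ℝ) :
    ℂ × ℂ :=
  (weight (-(2 * C)) w.2 +
    weight (-(2 * C)) w.2 *
      volterra 0 (fun y => c₁ w.1.1 y * (weight (2 * C) y * (n (w.1, y)).2)) w.2,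
   weight (-(2 * C)) w.2 * volterra (clampUpper w.1.2)
      (fun y => c₂ w.1.1 y * (weight (2 * C) y * (n (w.1, y)).1)) w.2)

section System

variable {c₁ c₂ : ℝ → ℝ → ℂ} {C : ℝ}

theorem norm_coeff_mul_weight_le {c φ : ℝ → ℂ} {B : ℝ} (hc : ∀ y, ‖c y‖ ≤ C * (1 + y ^ 2)⁻¹)
    (hφ : ∀ y, ‖φ y‖ ≤ B) (L y : ℝ) :
    ‖c y * (weight L y * φ y)‖ ≤
      C * (Real.exp (|L| * (Real.pi / 2)) * B) * (1 + y ^ 2)⁻¹ := by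
  have hC : 0 ≤ C := by simpa using (norm_nonneg _).trans (hc 0)
  rw [norm_mul, norm_mul]
  calc _ ≤ (C * (1 + y ^ 2)⁻¹) * (Real.exp (|L| * (Real.pi / 2)) * B) := by
        gcongr
        · exact hc y
        · exact norm_weight_le L y
        · exact hφ y
    _ = _ := by ring

theorem continuous_volterraMap (h₁ : Continuous (Function.uncurry c₁))
    (h₂ : Continuous (Function.uncurry c₂)) (b₁ : ∀ t y, ‖c₁ t y‖ ≤ C * (1 + y ^ 2)⁻¹)
    (b₂ : ∀ t y, ‖c₂ t y‖ ≤ C * (1 + y ^ 2)⁻¹) (n : (ℝ × ℂ) × ℝ →ᵇ ℂ × ℂ) :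
    Continuous (volterraMap c₁ c₂ C n) := by
  have hn1 : ∀ w, ‖(n w).1‖ ≤ ‖n‖ := fun w => (norm_fst_le _).trans (n.norm_coe_le_norm w)
  have hn2 : ∀ w, ‖(n w).2‖ ≤ ‖n‖ := fun w => (norm_snd_le _).trans (n.norm_coe_le_norm w)
  have hw := continuous_weight (2 * C)
  have hw' := continuous_weight (-(2 * C))
  have hnc : Continuous n := n.continuous
  have h₁' : Continuous fun w : (ℝ × ℂ) × ℝ => c₁ w.1.1 w.2 :=
    h₁.comp (by fun_prop : Continuous fun w : (ℝ × ℂ) × ℝ => (w.1.1, w.2))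
  have h₂' : Continuous fun w : (ℝ × ℂ) × ℝ => c₂ w.1.1 w.2 :=
    h₂.comp (by fun_prop : Continuous fun w : (ℝ × ℂ) × ℝ => (w.1.1, w.2))
  have e1 := continuous_volterra (P := ℝ × ℂ) (lam := fun _ => 0) continuous_const (by simp)
    (φ := fun p y => c₁ p.1 y * (weight (2 * C) y * (n (p, y)).2))
    (h₁'.mul ((hw.comp continuous_snd).mul (continuous_snd.comp hnc)))
    (fun p y => norm_coeff_mul_weight_le (φ := fun y => (n (p, y)).2) (b₁ p.1)
      (fun y => hn2 (p, y)) (2 * C) y)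
  have e2 := continuous_volterra (P := ℝ × ℂ) (lam := fun p => clampUpper p.2)
    (continuous_clampUpper.comp continuous_snd) (fun p => clampUpper_im_nonneg _)
    (φ := fun p y => c₂ p.1 y * (weight (2 * C) y * (n (p, y)).1))
    (h₂'.mul ((hw.comp continuous_snd).mul (continuous_fst.comp hnc)))
    (fun p y => norm_coeff_mul_weight_le (φ := fun y => (n (p, y)).1) (b₂ p.1)
      (fun y => hn1 (p, y)) (2 * C) y)
  have hw2 := hw'.comp (continuous_snd (X := ℝ × ℂ) (Y := ℝ))
  exact (hw2.add (hw2.mul e1)).prodMk (hw2.mul e2)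

theorem norm_volterraMap_le (hC : 0 < C) (b₁ : ∀ t y, ‖c₁ t y‖ ≤ C * (1 + y ^ 2)⁻¹)
    (b₂ : ∀ t y, ‖c₂ t y‖ ≤ C * (1 + y ^ 2)⁻¹) (n : (ℝ × ℂ) × ℝ →ᵇ ℂ × ℂ) (w : (ℝ × ℂ) × ℝ) :
    ‖volterraMap c₁ c₂ C n w‖ ≤ Real.exp (|-(2 * C)| * (Real.pi / 2)) + ‖n‖ / 2 := by
  have hn1 : ∀ w, ‖(n w).1‖ ≤ ‖n‖ := fun w => (norm_fst_le _).trans (n.norm_coe_le_norm w)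
  have hn2 : ∀ w, ‖(n w).2‖ ≤ ‖n‖ := fun w => (norm_snd_le _).trans (n.norm_coe_le_norm w)
  refine norm_prod_le_iff.2 ⟨?_, ?_⟩
  · refine (norm_add_le _ _).trans (add_le_add (norm_weight_le _ _) ?_)
    exact norm_weight_mul_volterra_le (by simp) hC (b₁ _) (fun y => hn2 (w.1, y)) _
  · refine (norm_weight_mul_volterra_le (clampUpper_im_nonneg _) hC (b₂ _)
      (fun y => hn1 (w.1, y)) _).trans ?_
    linarith [Real.exp_pos (|-(2 * C)| * (Real.pi / 2))]

/-- A linear Volterra system with an oscillating kernel has a bounded solution which depends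
continuously on all parameters and holomorphically on the spectral parameter. -/
theorem exists_volterra_system (hC : 0 < C) (h₁ : Continuous (Function.uncurry c₁))
    (h₂ : Continuous (Function.uncurry c₂)) (b₁ : ∀ t y, ‖c₁ t y‖ ≤ C * (1 + y ^ 2)⁻¹)
    (b₂ : ∀ t y, ‖c₂ t y‖ ≤ C * (1 + y ^ 2)⁻¹) :
    ∃ f h : ℝ → ℂ → ℝ → ℂ,
      Continuous (fun p : (ℝ × ℂ) × ℝ => f p.1.1 p.1.2 p.2) ∧
      Continuous (fun p : (ℝ × ℂ) × ℝ => h p.1.1 p.1.2 p.2) ∧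
      (∃ M, ∀ t z x, ‖f t z x‖ ≤ M ∧ ‖h t z x‖ ≤ M) ∧
      (∀ t z x, f t z x = 1 + volterra 0 (fun y => c₁ t y * h t z y) x) ∧
      (∀ t z x, h t z x = volterra (clampUpper z) (fun y => c₂ t y * f t z y) x) ∧
      (∀ t x, DifferentiableOn ℂ (fun z => f t z x) {z | 0 < z.im}) ∧
      (∀ t x, DifferentiableOn ℂ (fun z => h t z x) {z | 0 < z.im}) := by
  set T : ((ℝ × ℂ) × ℝ →ᵇ ℂ × ℂ) → ((ℝ × ℂ) × ℝ →ᵇ ℂ × ℂ) := fun n =>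
    BoundedContinuousFunction.ofNormedAddCommGroup (volterraMap c₁ c₂ C n)
      (continuous_volterraMap h₁ h₂ b₁ b₂ n) _ (norm_volterraMap_le hC b₁ b₂ n) with hTdef
  have hTapp : ∀ n w, T n w = volterraMap c₁ c₂ C n w := fun n w => rfl
  have hc₁ : ∀ t, Continuous (c₁ t) := fun t => h₁.comp (by fun_prop : Continuous fun y => (t, y))
  have hc₂ : ∀ t, Continuous (c₂ t) := fun t => h₂.comp (by fun_prop : Continuous fun y => (t, y))
  have hn1 : ∀ (n : (ℝ × ℂ) × ℝ →ᵇ ℂ × ℂ) w, ‖(n w).1‖ ≤ ‖n‖ :=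
    fun n w => (norm_fst_le _).trans (n.norm_coe_le_norm w)
  have hn2 : ∀ (n : (ℝ × ℂ) × ℝ →ᵇ ℂ × ℂ) w, ‖(n w).2‖ ≤ ‖n‖ :=
    fun n w => (norm_snd_le _).trans (n.norm_coe_le_norm w)
  have hcn1 : ∀ (n : (ℝ × ℂ) × ℝ →ᵇ ℂ × ℂ) p, Continuous fun y => (n (p, y)).1 := fun n p =>
    continuous_fst.comp (n.continuous.comp (by fun_prop : Continuous fun y : ℝ => (p, y)))
  have hcn2 : ∀ (n : (ℝ × ℂ) × ℝ →ᵇ ℂ × ℂ) p, Continuous fun y => (n (p, y)).2 := fun n p =>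
    continuous_snd.comp (n.continuous.comp (by fun_prop : Continuous fun y : ℝ => (p, y)))
  have hw := continuous_weight (2 * C)
  have hK1 : ∀ (n : (ℝ × ℂ) × ℝ →ᵇ ℂ × ℂ) t p,
      Continuous fun y => c₂ t y * (weight (2 * C) y * (n (p, y)).1) := fun n t p =>
    (hc₂ t).mul (hw.mul (hcn1 n p))
  have hK2 : ∀ (n : (ℝ × ℂ) × ℝ →ᵇ ℂ × ℂ) t p,
      Continuous fun y => c₁ t y * (weight (2 * C) y * (n (p, y)).2) := fun n t p =>
    (hc₁ t).mul (hw.mul (hcn2 n p))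
  have hi1 : ∀ (n : (ℝ × ℂ) × ℝ →ᵇ ℂ × ℂ) t p,
      Integrable fun y => c₂ t y * (weight (2 * C) y * (n (p, y)).1) := fun n t p =>
    integrable_of_decay (hK1 n t p) (norm_coeff_mul_weight_le (φ := fun y => (n (p, y)).1) (b₂ t)
      (fun y => hn1 n (p, y)) (2 * C))
  have hi2 : ∀ (n : (ℝ × ℂ) × ℝ →ᵇ ℂ × ℂ) t p,
      Integrable fun y => c₁ t y * (weight (2 * C) y * (n (p, y)).2) := fun n t p =>
    integrable_of_decay (hK2 n t p) (norm_coeff_mul_weight_le (φ := fun y => (n (p, y)).2) (b₁ t)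
      (fun y => hn2 n (p, y)) (2 * C))
  have hcontr : ContractingWith (1 / 2) T := by
    refine ⟨by rw [← NNReal.coe_lt_coe]; norm_num, LipschitzWith.of_dist_le_mul fun n m => ?_⟩
    have hB : 0 ≤ ((1 / 2 : NNReal) : ℝ) * dist n m := by positivity
    refine (BoundedContinuousFunction.dist_le hB).2 fun w => ?_
    have hd : ∀ v, ‖(n v - m v)‖ ≤ dist n m := fun v => by
      rw [← dist_eq_norm]; exact BoundedContinuousFunction.dist_coe_le_dist v
    rw [hTapp, hTapp, dist_eq_norm]
    have hhalf : ((1 / 2 : NNReal) : ℝ) * dist n m = dist n m / 2 := by push_cast; ring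
    rw [hhalf]
    refine norm_prod_le_iff.2 ⟨?_, ?_⟩
    · simp only [volterraMap, Prod.fst_sub, add_sub_add_left_eq_sub, ← mul_sub]
      rw [volterra_sub (by simp) (hi2 n _ _) (hi2 m _ _)]
      simp only [← mul_sub]
      exact norm_weight_mul_volterra_le (φ := fun y => (n (w.1, y)).2 - (m (w.1, y)).2) (by simp) hC
        (b₁ w.1.1) (fun y => (norm_snd_le (n (w.1, y) - m (w.1, y))).trans (hd (w.1, y))) w.2
    · simp only [volterraMap, Prod.snd_sub, ← mul_sub]
      rw [volterra_sub (clampUpper_im_nonneg _) (hi1 n _ _) (hi1 m _ _)]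
      simp only [← mul_sub]
      exact norm_weight_mul_volterra_le (φ := fun y => (n (w.1, y)).1 - (m (w.1, y)).1)
        (clampUpper_im_nonneg _) hC
        (b₂ w.1.1) (fun y => (norm_fst_le (n (w.1, y) - m (w.1, y))).trans (hd (w.1, y))) w.2
  set n₀ := ContractingWith.fixedPoint T hcontr with hn₀
  have hfix : ∀ w, n₀ w = volterraMap c₁ c₂ C n₀ w := fun w => by
    have h : T n₀ = n₀ := hcontr.fixedPoint_isFixedPt
    rw [← hTapp, h]
  have hcl : ∀ z : ℂ, 0 < z.im → 0 ≤ (clampUpper z).im := fun z _ => clampUpper_im_nonneg z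
  have hclD : DifferentiableOn ℂ clampUpper {z | 0 < z.im} :=
    differentiableOn_id.congr fun z hz => clampUpper_of_nonneg (le_of_lt hz)
  -- Continuity in all parameters is built into the space in which the fixed point is taken, but
  -- holomorphy is not. It holds for every Picard iterate started at 0 and passes to the uniform
  -- limit.
  have hanal : ∀ k : ℕ, ∀ t x,
      DifferentiableOn ℂ (fun z => ((T^[k] 0) ((t, z), x)).1) {z | 0 < z.im} ∧
      DifferentiableOn ℂ (fun z => ((T^[k] 0) ((t, z), x)).2) {z | 0 < z.im} := by
    intro k
    induction k with
    | zero => intro t x; exact ⟨differentiableOn_const 0, differentiableOn_const 0⟩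
    | succ k ih =>
      intro t x
      rw [Function.iterate_succ_apply']
      set n := T^[k] 0
      simp only [hTapp, volterraMap]
      constructor
      · refine (differentiableOn_const _).add ((differentiableOn_const _).mul ?_)
        refine differentiableOn_volterra (differentiableOn_const _) (by simp)
          (φ := fun z y => c₁ t y * (weight (2 * C) y * (n ((t, z), y)).2))
          (fun z => hK2 n t (t, z))
          (fun z => norm_coeff_mul_weight_le (φ := fun y => (n ((t, z), y)).2) (b₁ t)
            (fun y => hn2 n _) (2 * C)) fun y => ?_
        exact (differentiableOn_const _).mul ((differentiableOn_const _).mul (ih t y).2)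
      · refine (differentiableOn_const _).mul ?_
        refine differentiableOn_volterra hclD hcl
          (φ := fun z y => c₂ t y * (weight (2 * C) y * (n ((t, z), y)).1))
          (fun z => hK1 n t (t, z))
          (fun z => norm_coeff_mul_weight_le (φ := fun y => (n ((t, z), y)).1) (b₂ t)
            (fun y => hn1 n _) (2 * C)) fun y => ?_
        exact (differentiableOn_const _).mul ((differentiableOn_const _).mul (ih t y).1)
  have hunif := BoundedContinuousFunction.tendsto_iff_tendstoUniformly.1
    (hcontr.tendsto_iterate_fixedPoint 0)
  have hopen : IsOpen {z : ℂ | 0 < z.im} := isOpen_lt continuous_const Complex.continuous_im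
  have hA1 : ∀ t x, DifferentiableOn ℂ (fun z => (n₀ ((t, z), x)).1) {z | 0 < z.im} := by
    intro t x
    refine TendstoLocallyUniformlyOn.differentiableOn (φ := atTop)
      (F := fun k z => ((T^[k] 0) ((t, z), x)).1) ?_
      (Eventually.of_forall fun k => (hanal k t x).1) hopen
    have h1 := (uniformContinuous_fst (α := ℂ) (β := ℂ)).comp_tendstoUniformly hunif
    exact (h1.comp (fun z : ℂ => ((t, z), x))).tendstoLocallyUniformly.tendstoLocallyUniformlyOn
  have hA2 : ∀ t x, DifferentiableOn ℂ (fun z => (n₀ ((t, z), x)).2) {z | 0 < z.im} := by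
    intro t x
    refine TendstoLocallyUniformlyOn.differentiableOn (φ := atTop)
      (F := fun k z => ((T^[k] 0) ((t, z), x)).2) ?_
      (Eventually.of_forall fun k => (hanal k t x).2) hopen
    have h1 := (uniformContinuous_snd (α := ℂ) (β := ℂ)).comp_tendstoUniformly hunif
    exact (h1.comp (fun z : ℂ => ((t, z), x))).tendstoLocallyUniformly.tendstoLocallyUniformlyOn
  -- The fixed point solves the system conjugated by the weight; multiplying the weight back gives
  -- the solution proper.
  refine ⟨fun t z x => weight (2 * C) x * (n₀ ((t, z), x)).1,
    fun t z x => weight (2 * C) x * (n₀ ((t, z), x)).2, ?_, ?_, ?_, ?_, ?_, ?_, ?_⟩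
  · exact (hw.comp continuous_snd).mul (continuous_fst.comp n₀.continuous)
  · exact (hw.comp continuous_snd).mul (continuous_snd.comp n₀.continuous)
  · refine ⟨Real.exp (|2 * C| * (Real.pi / 2)) * ‖n₀‖, fun t z x => ⟨?_, ?_⟩⟩
    · rw [norm_mul]
      exact mul_le_mul (norm_weight_le _ _) (hn1 n₀ _) (norm_nonneg _) (by positivity)
    · rw [norm_mul]
      exact mul_le_mul (norm_weight_le _ _) (hn2 n₀ _) (norm_nonneg _) (by positivity)
  · intro t z x
    have h := congrArg Prod.fst (hfix ((t, z), x))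
    simp only [volterraMap] at h
    simp only
    rw [h, ← mul_one_add, ← mul_assoc, weight_mul_weight_neg, one_mul]
  · intro t z x
    have h := congrArg Prod.snd (hfix ((t, z), x))
    simp only [volterraMap] at h
    simp only
    rw [h, ← mul_assoc, weight_mul_weight_neg, one_mul]
  · exact fun t x => (differentiableOn_const _).mul (hA1 t x)
  · exact fun t x => (differentiableOn_const _).mul (hA2 t x)

end System

/-! ### Grönwall's lemma and families of decaying potentials. -/

/-- Grönwall's lemma on a left half line. -/
theorem eq_zero_of_le_integral_Iic {u : ℝ → ℝ} (hu : Continuous u) (h0 : ∀ x, 0 ≤ u x) {B C : ℝ}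
    (hB : ∀ x, u x ≤ B) (hC : 0 < C)
    (h : ∀ x, u x ≤ ∫ y in Set.Iic x, C * (1 + y ^ 2)⁻¹ * u y) (x : ℝ) : u x = 0 := by
  -- With this exponent each application of the integral inequality halves the constant in front of
  -- e^{L arctan x}. The factor e^{Lπ/2} in `key` makes the zeroth bound hold where the weight is
  -- smallest.
  set L := 2 * C with hL
  have hB0 : 0 ≤ B := (h0 0).trans (hB 0)
  have key : ∀ n : ℕ, ∀ x, u x ≤
      (1 / 2) ^ n * (B * Real.exp (L * (Real.pi / 2))) * Real.exp (L * Real.arctan x) := by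
    intro n
    induction n with
    | zero =>
      intro x
      have : 1 ≤ Real.exp (L * (Real.pi / 2)) * Real.exp (L * Real.arctan x) := by
        rw [← Real.exp_add]
        refine Real.one_le_exp ?_
        have := (Real.neg_pi_div_two_lt_arctan x).le
        rw [← mul_add]
        exact mul_nonneg (by positivity) (by linarith)
      calc u x ≤ B * 1 := by simpa using hB x
        _ ≤ B * (Real.exp (L * (Real.pi / 2)) * Real.exp (L * Real.arctan x)) := by gcongr
        _ = _ := by ring
    | succ n ih =>
      intro x
      set D := (1 / 2) ^ n * (B * Real.exp (L * (Real.pi / 2))) with hD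
      obtain ⟨h1, h2⟩ := integral_Iic_exp_arctan (L := L) (by positivity) x
      refine (h x).trans ?_
      calc ∫ y in Set.Iic x, C * (1 + y ^ 2)⁻¹ * u y
          ≤ ∫ y in Set.Iic x, C * D * (Real.exp (L * Real.arctan y) * (1 + y ^ 2)⁻¹) := by
            refine setIntegral_mono ?_ (h1.const_mul _) fun y => ?_
            · have hi : Integrable fun y : ℝ => C * (1 + y ^ 2)⁻¹ * B :=
                (integrable_inv_one_add_sq.const_mul C).mul_const B
              refine (hi.mono' ?_ (ae_of_all _ fun y => ?_)).integrableOn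
              · have : ∀ y : ℝ, 1 + y ^ 2 ≠ 0 := fun y => by positivity
                exact Continuous.aestronglyMeasurable (by fun_prop (disch := exact this _))
              · rw [Real.norm_of_nonneg (by have := h0 y; positivity)]
                gcongr
                exact hB y
            · have := ih y
              calc C * (1 + y ^ 2)⁻¹ * u y
                  ≤ C * (1 + y ^ 2)⁻¹ * (D * Real.exp (L * Real.arctan y)) := by gcongr
                _ = _ := by ring
        _ ≤ C * D * (L⁻¹ * Real.exp (L * Real.arctan x)) := by
            rw [integral_const_mul]; gcongr
        _ = _ := by rw [pow_succ, hD, hL]; field_simp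
  refine le_antisymm ?_ (h0 x)
  have ht : Tendsto (fun n : ℕ => (1 / 2 : ℝ) ^ n * (B * Real.exp (L * (Real.pi / 2))) *
      Real.exp (L * Real.arctan x)) atTop (𝓝 0) := by
    have := ((tendsto_pow_atTop_nhds_zero_of_lt_one (by norm_num : (0 : ℝ) ≤ 1 / 2)
      (by norm_num)).mul_const (B * Real.exp (L * (Real.pi / 2)))).mul_const
      (Real.exp (L * Real.arctan x))
    simpa using this
  exact ge_of_tendsto' ht fun n => key n x

/-- A one-parameter family of twice differentiable potentials decaying like `(1 + x²)⁻¹`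
together with their first two derivatives. -/
structure PotentialFamily (Q Q' Q'' : ℝ → ℝ → ℂ) (C : ℝ) : Prop where
  pos : 0 < C
  cont : Continuous (Function.uncurry Q)
  cont' : Continuous (Function.uncurry Q')
  cont'' : ∀ t, Continuous (Q'' t)
  deriv : ∀ t x, HasDerivAt (Q t) (Q' t x) x
  deriv' : ∀ t x, HasDerivAt (Q' t) (Q'' t x) x
  bound : ∀ t x, ‖Q t x‖ ≤ C * (1 + x ^ 2)⁻¹
  bound' : ∀ t x, ‖Q' t x‖ ≤ C * (1 + x ^ 2)⁻¹
  bound'' : ∀ t x, ‖Q'' t x‖ ≤ C * (1 + x ^ 2)⁻¹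

theorem inv_one_add_sq_le_one (x : ℝ) : (1 + x ^ 2)⁻¹ ≤ 1 :=
  inv_le_one_of_one_le₀ (by nlinarith [sq_nonneg x])

theorem le_of_decay {a C x : ℝ} (hC : 0 ≤ C) (h : a ≤ C * (1 + x ^ 2)⁻¹) : a ≤ C :=
  h.trans (mul_le_of_le_one_right hC (inv_one_add_sq_le_one x))

theorem tendsto_zero_atBot_of_decay {φ : ℝ → ℂ} {C : ℝ} (h : ∀ x, ‖φ x‖ ≤ C * (1 + x ^ 2)⁻¹) :
    Tendsto φ atBot (𝓝 0) :=
  squeeze_zero_norm h (by simpa using tendsto_inv_one_add_sq_atBot.const_mul C)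

theorem tendsto_zero_atTop_of_decay {φ : ℝ → ℂ} {C : ℝ} (h : ∀ x, ‖φ x‖ ≤ C * (1 + x ^ 2)⁻¹) :
    Tendsto φ atTop (𝓝 0) :=
  squeeze_zero_norm h (by simpa using tendsto_inv_one_add_sq_atTop.const_mul C)

namespace PotentialFamily

variable {Q Q' Q'' : ℝ → ℝ → ℂ} {C : ℝ}

theorem cont_x (hQ : PotentialFamily Q Q' Q'' C) (t : ℝ) : Continuous (Q t) :=
  hQ.cont.comp (by fun_prop : Continuous fun y => (t, y))

theorem cont_x' (hQ : PotentialFamily Q Q' Q'' C) (t : ℝ) : Continuous (Q' t) :=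
  hQ.cont'.comp (by fun_prop : Continuous fun y => (t, y))

theorem norm_le (hQ : PotentialFamily Q Q' Q'' C) (t x : ℝ) : ‖Q t x‖ ≤ C :=
  le_of_decay hQ.pos.le (hQ.bound t x)

theorem norm_le' (hQ : PotentialFamily Q Q' Q'' C) (t x : ℝ) : ‖Q' t x‖ ≤ C :=
  le_of_decay hQ.pos.le (hQ.bound' t x)

/-- The reflected family `x ↦ Q (-x)`. -/
theorem reflect (hQ : PotentialFamily Q Q' Q'' C) :
    PotentialFamily (fun t x => Q t (-x)) (fun t x => -Q' t (-x)) (fun t x => Q'' t (-x)) C where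
  pos := hQ.pos
  cont := hQ.cont.comp (by fun_prop : Continuous fun p : ℝ × ℝ => (p.1, -p.2))
  cont' := (hQ.cont'.comp (by fun_prop : Continuous fun p : ℝ × ℝ => (p.1, -p.2))).neg
  cont'' t := (hQ.cont'' t).comp continuous_neg
  deriv t x := by
    have := (hQ.deriv t (-x)).scomp x (hasDerivAt_neg x)
    simpa [Function.comp_def] using this
  deriv' t x := by
    have := ((hQ.deriv' t (-x)).scomp x (hasDerivAt_neg x)).neg
    exact this.congr_deriv (by simp)
  bound t x := by simpa using hQ.bound t (-x)
  bound' t x := by simpa using hQ.bound' t (-x)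
  bound'' t x := by simpa using hQ.bound'' t (-x)

end PotentialFamily

/-! ### The Jost column normalized at -∞. -/

/-- The half mass `∫_{-∞}^x σ |Q|² / 2` to the left of `x`. -/
def leftPhase (σ : ℝ) (Q : ℝ → ℂ) (x : ℝ) : ℝ := ∫ y in Set.Iic x, σ * ‖Q y‖ ^ 2 / 2

theorem ofReal_leftPhase (σ : ℝ) (Q : ℝ → ℂ) (x : ℝ) :
    (leftPhase σ Q x : ℂ) = volterra 0 (fun y => σ * conj (Q y) * Q y / 2) x := by
  rw [leftPhase, ← integral_complex_ofReal, volterra]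
  congr 1; ext y
  simp only [mul_zero, zero_mul, Complex.exp_zero, one_mul, mul_assoc, Complex.conj_mul']
  push_cast
  ring

/-- The coefficient of the system satisfied by the gauge-transformed Jost column. -/
def coeffW (σ : ℝ) (Q Q' : ℝ → ℝ → ℂ) (t x : ℝ) : ℂ :=
  σ * conj (Q' t x) - (I / 2) * (σ * conj (Q t x) * Q t x) * (σ * conj (Q t x))

/-- The `x`-derivative of `coeffW`. -/
def coeffW' (σ : ℝ) (Q Q' Q'' : ℝ → ℝ → ℂ) (t x : ℝ) : ℂ :=
  σ * conj (Q'' t x) - (I / 2) * σ ^ 2 *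
    (2 * conj (Q t x) * conj (Q' t x) * Q t x + conj (Q t x) ^ 2 * Q' t x)

section coeff

variable {σ : ℝ} {Q Q' Q'' : ℝ → ℝ → ℂ} {C : ℝ}

theorem HasDerivAt.conj {f : ℝ → ℂ} {f' : ℂ} {x : ℝ} (h : HasDerivAt f f' x) :
    HasDerivAt (fun y => conj (f y)) (conj f') x := by
  have := h.star
  simpa using this

theorem hasDerivAt_coeffW (hQ : PotentialFamily Q Q' Q'' C) (t x : ℝ) :
    HasDerivAt (coeffW σ Q Q' t) (coeffW' σ Q Q' Q'' t x) x := by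
  have h1 := hQ.deriv t x
  have h2 := HasDerivAt.conj h1
  have h3 := HasDerivAt.conj (hQ.deriv' t x)
  refine ((h3.const_mul (σ : ℂ)).sub ((((h2.const_mul (σ : ℂ)).mul h1).const_mul (I / 2)).mul
    (h2.const_mul (σ : ℂ)))).congr_deriv ?_
  simp only [coeffW', Pi.mul_apply]
  ring

theorem norm_coeffW_le (hσ : |σ| = 1) (hQ : PotentialFamily Q Q' Q'' C) (t x : ℝ) :
    ‖coeffW σ Q Q' t x‖ ≤ (C + C ^ 3) * (1 + x ^ 2)⁻¹ := by
  have hσ' : ‖(σ : ℂ)‖ = 1 := by rw [Complex.norm_real, Real.norm_eq_abs, hσ]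
  have h1 := hQ.bound t x
  have h2 := hQ.bound' t x
  have h3 := hQ.norm_le t x
  have hC := hQ.pos
  refine (norm_sub_le _ _).trans ?_
  simp only [norm_mul, norm_div, RCLike.norm_conj, hσ', Complex.norm_I, one_mul, Complex.norm_ofNat]
  have h4 : ‖Q t x‖ * ‖Q t x‖ * ‖Q t x‖ ≤ C * C * (C * (1 + x ^ 2)⁻¹) := by gcongr
  have h5 : 0 ≤ C * C * (C * (1 + x ^ 2)⁻¹) := by positivity
  nlinarith

theorem norm_coeffW'_le (hσ : |σ| = 1) (hQ : PotentialFamily Q Q' Q'' C) (t x : ℝ) :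
    ‖coeffW' σ Q Q' Q'' t x‖ ≤ (C + 2 * C ^ 3) * (1 + x ^ 2)⁻¹ := by
  have hσ' : ‖(σ : ℂ)‖ = 1 := by rw [Complex.norm_real, Real.norm_eq_abs, hσ]
  have h1 := hQ.bound t x
  have h2 := hQ.bound'' t x
  have h3 := hQ.norm_le t x
  have h3' := hQ.norm_le' t x
  have hC := hQ.pos
  refine (norm_sub_le _ _).trans ?_
  simp only [norm_mul, norm_div, norm_pow, RCLike.norm_conj, hσ', Complex.norm_I, one_mul, one_pow,
    Complex.norm_ofNat, mul_one]
  have h4 : ‖2 * conj (Q t x) * conj (Q' t x) * Q t x + conj (Q t x) ^ 2 * Q' t x‖ ≤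
      3 * (C * C * (C * (1 + x ^ 2)⁻¹)) := by
    refine (norm_add_le _ _).trans ?_
    simp only [norm_mul, norm_pow, RCLike.norm_conj, Complex.norm_ofNat]
    have h4 : ‖Q t x‖ * ‖Q' t x‖ * ‖Q t x‖ ≤ C * C * (C * (1 + x ^ 2)⁻¹) := by gcongr
    nlinarith
  have h5 : 0 ≤ C * C * (C * (1 + x ^ 2)⁻¹) := by positivity
  nlinarith

end coeff

/-- `f, g, h` are the components of the Jost column normalized at `-∞` for the family `Q`:
`f` and `k g` are its two entries and `h = 2 i z g + σ Q̄ f`, where `z = k²`. -/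
structure IsJost (σ : ℝ) (Q : ℝ → ℝ → ℂ) (f g h : ℝ → ℂ → ℝ → ℂ) : Prop where
  cont_f : Continuous fun p : (ℝ × ℂ) × ℝ => f p.1.1 p.1.2 p.2
  cont_g : Continuous fun p : (ℝ × ℂ) × ℝ => g p.1.1 p.1.2 p.2
  cont_h : Continuous fun p : (ℝ × ℂ) × ℝ => h p.1.1 p.1.2 p.2
  bound : ∃ M, ∀ t z x, ‖f t z x‖ ≤ M ∧ ‖g t z x‖ ≤ M
  deriv_f : ∀ t z x, 0 ≤ z.im → HasDerivAt (f t z)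
    (-(I / 2) * (σ * conj (Q t x) * Q t x) * f t z x + z * Q t x * g t z x) x
  deriv_g : ∀ t z x, 0 ≤ z.im → HasDerivAt (g t z)
    (2 * I * z * g t z x + σ * conj (Q t x) * f t z x +
      (I / 2) * (σ * conj (Q t x) * Q t x) * g t z x) x
  rel : ∀ t z x, 0 ≤ z.im → h t z x = 2 * I * z * g t z x + σ * conj (Q t x) * f t z x
  lim_f : ∀ t z, 0 ≤ z.im → Tendsto (f t z) atBot (𝓝 1)
  lim_g : ∀ t z, 0 ≤ z.im → Tendsto (g t z) atBot (𝓝 0)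
  hol_f : ∀ t x, DifferentiableOn ℂ (fun z => f t z x) {z | 0 < z.im}
  hol_g : ∀ t x, DifferentiableOn ℂ (fun z => g t z x) {z | 0 < z.im}
  hol_h : ∀ t x, DifferentiableOn ℂ (fun z => h t z x) {z | 0 < z.im}
  asymp : ∃ M, ∀ t z x, 0 ≤ z.im → ‖z‖ * ‖h t z x‖ ≤ M ∧ ‖z‖ * ‖f t z x - 1‖ ≤ M

theorem norm_exp_I_mul_ofReal' (r : ℝ) : ‖exp (I * r)‖ = 1 := by
  rw [mul_comm]; exact Complex.norm_exp_ofReal_mul_I r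

section leftPhase

variable {σ : ℝ} {Q Q' Q'' : ℝ → ℝ → ℂ} {C : ℝ}

theorem norm_density_le (hσ : |σ| = 1) (hQ : PotentialFamily Q Q' Q'' C) (t y : ℝ) :
    ‖σ * conj (Q t y) * Q t y / 2‖ ≤ C ^ 2 * (1 + y ^ 2)⁻¹ := by
  have hσ' : ‖(σ : ℂ)‖ = 1 := by rw [Complex.norm_real, Real.norm_eq_abs, hσ]
  have hC := hQ.pos
  have h1 := hQ.bound t y
  have h2 := hQ.norm_le t y
  simp only [norm_mul, norm_div, RCLike.norm_conj, hσ', one_mul, Complex.norm_ofNat]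
  have h4 : ‖Q t y‖ * ‖Q t y‖ ≤ C * (C * (1 + y ^ 2)⁻¹) := by gcongr
  nlinarith [mul_nonneg (norm_nonneg (Q t y)) (norm_nonneg (Q t y))]

theorem continuous_density (hQ : PotentialFamily Q Q' Q'' C) :
    Continuous fun w : ℝ × ℝ => σ * conj (Q w.1 w.2) * Q w.1 w.2 / 2 := by
  have hQ2 : Continuous fun w : ℝ × ℝ => Q w.1 w.2 := hQ.cont
  fun_prop

theorem hasDerivAt_leftPhase (hσ : |σ| = 1) (hQ : PotentialFamily Q Q' Q'' C) (t x : ℝ) :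
    HasDerivAt (fun y => (leftPhase σ (Q t) y : ℂ)) (σ * conj (Q t x) * Q t x / 2) x := by
  have hpc : Continuous fun y => σ * conj (Q t y) * Q t y / 2 := by
    have := hQ.cont_x t
    fun_prop
  have h1 := hasDerivAt_volterra (lam := 0) (by simp) hpc
    (integrable_of_decay hpc (norm_density_le hσ hQ t)) x
  have h2 : (fun y => (leftPhase σ (Q t) y : ℂ)) =
      volterra 0 (fun y => σ * conj (Q t y) * Q t y / 2) :=
    funext fun x => ofReal_leftPhase σ (Q t) x
  rw [h2]
  refine h1.congr_deriv ?_
  ring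

theorem continuous_leftPhase (hσ : |σ| = 1) (hQ : PotentialFamily Q Q' Q'' C) :
    Continuous fun w : ℝ × ℝ => (leftPhase σ (Q w.1) w.2 : ℂ) := by
  have h1 := continuous_volterra (P := ℝ) (lam := fun _ => 0) continuous_const (by simp)
    (φ := fun t y => σ * conj (Q t y) * Q t y / 2) (continuous_density hQ) (norm_density_le hσ hQ)
  exact h1.congr fun w => (ofReal_leftPhase σ (Q w.1) w.2).symm

theorem tendsto_leftPhase (hσ : |σ| = 1) (hQ : PotentialFamily Q Q' Q'' C) (t : ℝ) :
    Tendsto (fun x => (leftPhase σ (Q t) x : ℂ)) atBot (𝓝 0) :=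
  (tendsto_volterra_atBot (lam := 0) (by simp) (norm_density_le hσ hQ t)).congr fun x =>
    (ofReal_leftPhase σ (Q t) x).symm

end leftPhase

theorem volterra_const_mul (lam c : ℂ) (φ : ℝ → ℂ) (x : ℝ) :
    volterra lam (fun y => c * φ y) x = c * volterra lam φ x := by
  rw [volterra, volterra, ← integral_const_mul]
  congr 1; ext y; ring

/-- The unknowns f and h = 2izg + σQ̄f satisfy f' = -(i/2)Qh and h' = 2izh + Wf, with W = `coeffW`
free of z. The price is one derivative of Q in W, and a second one in the integration by parts. This
system is solved first; g is then recovered by its own Volterra integral, which avoids dividing by z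
at z = 0. -/
theorem exists_isJost {σ : ℝ} (hσ : |σ| = 1) {Q Q' Q'' : ℝ → ℝ → ℂ} {C : ℝ}
    (hQ : PotentialFamily Q Q' Q'' C) : ∃ f g h, IsJost σ Q f g h := by
  have hσ' : ‖(σ : ℂ)‖ = 1 := by rw [Complex.norm_real, Real.norm_eq_abs, hσ]
  have hC := hQ.pos
  have hQc := hQ.cont
  have hQ'c := hQ.cont'
  have hQ2 : Continuous fun w : ℝ × ℝ => Q w.1 w.2 := hQc
  have hQ2' : Continuous fun w : ℝ × ℝ => Q' w.1 w.2 := hQ'c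
  have hQx := hQ.cont_x
  have hWc : Continuous (Function.uncurry (coeffW σ Q Q')) := by
    have : Continuous fun w : ℝ × ℝ => coeffW σ Q Q' w.1 w.2 := by
      unfold coeffW
      fun_prop
    exact this
  have hW1 := norm_coeffW_le hσ hQ
  have hW2 := norm_coeffW'_le hσ hQ
  have hWx : ∀ t, Continuous (coeffW σ Q Q' t) := fun t =>
    hWc.comp (by fun_prop : Continuous fun y => (t, y))
  have hc1b : ∀ t y, ‖-(I / 2) * Q t y‖ ≤ C * (1 + y ^ 2)⁻¹ := by
    intro t y
    have h1 := hQ.bound t y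
    simp only [norm_mul, norm_div, norm_neg, Complex.norm_I, Complex.norm_ofNat]
    nlinarith [norm_nonneg (Q t y)]
  -- The Volterra system asks for one constant for both coefficients, and W needs C + C³.
  have hc1b' : ∀ t y, ‖-(I / 2) * Q t y‖ ≤ (C + C ^ 3) * (1 + y ^ 2)⁻¹ := fun t y =>
    (hc1b t y).trans (by gcongr; linarith [pow_pos hC 3])
  obtain ⟨f, h, hfc, hhc, ⟨M, hM⟩, hf, hh, hfd, hhd⟩ :=
    exists_volterra_system (c₁ := fun t y => -(I / 2) * Q t y) (c₂ := coeffW σ Q Q')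
      (C := C + C ^ 3) (by positivity)
      (show Continuous fun w : ℝ × ℝ => -(I / 2) * Q w.1 w.2 by fun_prop) hWc hc1b' hW1
  have hM0 : 0 ≤ M := (norm_nonneg _).trans (hM 0 0 0).1
  have hfx : ∀ t z, Continuous (f t z) := fun t z =>
    hfc.comp (by fun_prop : Continuous fun y : ℝ => ((t, z), y))
  have hhx : ∀ t z, Continuous (h t z) := fun t z =>
    hhc.comp (by fun_prop : Continuous fun y : ℝ => ((t, z), y))
  -- products with bounded factors decay
  have hmulb : ∀ {u v : ℝ → ℂ} {A B : ℝ}, (∀ y, ‖u y‖ ≤ A * (1 + y ^ 2)⁻¹) → (∀ y, ‖v y‖ ≤ B) →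
      ∀ y, ‖u y * v y‖ ≤ A * B * (1 + y ^ 2)⁻¹ := by
    intro u v A B hu hv y
    have hA : 0 ≤ A := by simpa using (norm_nonneg _).trans (hu 0)
    rw [norm_mul]
    calc ‖u y‖ * ‖v y‖ ≤ (A * (1 + y ^ 2)⁻¹) * B := by
          gcongr
          · exact hu y
          · exact hv y
      _ = _ := by ring
  have hb_c1h : ∀ t z y, ‖-(I / 2) * Q t y * h t z y‖ ≤ C * M * (1 + y ^ 2)⁻¹ := fun t z =>
    hmulb (hc1b t) (fun y => (hM t z y).2)
  have hb_Wf : ∀ t z y, ‖coeffW σ Q Q' t y * f t z y‖ ≤ (C + C ^ 3) * M * (1 + y ^ 2)⁻¹ :=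
    fun t z => hmulb (hW1 t) (fun y => (hM t z y).1)
  have hc_c1h : ∀ t z, Continuous fun y => -(I / 2) * Q t y * h t z y := fun t z => by
    have := hQx t; have := hhx t z; fun_prop
  have hc_Wf : ∀ t z, Continuous fun y => coeffW σ Q Q' t y * f t z y := fun t z => by
    have := hWx t; have := hfx t z; fun_prop
  have hdf : ∀ t z x, HasDerivAt (f t z) (-(I / 2) * Q t x * h t z x) x := by
    intro t z x
    have h1 := (hasDerivAt_volterra (lam := 0) (by simp) (hc_c1h t z)
      (integrable_of_decay (hc_c1h t z) (hb_c1h t z)) x).const_add 1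
    have h2 : f t z = fun x => 1 + volterra 0 (fun y => -(I / 2) * Q t y * h t z y) x :=
      funext fun x => hf t z x
    rw [h2]
    refine h1.congr_deriv ?_
    ring
  have hdh : ∀ t z x, HasDerivAt (h t z)
      (2 * I * clampUpper z * h t z x + coeffW σ Q Q' t x * f t z x) x := by
    intro t z x
    have h1 := hasDerivAt_volterra (clampUpper_im_nonneg z) (hc_Wf t z)
      (integrable_of_decay (hc_Wf t z) (hb_Wf t z)) x
    have h2 : h t z = volterra (clampUpper z) (fun y => coeffW σ Q Q' t y * f t z y) :=
      funext fun x => hh t z x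
    rw [← h2] at h1
    exact h1
  have hlimf : ∀ t z, Tendsto (f t z) atBot (𝓝 1) := by
    intro t z
    have h1 := (tendsto_volterra_atBot (lam := 0) (by simp) (hb_c1h t z)).const_add 1
    rw [add_zero] at h1
    exact h1.congr fun x => (hf t z x).symm
  have hlimh : ∀ t z, Tendsto (h t z) atBot (𝓝 0) := by
    intro t z
    have h1 := tendsto_volterra_atBot (clampUpper_im_nonneg z) (hb_Wf t z)
    exact h1.congr fun x => (hh t z x).symm
  -- the phase
  set θ : ℝ → ℝ → ℝ := fun t x => leftPhase σ (Q t) x with hθ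
  have hdθ := hasDerivAt_leftPhase hσ hQ
  have hθc := continuous_leftPhase hσ hQ
  have hθx : ∀ t, Continuous fun y => (θ t y : ℂ) := fun t =>
    hθc.comp (by fun_prop : Continuous fun y => (t, y))
  -- the second component
  set φ : ℝ → ℂ → ℝ → ℂ := fun t z y => σ * conj (Q t y) * (exp (-(I * θ t y)) * f t z y) with hφ
  have hφb : ∀ t z y, ‖φ t z y‖ ≤ C * M * (1 + y ^ 2)⁻¹ := by
    intro t z
    refine hmulb (fun y => ?_) (fun y => ?_)
    · rw [norm_mul, RCLike.norm_conj, hσ', one_mul]; exact hQ.bound t y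
    · have : exp (-(I * θ t y)) = exp (I * ((-θ t y : ℝ) : ℂ)) := by push_cast; ring_nf
      rw [norm_mul, this, norm_exp_I_mul_ofReal', one_mul]
      exact (hM t z y).1
  have hφc : Continuous fun w : (ℝ × ℂ) × ℝ => φ w.1.1 w.1.2 w.2 := by
    have h1 : Continuous fun w : (ℝ × ℂ) × ℝ => Q w.1.1 w.2 :=
      hQc.comp (by fun_prop : Continuous fun w : (ℝ × ℂ) × ℝ => (w.1.1, w.2))
    have h2 : Continuous fun w : (ℝ × ℂ) × ℝ => (θ w.1.1 w.2 : ℂ) :=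
      hθc.comp (by fun_prop : Continuous fun w : (ℝ × ℂ) × ℝ => (w.1.1, w.2))
    exact (continuous_const.mul (Complex.continuous_conj.comp h1)).mul
      ((Complex.continuous_exp.comp (continuous_const.mul h2).neg).mul hfc)
  have hφx : ∀ t z, Continuous (φ t z) := fun t z =>
    hφc.comp (by fun_prop : Continuous fun y : ℝ => ((t, z), y))
  have hφi : ∀ t z, Integrable (φ t z) := fun t z => integrable_of_decay (hφx t z) (hφb t z)
  set g : ℝ → ℂ → ℝ → ℂ := fun t z x => exp (I * θ t x) * volterra (clampUpper z) (φ t z) x with hg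
  have hee : ∀ t x, exp (I * θ t x) * exp (-(I * θ t x)) = 1 := fun t x => by
    rw [← Complex.exp_add]; simp
  have hdg : ∀ t z x, HasDerivAt (g t z)
      (2 * I * clampUpper z * g t z x + σ * conj (Q t x) * f t z x +
        (I / 2) * (σ * conj (Q t x) * Q t x) * g t z x) x := by
    intro t z x
    have h1 := ((hdθ t x).const_mul I).cexp
    have h2 := hasDerivAt_volterra (clampUpper_im_nonneg z) (hφx t z) (hφi t z) x
    refine (h1.mul h2).congr_deriv ?_
    simp only [hg, hφ]
    linear_combination (σ * conj (Q t x) * f t z x) * hee t x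
  have hgb : ∀ t z x, ‖volterra (clampUpper z) (φ t z) x‖ ≤ C * M * Real.pi := fun t z =>
    norm_volterra_le_pi (clampUpper_im_nonneg z) (hφb t z)
  have hlimg : ∀ t z, Tendsto (g t z) atBot (𝓝 0) := by
    intro t z
    have h1 := tendsto_volterra_atBot (clampUpper_im_nonneg z) (hφb t z)
    rw [tendsto_zero_iff_norm_tendsto_zero] at h1 ⊢
    refine h1.congr fun x => ?_
    simp only [hg]
    rw [norm_mul, norm_exp_I_mul_ofReal', one_mul]
  have hdQb : ∀ t x, HasDerivAt (fun y => conj (Q t y)) (conj (Q' t x)) x := fun t x =>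
    HasDerivAt.conj (hQ.deriv t x)
  -- The function e^{-iθ}(h - σQ̄f) vanishes at -∞ and solves the same equation as 2iz e^{-iθ}g, so
  -- the two agree.
  have hrel : ∀ t z x, h t z x = 2 * I * clampUpper z * g t z x + σ * conj (Q t x) * f t z x := by
    intro t z x
    have hu := eq_volterra_of_hasDerivAt (clampUpper_im_nonneg z)
      (φ := fun y => 2 * I * clampUpper z * φ t z y)
      (v := fun y => exp (-(I * θ t y)) * (h t z y - σ * conj (Q t y) * f t z y))
      ((hφi t z).const_mul _) (fun y => ?_) ?_ x
    · rw [volterra_const_mul] at hu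
      simp only [hg]
      linear_combination exp (I * θ t x) * hu -
        (h t z x - σ * conj (Q t x) * f t z x) * hee t x
    · have h1 := ((hdθ t y).const_mul I).neg.cexp
      have h2 := (hdh t z y).sub (((hdQb t y).const_mul (σ : ℂ)).mul (hdf t z y))
      refine (h1.mul h2).congr_deriv ?_
      simp only [hφ, coeffW, Pi.mul_apply, Pi.sub_apply, Pi.neg_apply]
      ring
    · have h1 : Tendsto (fun y => h t z y - σ * conj (Q t y) * f t z y) atBot (𝓝 0) := by
        have h2 : Tendsto (fun y => σ * conj (Q t y) * f t z y) atBot (𝓝 0) := by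
          refine tendsto_zero_atBot_of_decay (C := C * M) (hmulb (fun y => ?_)
            (fun y => (hM t z y).1))
          rw [norm_mul, RCLike.norm_conj, hσ', one_mul]; exact hQ.bound t y
        simpa using (hlimh t z).sub h2
      rw [tendsto_zero_iff_norm_tendsto_zero] at h1 ⊢
      refine h1.congr fun y => ?_
      have : exp (-(I * θ t y)) = exp (I * ((-θ t y : ℝ) : ℂ)) := by push_cast; ring_nf
      rw [norm_mul, this, norm_exp_I_mul_ofReal', one_mul]
  refine ⟨f, g, h, hfc, ?_, hhc, ?_, ?_, ?_, ?_, fun t z _ => hlimf t z, fun t z _ => hlimg t z,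
    hfd, ?_, hhd, ?_⟩
  · have h1 := continuous_volterra (P := ℝ × ℂ) (lam := fun p => clampUpper p.2)
      (continuous_clampUpper.comp continuous_snd) (fun p => clampUpper_im_nonneg _)
      (φ := fun p y => φ p.1 p.2 y) hφc (fun p y => hφb p.1 p.2 y)
    have h2 : Continuous fun w : (ℝ × ℂ) × ℝ => (θ w.1.1 w.2 : ℂ) :=
      hθc.comp (by fun_prop : Continuous fun w : (ℝ × ℂ) × ℝ => (w.1.1, w.2))
    exact (Complex.continuous_exp.comp (continuous_const.mul h2)).mul h1
  · refine ⟨max M (C * M * Real.pi), fun t z x => ⟨le_max_of_le_left (hM t z x).1,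
      le_max_of_le_right ?_⟩⟩
    simp only [hg]
    rw [norm_mul, norm_exp_I_mul_ofReal', one_mul]
    exact hgb t z x
  · intro t z x hz
    refine (hdf t z x).congr_deriv ?_
    rw [hrel, clampUpper_of_nonneg hz]
    linear_combination (-(z * Q t x * g t z x)) * Complex.I_sq
  · intro t z x hz
    have := hdg t z x
    rwa [clampUpper_of_nonneg hz] at this
  · intro t z x hz
    have := hrel t z x
    rwa [clampUpper_of_nonneg hz] at this
  · intro t x
    refine (differentiableOn_const _).mul ?_
    refine differentiableOn_volterra
      (differentiableOn_id.congr fun z hz => clampUpper_of_nonneg (le_of_lt hz))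
      (fun z _ => clampUpper_im_nonneg z) (hφx t) (hφb t) fun y => ?_
    exact (differentiableOn_const _).mul ((differentiableOn_const _).mul (hfd t y))
  · -- integration by parts
    set D := ((C + 2 * C ^ 3) * M + (C + C ^ 3) * (C * M)) with hD
    have hhz : ∀ t z x, 0 ≤ z.im → ‖z‖ * ‖h t z x‖ ≤ D * Real.pi + (C + C ^ 3) * M := by
      intro t z x hz
      set ψ : ℝ → ℂ := fun y => coeffW' σ Q Q' Q'' t y * f t z y +
        coeffW σ Q Q' t y * (-(I / 2) * Q t y * h t z y) with hψ
      have hψb : ∀ y, ‖ψ y‖ ≤ D * (1 + y ^ 2)⁻¹ := by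
        intro y
        have e1 := hmulb (hW2 t) (fun y => (hM t z y).1) y
        have e2 := hmulb (hW1 t) (v := fun y => -(I / 2) * Q t y * h t z y) (B := C * M)
          (fun y => le_of_decay (by positivity) (hb_c1h t z y)) y
        refine (norm_add_le _ _).trans ((add_le_add e1 e2).trans (le_of_eq ?_))
        rw [hD]; ring
      have hψc : Continuous ψ := by
        have h1 : Continuous (coeffW' σ Q Q' Q'' t) := by
          have := hQx t; have := hQ.cont_x' t; have := hQ.cont'' t
          unfold coeffW'
          fun_prop
        have := hfx t z; have := hWx t; have := hc_c1h t z
        fun_prop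
      -- Since ψ = (Wf)', the function 2izh + Wf obeys the equation of h with source ψ instead of
      -- Wf. It is therefore bounded uniformly in z, and with Wf bounded so is z h.
      have hv := eq_volterra_of_hasDerivAt hz (φ := ψ)
        (v := fun y => 2 * I * z * h t z y + coeffW σ Q Q' t y * f t z y)
        (integrable_of_decay hψc hψb) (fun y => ?_) ?_ x
      · have e1 := norm_volterra_le_pi hz hψb x
        rw [← hv] at e1
        have e2 : ‖coeffW σ Q Q' t x * f t z x‖ ≤ (C + C ^ 3) * M :=
          le_of_decay (by positivity) (hb_Wf t z x)
        have e3 : ‖2 * I * z * h t z x‖ = 2 * (‖z‖ * ‖h t z x‖) := by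
          simp only [norm_mul, Complex.norm_I, Complex.norm_ofNat]; ring
        have e4 := norm_sub_le (2 * I * z * h t z x + coeffW σ Q Q' t x * f t z x)
          (coeffW σ Q Q' t x * f t z x)
        rw [add_sub_cancel_right, e3] at e4
        have : 0 ≤ ‖z‖ * ‖h t z x‖ := by positivity
        linarith
      · have e1 := hdh t z y
        rw [clampUpper_of_nonneg hz] at e1
        refine ((e1.const_mul (2 * I * z)).add
          ((hasDerivAt_coeffW (σ := σ) hQ t y).mul (hdf t z y))).congr_deriv ?_
        simp only [hψ]
      · have e1 := ((hlimh t z).const_mul (2 * I * z)).add (tendsto_zero_atBot_of_decay (hb_Wf t z))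
        simpa using e1
    set E := D * Real.pi + (C + C ^ 3) * M with hE
    -- The second bound follows from the first, because f - 1 is the integral of -(i/2)Qh.
    refine ⟨max E (C * E * Real.pi), fun t z x hz => ⟨le_max_of_le_left (hhz t z x hz),
      le_max_of_le_right ?_⟩⟩
    rcases eq_or_ne z 0 with rfl | hz0
    · simp only [norm_zero, zero_mul]; positivity
    have hzp : 0 < ‖z‖ := norm_pos_iff.2 hz0
    have e1 := norm_volterra_le_pi (lam := 0) (by simp)
      (φ := fun y => -(I / 2) * Q t y * h t z y) (C := C * (E / ‖z‖))
      (hmulb (hc1b t) (fun y => by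
        rw [le_div_iff₀ hzp, mul_comm]; exact hhz t z y hz)) x
    have e2 : f t z x - 1 = volterra 0 (fun y => -(I / 2) * Q t y * h t z y) x := by
      rw [hf]; ring
    rw [e2]
    calc ‖z‖ * _ ≤ ‖z‖ * (C * (E / ‖z‖) * Real.pi) := by gcongr
      _ = C * E * Real.pi := by field_simp

/-! ### The Jost column normalized at +∞. -/

/-- `c, d, e` are the components of the Jost column normalized at `+∞` for the family `Q`:
`k c` and `d` are its two entries and `e = 2 i z c - Q d`, where `z = k²`. -/
structure IsRightJost (σ : ℝ) (Q : ℝ → ℝ → ℂ) (c d e : ℝ → ℂ → ℝ → ℂ) : Prop where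
  cont_c : Continuous fun p : (ℝ × ℂ) × ℝ => c p.1.1 p.1.2 p.2
  cont_d : Continuous fun p : (ℝ × ℂ) × ℝ => d p.1.1 p.1.2 p.2
  bound : ∃ M, ∀ t z x, ‖c t z x‖ ≤ M ∧ ‖d t z x‖ ≤ M
  deriv_c : ∀ t z x, 0 ≤ z.im → HasDerivAt (c t z)
    (-(2 * I * z * c t z x) - (I / 2) * (σ * conj (Q t x) * Q t x) * c t z x + Q t x * d t z x) x
  deriv_d : ∀ t z x, 0 ≤ z.im → HasDerivAt (d t z)
    (z * (σ * conj (Q t x)) * c t z x + (I / 2) * (σ * conj (Q t x) * Q t x) * d t z x) x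
  rel : ∀ t z x, 0 ≤ z.im → e t z x = 2 * I * z * c t z x - Q t x * d t z x
  lim_c : ∀ t z, 0 ≤ z.im → Tendsto (c t z) atTop (𝓝 0)
  lim_d : ∀ t z, 0 ≤ z.im → Tendsto (d t z) atTop (𝓝 1)
  hol_c : ∀ t x, DifferentiableOn ℂ (fun z => c t z x) {z | 0 < z.im}
  hol_d : ∀ t x, DifferentiableOn ℂ (fun z => d t z x) {z | 0 < z.im}
  asymp : ∃ M, ∀ t z x, 0 ≤ z.im → ‖z‖ * ‖e t z x‖ ≤ M ∧ ‖z‖ * ‖d t z x - 1‖ ≤ M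

theorem differentiableOn_conj_neg_conj {F : ℂ → ℂ} (hF : DifferentiableOn ℂ F {z | 0 < z.im}) :
    DifferentiableOn ℂ (fun z => conj (F (-conj z))) {z | 0 < z.im} := by
  have hopen : IsOpen {z : ℂ | 0 < z.im} := isOpen_lt continuous_const Complex.continuous_im
  intro z hz
  have hz' : -conj z ∈ {z : ℂ | 0 < z.im} := by simpa using hz
  have h1 : DifferentiableAt ℂ (fun w => F (-w)) (conj z) := by
    have h2 := hF.differentiableAt (hopen.mem_nhds hz')
    exact DifferentiableAt.comp (g := F) (f := fun w => -w) (conj z) h2 (by fun_prop)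
  have h3 : DifferentiableAt ℂ (conj ∘ (fun w => F (-w)) ∘ conj) z := by
    have := h1.conj_conj
    rwa [Complex.conj_conj] at this
  exact h3.differentiableWithinAt

/-- The substitution x ↦ -x, z ↦ -z̄ followed by conjugation exchanges the two ends of the line and
preserves the upper half plane. It reverses the sign of σ, so the left column is taken for -σ and
the reflected potential. -/
theorem exists_isRightJost {σ : ℝ} (hσ : |σ| = 1) {Q Q' Q'' : ℝ → ℝ → ℂ} {C : ℝ}
    (hQ : PotentialFamily Q Q' Q'' C) : ∃ c d e, IsRightJost σ Q c d e := by
  obtain ⟨f, g, h, H⟩ := exists_isJost (σ := -σ) (by simpa using hσ) hQ.reflect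
  have hσ2 : (σ : ℂ) * σ = 1 := by
    rw [← Complex.ofReal_mul, ← abs_mul_abs_self, hσ]; simp
  have hσ' : ‖(σ : ℂ)‖ = 1 := by rw [Complex.norm_real, Real.norm_eq_abs, hσ]
  have him : ∀ {z : ℂ}, 0 ≤ z.im → 0 ≤ (-conj z).im := fun hz => by simpa using hz
  have hflip : Continuous fun p : (ℝ × ℂ) × ℝ => ((p.1.1, -conj p.1.2), -p.2) := by fun_prop
  have hcc := Complex.continuous_conj
  refine ⟨fun t z x => σ * conj (g t (-conj z) (-x)), fun t z x => conj (f t (-conj z) (-x)),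
    fun t z x => σ * conj (h t (-conj z) (-x)), ?_, ?_, ?_, ?_, ?_, ?_, ?_, ?_, ?_, ?_, ?_⟩
  · exact continuous_const.mul (hcc.comp (H.cont_g.comp hflip))
  · exact hcc.comp (H.cont_f.comp hflip)
  · obtain ⟨M, hM⟩ := H.bound
    refine ⟨M, fun t z x => ⟨?_, ?_⟩⟩
    · rw [norm_mul, hσ', one_mul, RCLike.norm_conj]; exact (hM _ _ _).2
    · rw [RCLike.norm_conj]; exact (hM _ _ _).1
  · intro t z x hz
    have h1 := (HasDerivAt.conj ((H.deriv_g t _ (-x) (him hz)).scomp x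
      (hasDerivAt_neg x))).const_mul (σ : ℂ)
    refine h1.congr_deriv ?_
    simp only [map_mul, map_add, map_neg, neg_smul, one_smul, Complex.conj_conj, Complex.conj_I,
      map_div₀, Complex.conj_ofReal, Complex.ofReal_neg, neg_neg, map_ofNat]
    linear_combination (Q t x * conj (f t (-conj z) (-x))) * hσ2
  · intro t z x hz
    have h1 := HasDerivAt.conj ((H.deriv_f t _ (-x) (him hz)).scomp x (hasDerivAt_neg x))
    refine h1.congr_deriv ?_
    simp only [map_mul, map_add, map_neg, neg_smul, one_smul, Complex.conj_conj, Complex.conj_I,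
      map_div₀, Complex.conj_ofReal, Complex.ofReal_neg, neg_neg, map_ofNat]
    linear_combination (-(z * conj (Q t x) * conj (g t (-conj z) (-x)))) * hσ2
  · intro t z x hz
    simp only [H.rel t _ (-x) (him hz), map_mul, map_add, map_neg, Complex.conj_conj,
      Complex.conj_I, Complex.conj_ofReal, Complex.ofReal_neg, neg_neg, map_ofNat]
    linear_combination (-(Q t x * conj (f t (-conj z) (-x)))) * hσ2
  · intro t z hz
    have h1 := ((hcc.tendsto _).comp
      ((H.lim_g t _ (him hz)).comp tendsto_neg_atTop_atBot)).const_mul (σ : ℂ)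
    simpa [Function.comp_def] using h1
  · intro t z hz
    have h1 := (hcc.tendsto _).comp ((H.lim_f t _ (him hz)).comp tendsto_neg_atTop_atBot)
    simpa [Function.comp_def] using h1
  · exact fun t x => (differentiableOn_const _).mul
      (differentiableOn_conj_neg_conj (H.hol_g t (-x)))
  · exact fun t x => differentiableOn_conj_neg_conj (H.hol_f t (-x))
  · obtain ⟨M, hM⟩ := H.asymp
    refine ⟨M, fun t z x hz => ?_⟩
    obtain ⟨h1, h2⟩ := hM t (-conj z) (-x) (him hz)
    rw [norm_neg, RCLike.norm_conj] at h1 h2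
    refine ⟨?_, ?_⟩
    · rwa [norm_mul, hσ', one_mul, RCLike.norm_conj]
    · rwa [← map_one conj, ← map_sub, RCLike.norm_conj]

theorem eq_of_hasDerivAt_zero {F : ℝ → ℂ} (h : ∀ x, HasDerivAt F 0 x) (x y : ℝ) : F x = F y :=
  is_const_of_deriv_eq_zero (fun x => (h x).differentiableAt) (fun x => (h x).deriv) x y

/-! ### Wronskians, the scattering relation and large-z limits. -/

section Wronskian

variable {σ : ℝ} {Q : ℝ → ℝ → ℂ} {f g h c d e : ℝ → ℂ → ℝ → ℂ}

/-- The transmission function, as a Wronskian of the two Jost columns. -/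
def wronskianA (f g c d : ℝ → ℂ → ℝ → ℂ) (t : ℝ) (z : ℂ) : ℂ :=
  f t z 0 * d t z 0 - z * g t z 0 * c t z 0

/-- The Wronskian of the first Jost columns at `±∞`, for a real spectral parameter. -/
def wronskianB (σ : ℝ) (f g c d : ℝ → ℂ → ℝ → ℂ) (t : ℝ) (l : ℝ) : ℂ :=
  conj (d t l 0) * g t l 0 - σ * conj (c t l 0) * f t l 0

/-- The columns e^{-izx}(f, kg) and e^{izx}(kc, d) solve one traceless linear system, so their
determinant is constant, and the exponentials cancel in it. -/
theorem wronskianA_eq (hJ : IsJost σ Q f g h) (hR : IsRightJost σ Q c d e) (t : ℝ) {z : ℂ}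
    (hz : 0 ≤ z.im) (x : ℝ) :
    f t z x * d t z x - z * g t z x * c t z x = wronskianA f g c d t z := by
  refine eq_of_hasDerivAt_zero (F := fun x => f t z x * d t z x - z * g t z x * c t z x)
    (fun x => ?_) x 0
  refine (((hJ.deriv_f t z x hz).mul (hR.deriv_d t z x hz)).sub
    (((hJ.deriv_g t z x hz).const_mul z).mul (hR.deriv_c t z x hz))).congr_deriv ?_
  ring

theorem hasDerivAt_exp_neg (l : ℂ) (x : ℝ) : HasDerivAt (fun x : ℝ => exp (-(2 * I * l * x)))
    (-(2 * I * l) * exp (-(2 * I * l * x))) x := by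
  have := (((hasDerivAt_id x).ofReal_comp.const_mul (2 * I * l))).neg.cexp
  refine this.congr_deriv ?_
  simp [mul_comm]

theorem wronskianB_eq (hJ : IsJost σ Q f g h) (hR : IsRightJost σ Q c d e) (t l : ℝ) (x : ℝ) :
    exp (-(2 * I * l * x)) * (conj (d t l x) * g t l x - σ * conj (c t l x) * f t l x) =
      wronskianB σ f g c d t l := by
  have hl : 0 ≤ (l : ℂ).im := by simp
  have := eq_of_hasDerivAt_zero (F := fun x : ℝ => exp (-(2 * I * l * x)) *
    (conj (d t l x) * g t l x - σ * conj (c t l x) * f t l x)) (fun x => ?_) x 0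
  · rw [this, wronskianB]; simp
  have hc := HasDerivAt.conj (hR.deriv_c t l x hl)
  have hd := HasDerivAt.conj (hR.deriv_d t l x hl)
  refine ((hasDerivAt_exp_neg l x).mul ((hd.mul (hJ.deriv_g t l x hl)).sub
    ((hc.const_mul (σ : ℂ)).mul (hJ.deriv_f t l x hl)))).congr_deriv ?_
  simp only [map_mul, map_add, map_sub, map_neg, Complex.conj_conj, Complex.conj_I,
      map_div₀, Complex.conj_ofReal, map_ofNat, Pi.sub_apply, Pi.mul_apply]
  ring

/-- For k² = l real, (d̄, kσc̄) and (kc, d) form a fundamental matrix; its determinant is constant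
and tends to 1 at +∞. -/
theorem rightJost_det (hR : IsRightJost σ Q c d e) (t l : ℝ) (x : ℝ) :
    conj (d t l x) * d t l x - σ * l * (conj (c t l x) * c t l x) = 1 := by
  have hl : 0 ≤ (l : ℂ).im := by simp
  set F : ℝ → ℂ := fun x => conj (d t l x) * d t l x - σ * l * (conj (c t l x) * c t l x) with hF
  have hconst : ∀ y, F y = F x := fun y => by
    refine eq_of_hasDerivAt_zero (fun x => ?_) y x
    have hc := HasDerivAt.conj (hR.deriv_c t l x hl)
    have hd := HasDerivAt.conj (hR.deriv_d t l x hl)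
    refine ((hd.mul (hR.deriv_d t l x hl)).sub
      ((hc.mul (hR.deriv_c t l x hl)).const_mul (σ * l : ℂ))).congr_deriv ?_
    simp only [map_mul, map_add, map_sub, map_neg, Complex.conj_conj, Complex.conj_I,
        map_div₀, Complex.conj_ofReal, map_ofNat]
    ring
  have hlim : Tendsto F atTop (𝓝 1) := by
    have hcc := Complex.continuous_conj
    have h1 := hR.lim_d t l hl
    have h2 := hR.lim_c t l hl
    have h3 := (((hcc.tendsto _).comp h1).mul h1).sub
      ((((hcc.tendsto _).comp h2).mul h2).const_mul (σ * l : ℂ))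
    simpa [Function.comp_def] using h3
  exact tendsto_nhds_unique (tendsto_const_nhds.congr fun y => (hconst y).symm) hlim

/-- The scattering relation: the first Jost column at `-∞` in terms of the columns at `+∞`. -/
theorem jost_first_eq (hJ : IsJost σ Q f g h) (hR : IsRightJost σ Q c d e) (t l : ℝ) (x : ℝ) :
    f t l x = wronskianA f g c d t l * conj (d t l x) +
      l * wronskianB σ f g c d t l * exp (2 * I * l * x) * c t l x := by
  have h1 := wronskianA_eq hJ hR t (z := l) (by simp) x
  have h2 := wronskianB_eq hJ hR t l x
  have h3 := rightJost_det hR t l x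
  have h4 : exp (2 * I * l * x) * exp (-(2 * I * l * x)) = 1 := by rw [← Complex.exp_add]; simp
  rw [← h1, ← h2]
  linear_combination (-f t l x) * h3 -
    (l * c t l x * (conj (d t l x) * g t l x - σ * conj (c t l x) * f t l x)) * h4

/-- Cramer's rule in the basis of the two right columns, whose determinant is 1 by `rightJost_det`.
-/
theorem jost_second_eq (hJ : IsJost σ Q f g h) (hR : IsRightJost σ Q c d e) (t l : ℝ) (x : ℝ) :
    g t l x = wronskianA f g c d t l * (σ * conj (c t l x)) +
      wronskianB σ f g c d t l * exp (2 * I * l * x) * d t l x := by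
  have h1 := wronskianA_eq hJ hR t (z := l) (by simp) x
  have h2 := wronskianB_eq hJ hR t l x
  have h3 := rightJost_det hR t l x
  have h4 : exp (2 * I * l * x) * exp (-(2 * I * l * x)) = 1 := by rw [← Complex.exp_add]; simp
  rw [← h1, ← h2]
  linear_combination (-g t l x) * h3 -
    (d t l x * (conj (d t l x) * g t l x - σ * conj (c t l x) * f t l x)) * h4

theorem continuous_wronskianA (hJ : IsJost σ Q f g h) (hR : IsRightJost σ Q c d e) (t : ℝ) :
    Continuous (wronskianA f g c d t) := by
  have hi : Continuous fun z : ℂ => (((t, z), 0) : (ℝ × ℂ) × ℝ) := by fun_prop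
  exact ((hJ.cont_f.comp hi).mul (hR.cont_d.comp hi)).sub
    ((continuous_id.mul (hJ.cont_g.comp hi)).mul (hR.cont_c.comp hi))

theorem continuous_wronskianB (hJ : IsJost σ Q f g h) (hR : IsRightJost σ Q c d e) (t : ℝ) :
    Continuous (wronskianB σ f g c d t) := by
  have hi : Continuous fun l : ℝ => (((t, (l : ℂ)), 0) : (ℝ × ℂ) × ℝ) := by fun_prop
  have hcc := Complex.continuous_conj
  exact ((hcc.comp (hR.cont_d.comp hi)).mul (hJ.cont_g.comp hi)).sub
    ((continuous_const.mul (hcc.comp (hR.cont_c.comp hi))).mul (hJ.cont_f.comp hi))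

theorem differentiableOn_wronskianA (hJ : IsJost σ Q f g h) (hR : IsRightJost σ Q c d e) (t : ℝ) :
    DifferentiableOn ℂ (wronskianA f g c d t) {z | 0 < z.im} :=
  ((hJ.hol_f t 0).mul (hR.hol_d t 0)).sub ((differentiableOn_id.mul (hJ.hol_g t 0)).mul
    (hR.hol_c t 0))

theorem tendsto_of_norm_mul_norm_sub_le {F : ℂ → ℂ} {b : ℂ} {M : ℝ}
    (h : ∀ z : ℂ, 0 ≤ z.im → ‖z‖ * ‖F z - b‖ ≤ M) :
    Tendsto F (cocompact ℂ ⊓ 𝓟 {z | 0 ≤ z.im}) (𝓝 b) := by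
  rw [tendsto_iff_norm_sub_tendsto_zero]
  have h1 : Tendsto (fun z : ℂ => M * ‖z‖⁻¹) (cocompact ℂ ⊓ 𝓟 {z | 0 ≤ z.im}) (𝓝 0) := by
    have := (tendsto_inv_atTop_zero.comp (tendsto_norm_cocompact_atTop (E := ℂ))).const_mul M
    rw [mul_zero] at this
    exact this.mono_left inf_le_left
  refine squeeze_zero' (Eventually.of_forall fun z => norm_nonneg _) ?_ h1
  have h2 : ∀ᶠ z : ℂ in cocompact ℂ ⊓ 𝓟 {z | 0 ≤ z.im}, z ≠ 0 := by
    refine Filter.Eventually.filter_mono inf_le_left ?_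
    have := (isCompact_singleton (x := (0 : ℂ))).compl_mem_cocompact
    filter_upwards [this] with z hz
    simpa using hz
  have h3 : ∀ᶠ z : ℂ in cocompact ℂ ⊓ 𝓟 {z | 0 ≤ z.im}, 0 ≤ z.im :=
    Filter.Eventually.filter_mono inf_le_right (mem_principal_self _)
  filter_upwards [h2, h3] with z hz hz'
  have hzp : 0 < ‖z‖ := norm_pos_iff.2 hz
  rw [← div_eq_mul_inv, le_div_iff₀ hzp, mul_comm]
  exact h z hz'

theorem IsJost.tendsto_f (hJ : IsJost σ Q f g h) (t x : ℝ) :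
    Tendsto (fun z => f t z x) (cocompact ℂ ⊓ 𝓟 {z | 0 ≤ z.im}) (𝓝 1) := by
  obtain ⟨M, hM⟩ := hJ.asymp
  exact tendsto_of_norm_mul_norm_sub_le fun z hz => (hM t z x hz).2

theorem IsJost.tendsto_h (hJ : IsJost σ Q f g h) (t x : ℝ) :
    Tendsto (fun z => h t z x) (cocompact ℂ ⊓ 𝓟 {z | 0 ≤ z.im}) (𝓝 0) := by
  obtain ⟨M, hM⟩ := hJ.asymp
  exact tendsto_of_norm_mul_norm_sub_le (M := M) fun z hz => by simpa using (hM t z x hz).1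

theorem IsJost.tendsto_mul_g (hJ : IsJost σ Q f g h) (t x : ℝ) :
    Tendsto (fun z => 2 * I * (z * g t z x)) (cocompact ℂ ⊓ 𝓟 {z | 0 ≤ z.im})
      (𝓝 (-(σ * conj (Q t x)))) := by
  have h1 := (hJ.tendsto_h t x).sub ((hJ.tendsto_f t x).const_mul (σ * conj (Q t x)))
  rw [zero_sub, mul_one] at h1
  refine h1.congr' ?_
  filter_upwards [Filter.Eventually.filter_mono inf_le_right (mem_principal_self _)] with z hz
  rw [hJ.rel t z x hz]
  ring

theorem IsRightJost.tendsto_d (hR : IsRightJost σ Q c d e) (t x : ℝ) :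
    Tendsto (fun z => d t z x) (cocompact ℂ ⊓ 𝓟 {z | 0 ≤ z.im}) (𝓝 1) := by
  obtain ⟨M, hM⟩ := hR.asymp
  exact tendsto_of_norm_mul_norm_sub_le fun z hz => (hM t z x hz).2

/-- In the relation e = 2izc - Qd one has e → 0 and d → 1. This limit is what reconstructs the
potential. -/
theorem IsRightJost.tendsto_mul_c (hR : IsRightJost σ Q c d e) (t x : ℝ) :
    Tendsto (fun z => 2 * I * (z * c t z x)) (cocompact ℂ ⊓ 𝓟 {z | 0 ≤ z.im}) (𝓝 (Q t x)) := by
  obtain ⟨M, hM⟩ := hR.asymp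
  have h0 : Tendsto (fun z => e t z x) (cocompact ℂ ⊓ 𝓟 {z | 0 ≤ z.im}) (𝓝 0) :=
    tendsto_of_norm_mul_norm_sub_le (M := M) fun z hz => by simpa using (hM t z x hz).1
  have h1 := h0.add ((hR.tendsto_d t x).const_mul (Q t x))
  rw [zero_add, mul_one] at h1
  refine h1.congr' ?_
  filter_upwards [Filter.Eventually.filter_mono inf_le_right (mem_principal_self _)] with z hz
  rw [hR.rel t z x hz]
  ring

/-- If `z φ(z)` has a limit at infinity, then `φ` tends to zero. -/
theorem tendsto_zero_of_tendsto_mul {φ : ℂ → ℂ} {b : ℂ} {S : Set ℂ}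
    (h : Tendsto (fun z => 2 * I * (z * φ z)) (cocompact ℂ ⊓ 𝓟 S) (𝓝 b)) :
    Tendsto φ (cocompact ℂ ⊓ 𝓟 S) (𝓝 0) := by
  have h1 : Tendsto (fun z : ℂ => (2 * I * z)⁻¹) (cocompact ℂ ⊓ 𝓟 S) (𝓝 0) := by
    have h2 : Tendsto (fun z : ℂ => (2 * I)⁻¹ * z⁻¹) (cocompact ℂ) (𝓝 ((2 * I)⁻¹ * 0)) := by
      refine Tendsto.const_mul _ ?_
      rw [← Metric.cobounded_eq_cocompact]
      exact tendsto_inv₀_cobounded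
    rw [mul_zero] at h2
    refine (h2.mono_left inf_le_left).congr fun z => ?_
    simp only [mul_inv]
  have h3 := h1.mul h
  rw [zero_mul] at h3
  refine h3.congr' ?_
  have h2 : ∀ᶠ z : ℂ in cocompact ℂ ⊓ 𝓟 S, z ≠ 0 := by
    refine Filter.Eventually.filter_mono inf_le_left ?_
    have := (isCompact_singleton (x := (0 : ℂ))).compl_mem_cocompact
    filter_upwards [this] with z hz
    simpa using hz
  filter_upwards [h2] with z hz
  have := Complex.I_ne_zero
  field_simp

/-- The product z g c vanishes at infinity because z g converges while c → 0. -/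
theorem tendsto_wronskianA (hJ : IsJost σ Q f g h) (hR : IsRightJost σ Q c d e) (t : ℝ) :
    Tendsto (wronskianA f g c d t) (cocompact ℂ ⊓ 𝓟 {z | 0 ≤ z.im}) (𝓝 1) := by
  have h1 := (hJ.tendsto_f t 0).mul (hR.tendsto_d t 0)
  have h2 := ((hJ.tendsto_mul_g t 0).mul
    (tendsto_zero_of_tendsto_mul (hR.tendsto_mul_c t 0))).const_mul (2 * I)⁻¹
  have h3 := h1.sub h2
  rw [mul_one, mul_zero, mul_zero, sub_zero] at h3
  refine h3.congr fun z => ?_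
  have := Complex.I_ne_zero
  rw [wronskianA]
  field_simp

end Wronskian

/-! ### Classical solutions and their gauge transforms. -/

/-- A classical solution, extended to all times by its values at the end points, is a family of
potentials which satisfies the equation within the time interval. -/
theorem IsSolution.exists_family {σ T : ℝ} (hT : 0 < T) {q₀ : ℝ → ℂ} {q : ℝ → ℝ → ℂ}
    (hq : IsSolution σ T q₀ q) :
    ∃ (u u' u'' : ℝ → ℝ → ℂ) (C : ℝ), PotentialFamily u u' u'' C ∧
      (∀ t ∈ Set.Icc 0 T, ∀ x, u t x = q x t) ∧
      (∀ x, ∀ t ∈ Set.Icc 0 T, HasDerivWithinAt (fun s => u s x)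
        (I * u'' t x + (σ * conj (u' t x) * u t x ^ 2 + σ * conj (u t x) * (2 * u t x * u' t x)))
        (Set.Icc 0 T) t) := by
  set cl : ℝ → ℝ := fun t => max 0 (min t T) with hcl
  have hclm : ∀ t, cl t ∈ Set.Icc 0 T := fun t =>
    ⟨le_max_left _ _, max_le hT.le (min_le_right _ _)⟩
  have hcls : ∀ t ∈ Set.Icc 0 T, cl t = t := fun t ht => by
    simp only [hcl, min_eq_left ht.2, max_eq_right ht.1]
  obtain ⟨C, hC⟩ := hq.decay
  have hcont : ∀ j ≤ 2, Continuous fun w : ℝ × ℝ =>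
      iteratedDeriv j (fun x => q x (cl w.1)) w.2 := by
    intro j hj
    have h1 : Continuous fun w : ℝ × ℝ => (w.2, cl w.1) := by fun_prop
    exact (hq.continuousOn j hj).comp_continuous h1 fun w => ⟨trivial, hclm w.1⟩
  have hd0 : ∀ t ∈ Set.Icc 0 T, ∀ x, HasDerivAt (fun y => q y t)
      (iteratedDeriv 1 (fun y => q y t) x) x := fun t ht x => by
    rw [iteratedDeriv_one]
    exact ((hq.smooth t ht).differentiable (by norm_num) x).hasDerivAt
  have hd1 : ∀ t ∈ Set.Icc 0 T, ∀ x, HasDerivAt (iteratedDeriv 1 (fun y => q y t))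
      (iteratedDeriv 2 (fun y => q y t) x) x := fun t ht x => by
    rw [iteratedDeriv_succ (n := 1)]
    exact ((hq.smooth t ht).differentiable_iteratedDeriv 1 (by norm_num) x).hasDerivAt
  have hbd : ∀ j ≤ 2, ∀ t x, ‖iteratedDeriv j (fun y => q y (cl t)) x‖ ≤
      max C 1 * (1 + x ^ 2)⁻¹ := by
    intro j hj t x
    refine (hC j hj _ (hclm t) x).trans ?_
    rw [div_eq_mul_inv]
    gcongr
    exact le_max_left _ _
  refine ⟨fun t x => q x (cl t), fun t x => iteratedDeriv 1 (fun y => q y (cl t)) x,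
    fun t x => iteratedDeriv 2 (fun y => q y (cl t)) x, max C 1, ?_, ?_, ?_⟩
  · refine ⟨by positivity, ?_, hcont 1 (by norm_num), fun t => ?_, fun t => hd0 _ (hclm t),
      fun t => hd1 _ (hclm t), fun t x => ?_, hbd 1 (by norm_num), hbd 2 le_rfl⟩
    · have := hcont 0 (by norm_num)
      simp only [iteratedDeriv_zero] at this
      exact this
    · have := (hcont 2 le_rfl).comp (by fun_prop : Continuous fun y : ℝ => (t, y))
      exact this
    · have := hbd 0 (by norm_num) t x
      simpa only [iteratedDeriv_zero] using this
  · intro t ht x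
    simp only [hcls t ht]
  · intro x t ht
    simp only [hcls t ht]
    have h1 := (hq.differentiable_time x t ht).hasDerivWithinAt
    have h2 : HasDerivAt (fun y => (σ * conj (q y t)) * q y t ^ 2)
        (σ * conj (iteratedDeriv 1 (fun y => q y t) x) * q x t ^ 2 +
          σ * conj (q x t) * (2 * q x t * iteratedDeriv 1 (fun y => q y t) x)) x := by
      have h3 := hd0 t ht x
      refine (((HasDerivAt.conj h3).const_mul (σ : ℂ)).mul (h3.pow 2)).congr_deriv ?_
      simp
    have h3 := hq.equation x t ht
    rw [h2.deriv] at h3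
    refine (h1.congr_deriv ?_).congr (fun s hs => by rw [hcls s hs]) (by rw [hcls t ht])
    have := Complex.I_sq
    linear_combination (-I) * h3 + (derivWithin (fun s => q x s) (Set.Icc 0 T) t -
      (σ * conj (iteratedDeriv 1 (fun y => q y t) x) * q x t ^ 2 +
          σ * conj (q x t) * (2 * q x t * iteratedDeriv 1 (fun y => q y t) x))) * this

/-- Reflection turns the integral from +∞ into `leftPhase`, from which reality, continuity and the
derivative of the phase are inherited. -/
theorem phase_eq (σ : ℝ) (u : ℝ → ℂ) (x : ℝ) :
    phase σ u x = -((leftPhase σ (fun y => u (-y)) (-x) : ℝ) : ℂ) := by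
  rw [ofReal_leftPhase, phase, volterra,
    ← integral_comp_neg_Ioi (f := fun y : ℝ => exp (2 * I * 0 * (((-x : ℝ) : ℂ) - y)) *
      (σ * conj (u (-y)) * u (-y) / 2))]
  congr 2
  ext y
  simp only [mul_zero, zero_mul, Complex.exp_zero, neg_neg]
  ring

/-- The gauge-transformed potential `u e^{-2 i δ}`. -/
def gauge (σ : ℝ) (u : ℝ → ℝ → ℂ) (t x : ℝ) : ℂ := u t x * exp (-2 * I * phase σ (u t) x)

/-- The first derivative of `gauge`. -/
def gauge' (σ : ℝ) (u u' : ℝ → ℝ → ℂ) (t x : ℝ) : ℂ :=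
  (u' t x - I * σ * conj (u t x) * u t x ^ 2) * exp (-2 * I * phase σ (u t) x)

/-- The second derivative of `gauge`. -/
def gauge'' (σ : ℝ) (u u' u'' : ℝ → ℝ → ℂ) (t x : ℝ) : ℂ :=
  (u'' t x - I * σ * (conj (u' t x) * u t x ^ 2 + 2 * conj (u t x) * u t x * u' t x) -
    I * σ * conj (u t x) * u t x * (u' t x - I * σ * conj (u t x) * u t x ^ 2)) *
    exp (-2 * I * phase σ (u t) x)

theorem norm_exp_phase (σ : ℝ) (u : ℝ → ℂ) (x : ℝ) : ‖exp (-2 * I * phase σ u x)‖ = 1 := by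
  rw [phase_eq]
  have : -2 * I * -((leftPhase σ (fun y => u (-y)) (-x) : ℝ) : ℂ) =
      I * ((2 * leftPhase σ (fun y => u (-y)) (-x) : ℝ) : ℂ) := by push_cast; ring
  rw [this, norm_exp_I_mul_ofReal']

theorem conj_phase (σ : ℝ) (u : ℝ → ℂ) (x : ℝ) : conj (phase σ u x) = phase σ u x := by
  rw [phase_eq, map_neg, Complex.conj_ofReal]

theorem conj_gauge (σ : ℝ) (u : ℝ → ℝ → ℂ) (t x : ℝ) :
    conj (gauge σ u t x) = conj (u t x) * exp (2 * I * phase σ (u t) x) := by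
  rw [gauge, map_mul, ← Complex.exp_conj]
  simp only [map_mul, map_neg, Complex.conj_I, conj_phase, map_ofNat]
  ring_nf

theorem gauge_mul_conj (σ : ℝ) (u : ℝ → ℝ → ℂ) (t x : ℝ) :
    σ * conj (gauge σ u t x) * gauge σ u t x = σ * conj (u t x) * u t x := by
  have : exp (2 * I * phase σ (u t) x) * exp (-2 * I * phase σ (u t) x) = 1 := by
    rw [← Complex.exp_add]; ring_nf; simp
  rw [conj_gauge, gauge]
  linear_combination (σ * conj (u t x) * u t x) * this

theorem norm_gauge (σ : ℝ) (u : ℝ → ℝ → ℂ) (t x : ℝ) : ‖gauge σ u t x‖ = ‖u t x‖ := by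
  rw [gauge, norm_mul, norm_exp_phase, mul_one]

section gauge

variable {σ : ℝ} {u u' u'' : ℝ → ℝ → ℂ} {C : ℝ}

theorem hasDerivAt_phase (hσ : |σ| = 1) (hu : PotentialFamily u u' u'' C) (t x : ℝ) :
    HasDerivAt (phase σ (u t)) (σ * conj (u t x) * u t x / 2) x := by
  have h1 := ((hasDerivAt_leftPhase hσ hu.reflect t (-x)).scomp x (hasDerivAt_neg x)).neg
  have h2 : phase σ (u t) = fun x => -((leftPhase σ (fun y => u t (-y)) (-x) : ℝ) : ℂ) :=
    funext fun x => phase_eq σ (u t) x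
  rw [h2]
  refine h1.congr_deriv ?_
  simp

theorem continuous_phase (hσ : |σ| = 1) (hu : PotentialFamily u u' u'' C) :
    Continuous fun w : ℝ × ℝ => phase σ (u w.1) w.2 := by
  have h1 := ((continuous_leftPhase hσ hu.reflect).comp
    (by fun_prop : Continuous fun w : ℝ × ℝ => (w.1, -w.2))).neg
  exact h1.congr fun w => (phase_eq σ (u w.1) w.2).symm

theorem tendsto_phase (hσ : |σ| = 1) (hu : PotentialFamily u u' u'' C) (t : ℝ) :
    Tendsto (phase σ (u t)) atTop (𝓝 0) := by
  have h1 := ((tendsto_leftPhase hσ hu.reflect t).comp tendsto_neg_atTop_atBot).neg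
  rw [neg_zero] at h1
  exact h1.congr fun x => (phase_eq σ (u t) x).symm

/-- The phase factor is unimodular with logarithmic derivative -iσ|u|², so two differentiations add
only cubic and quintic terms in u and u', all with the same decay. -/
theorem PotentialFamily.gauge (hσ : |σ| = 1) (hu : PotentialFamily u u' u'' C) :
    PotentialFamily (gauge σ u) (gauge' σ u u') (gauge'' σ u u' u'')
      (C + 4 * C ^ 3 + C ^ 5) := by
  have hσ' : ‖(σ : ℂ)‖ = 1 := by rw [Complex.norm_real, Real.norm_eq_abs, hσ]
  have hC := hu.pos
  have hph := continuous_phase hσ hu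
  have hu0 : Continuous fun w : ℝ × ℝ => u w.1 w.2 := hu.cont
  have hu1 : Continuous fun w : ℝ × ℝ => u' w.1 w.2 := hu.cont'
  have hdexp : ∀ t x, HasDerivAt (fun x => exp (-2 * I * phase σ (u t) x))
      (exp (-2 * I * phase σ (u t) x) * (-2 * I * (σ * conj (u t x) * u t x / 2))) x := fun t x =>
    ((hasDerivAt_phase hσ hu t x).const_mul (-2 * I)).cexp
  have hle1 : C ≤ C + 4 * C ^ 3 + C ^ 5 := by nlinarith [pow_pos hC 3, pow_pos hC 5]
  have hb3 : ∀ {a b c : ℂ} {x : ℝ}, ‖a‖ ≤ C → ‖b‖ ≤ C → ‖c‖ ≤ C * (1 + x ^ 2)⁻¹ →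
      ‖a‖ * ‖b‖ * ‖c‖ ≤ C ^ 3 * (1 + x ^ 2)⁻¹ := by
    intro a b c x ha hb hc
    calc ‖a‖ * ‖b‖ * ‖c‖ ≤ C * C * (C * (1 + x ^ 2)⁻¹) := by gcongr
      _ = _ := by ring
  have hb1 : ∀ t x, ‖u' t x - I * σ * conj (u t x) * u t x ^ 2‖ ≤
      (C + C ^ 3) * (1 + x ^ 2)⁻¹ := by
    intro t x
    refine (norm_sub_le _ _).trans ?_
    have h1 := hu.bound' t x
    have h2 := hb3 (hu.norm_le t x) (hu.norm_le t x) (hu.bound t x)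
    simp only [norm_mul, norm_pow, Complex.norm_I, hσ', RCLike.norm_conj, one_mul]
    nlinarith
  refine ⟨by positivity, ?_, ?_, ?_, ?_, ?_, ?_, ?_, ?_⟩
  · have : Continuous fun w : ℝ × ℝ => DNLS.gauge σ u w.1 w.2 := by
      unfold DNLS.gauge; fun_prop
    exact this
  · have : Continuous fun w : ℝ × ℝ => gauge' σ u u' w.1 w.2 := by
      unfold gauge'; fun_prop
    exact this
  · intro t
    have h1 := hu.cont_x' t
    have h2 := hu.cont'' t
    have h3 : Continuous (phase σ (u t)) :=
      hph.comp (by fun_prop : Continuous fun y => (t, y))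
    unfold gauge''
    fun_prop
  · intro t x
    refine ((hu.deriv t x).mul (hdexp t x)).congr_deriv ?_
    rw [gauge']; ring
  · intro t x
    have h1 := hu.deriv t x
    have h2 := HasDerivAt.conj h1
    refine (((hu.deriv' t x).sub ((h2.const_mul (I * σ)).mul (h1.pow 2))).mul
      (hdexp t x)).congr_deriv ?_
    simp only [gauge'', Pi.sub_apply, Pi.mul_apply, Pi.pow_apply]
    push_cast
    ring
  · intro t x
    rw [norm_gauge]
    exact (hu.bound t x).trans (by gcongr)
  · intro t x
    rw [gauge', norm_mul, norm_exp_phase, mul_one]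
    refine (hb1 t x).trans (mul_le_mul_of_nonneg_right ?_ (by positivity))
    linarith [pow_pos hC 3, pow_pos hC 5]
  · intro t x
    rw [gauge'', norm_mul, norm_exp_phase, mul_one]
    have h1 := hu.bound'' t x
    have h2 := hb3 (hu.norm_le' t x) (hu.norm_le t x) (hu.bound t x)
    have h3 := hb1 t x
    have h4 : ‖u t x‖ * ‖u t x‖ * ‖u' t x - I * σ * conj (u t x) * u t x ^ 2‖ ≤
        C * C * ((C + C ^ 3) * (1 + x ^ 2)⁻¹) := by
      have := hu.norm_le t x
      gcongr
    have h5 : ‖conj (u' t x) * u t x ^ 2 + 2 * conj (u t x) * u t x * u' t x‖ ≤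
        3 * (C ^ 3 * (1 + x ^ 2)⁻¹) := by
      refine (norm_add_le _ _).trans ?_
      simp only [norm_mul, norm_pow, RCLike.norm_conj, Complex.norm_ofNat]
      nlinarith
    refine (norm_sub_le _ _).trans ((add_le_add (norm_sub_le _ _) le_rfl).trans ?_)
    simp only [norm_mul, Complex.norm_I, hσ', RCLike.norm_conj, one_mul] at h4 ⊢
    nlinarith

end gauge

/-! ### Time evolution of Wronskians by zero curvature. -/

/-- The time derivative prescribed by the equation. -/
def rhs (σ : ℝ) (u u' u'' : ℝ → ℝ → ℂ) (t x : ℝ) : ℂ :=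
  I * u'' t x + (σ * conj (u' t x) * u t x ^ 2 + σ * conj (u t x) * (2 * u t x * u' t x))

theorem norm_rhs_le {σ : ℝ} (hσ : |σ| = 1) {u u' u'' : ℝ → ℝ → ℂ} {C : ℝ}
    (hu : PotentialFamily u u' u'' C) (t x : ℝ) :
    ‖rhs σ u u' u'' t x‖ ≤ (C + 3 * C ^ 3) * (1 + x ^ 2)⁻¹ := by
  have hσ' : ‖(σ : ℂ)‖ = 1 := by rw [Complex.norm_real, Real.norm_eq_abs, hσ]
  have hC := hu.pos
  have h1 := hu.bound'' t x
  have h2 : ‖u' t x‖ * ‖u t x‖ * ‖u t x‖ ≤ C * C * (C * (1 + x ^ 2)⁻¹) := by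
    have e1 := hu.norm_le' t x
    have e2 := hu.norm_le t x
    have e3 := hu.bound t x
    gcongr
  refine (norm_add_le _ _).trans ((add_le_add le_rfl (norm_add_le _ _)).trans ?_)
  simp only [norm_mul, norm_pow, Complex.norm_I, hσ', RCLike.norm_conj, one_mul,
    Complex.norm_ofNat]
  nlinarith

section evolution

variable {σ T : ℝ} {u u' u'' : ℝ → ℝ → ℂ} {C : ℝ} {z κ : ℂ} {F G Y₁ Y₂ : ℝ → ℝ → ℂ} {M : ℝ}

/-- The variation of a Wronskian in time, in terms of the potential. -/
theorem wronskian_sub_eq_integral (hσ : |σ| = 1) (hu : PotentialFamily u u' u'' C)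
    (bF : ∀ t x, ‖F t x‖ ≤ M) (bG : ∀ t x, ‖G t x‖ ≤ M)
    (bY₁ : ∀ t x, ‖Y₁ t x‖ ≤ M) (bY₂ : ∀ t x, ‖Y₂ t x‖ ≤ M)
    (dF : ∀ t x, HasDerivAt (F t) (z * u t x * G t x) x)
    (dG : ∀ t x, HasDerivAt (G t) (2 * I * z * G t x + σ * conj (u t x) * F t x) x)
    (dY₁ : ∀ t x, HasDerivAt (Y₁ t) (-(σ * conj (u t x) * Y₂ t x)) x)
    (dY₂ : ∀ t x, HasDerivAt (Y₂ t) (-(z * u t x * Y₁ t x) - 2 * I * z * Y₂ t x) x)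
    (lF : ∀ t, Tendsto (F t) atBot (𝓝 1)) (lG : ∀ t, Tendsto (G t) atBot (𝓝 0))
    (lY₁ : ∀ s t, Tendsto (fun x => Y₁ s x - Y₁ t x) atTop (𝓝 0))
    (lY₂ : ∀ s t, Tendsto (fun x => Y₂ s x - Y₂ t x) atTop (𝓝 0)) (s t : ℝ) :
    (Y₁ t 0 * F t 0 + Y₂ t 0 * G t 0) - (Y₁ s 0 * F s 0 + Y₂ s 0 * G s 0) =
      ∫ x, (Y₁ s x * (z * (u t x - u s x)) * G t x +
        Y₂ s x * (σ * conj (u t x - u s x)) * F t x) := by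
  have hσ' : ‖(σ : ℂ)‖ = 1 := by rw [Complex.norm_real, Real.norm_eq_abs, hσ]
  have hM : 0 ≤ M := (norm_nonneg _).trans (bF 0 0)
  have hC := hu.pos
  have hconst : ∀ t x, Y₁ t x * F t x + Y₂ t x * G t x = Y₁ t 0 * F t 0 + Y₂ t 0 * G t 0 := by
    intro t x
    refine eq_of_hasDerivAt_zero (F := fun x => Y₁ t x * F t x + Y₂ t x * G t x) (fun x => ?_) x 0
    refine (((dY₁ t x).mul (dF t x)).add ((dY₂ t x).mul (dG t x))).congr_deriv ?_
    ring
  have cF : ∀ t, Continuous (F t) := fun t =>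
    continuous_iff_continuousAt.2 fun x => (dF t x).continuousAt
  have cG : ∀ t, Continuous (G t) := fun t =>
    continuous_iff_continuousAt.2 fun x => (dG t x).continuousAt
  have cY₁ : ∀ t, Continuous (Y₁ t) := fun t =>
    continuous_iff_continuousAt.2 fun x => (dY₁ t x).continuousAt
  have cY₂ : ∀ t, Continuous (Y₂ t) := fun t =>
    continuous_iff_continuousAt.2 fun x => (dY₂ t x).continuousAt
  have hmul0 : ∀ {l : Filter ℝ} {a b : ℝ → ℂ}, (∀ x, ‖a x‖ ≤ M) → Tendsto b l (𝓝 0) →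
      Tendsto (fun x => a x * b x) l (𝓝 0) := by
    intro l a b ha hb
    refine squeeze_zero_norm (a := fun x => M * ‖b x‖) (fun x => ?_) ?_
    · rw [norm_mul]
      exact mul_le_mul_of_nonneg_right (ha x) (norm_nonneg _)
    · simpa using (tendsto_zero_iff_norm_tendsto_zero.1 hb).const_mul M
  symm
  -- The row at time s is paired with the column at time t. The columns agree at -∞ and the rows at
  -- +∞, so this mixed pairing tends to the Wronskian at s on the left and at t on the right. Its
  -- derivative contains only the difference of the potentials.
  refine integral_of_hasDerivAt_of_tendsto (f := fun x => Y₁ s x * F t x + Y₂ s x * G t x)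
    (fun x => ?_) ?_ ?_ ?_
  · refine (((dY₁ s x).mul (dF t x)).add ((dY₂ s x).mul (dG t x))).congr_deriv ?_
    rw [map_sub]
    ring
  · have hcu := hu.cont_x
    have e0 := cF t; have e1 := cG t; have e2 := cY₁ s; have e3 := cY₂ s
    have e4 := hcu t; have e5 := hcu s
    refine integrable_of_decay (C := M * (‖z‖ * (2 * C)) * M + M * (2 * C) * M) (by fun_prop)
      fun x => ?_
    have hdiff : ‖u t x - u s x‖ ≤ 2 * C * (1 + x ^ 2)⁻¹ :=
      (norm_sub_le _ _).trans (by linarith [hu.bound t x, hu.bound s x])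
    refine (norm_add_le _ _).trans ?_
    simp only [norm_mul, hσ', one_mul, RCLike.norm_conj]
    calc ‖Y₁ s x‖ * (‖z‖ * ‖u t x - u s x‖) * ‖G t x‖ + ‖Y₂ s x‖ * ‖u t x - u s x‖ * ‖F t x‖
        ≤ M * (‖z‖ * (2 * C * (1 + x ^ 2)⁻¹)) * M + M * (2 * C * (1 + x ^ 2)⁻¹) * M := by
          gcongr
          · exact bY₁ s x
          · exact bG t x
          · exact bY₂ s x
          · exact bF t x
      _ = _ := by ring
  · have h1 : Tendsto (fun x => F t x - F s x) atBot (𝓝 0) := by simpa using (lF t).sub (lF s)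
    have h2 : Tendsto (fun x => G t x - G s x) atBot (𝓝 0) := by simpa using (lG t).sub (lG s)
    have h3 := ((hmul0 (bY₁ s) h1).add (hmul0 (bY₂ s) h2)).add_const
      (Y₁ s 0 * F s 0 + Y₂ s 0 * G s 0)
    rw [add_zero, zero_add] at h3
    refine h3.congr fun x => ?_
    rw [← hconst s x]; ring
  · have h3 := ((hmul0 (bF t) (lY₁ s t)).add (hmul0 (bG t) (lY₂ s t))).add_const
      (Y₁ t 0 * F t 0 + Y₂ t 0 * G t 0)
    rw [add_zero, zero_add] at h3
    refine h3.congr fun x => ?_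
    rw [← hconst t x]; ring

/-- The integral of the variation of a Wronskian, by the zero curvature equation. -/
theorem integral_wronskian_variation (hσ : |σ| = 1) (hu : PotentialFamily u u' u'' C)
    (bF : ∀ t x, ‖F t x‖ ≤ M) (bG : ∀ t x, ‖G t x‖ ≤ M)
    (bY₁ : ∀ t x, ‖Y₁ t x‖ ≤ M) (bY₂ : ∀ t x, ‖Y₂ t x‖ ≤ M)
    (dF : ∀ t x, HasDerivAt (F t) (z * u t x * G t x) x)
    (dG : ∀ t x, HasDerivAt (G t) (2 * I * z * G t x + σ * conj (u t x) * F t x) x)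
    (dY₁ : ∀ t x, HasDerivAt (Y₁ t) (-(σ * conj (u t x) * Y₂ t x)) x)
    (dY₂ : ∀ t x, HasDerivAt (Y₂ t) (-(z * u t x * Y₁ t x) - 2 * I * z * Y₂ t x) x)
    (lG : ∀ t, Tendsto (G t) atBot (𝓝 0))
    (lκ : ∀ t, Tendsto (fun x => Y₂ t x * G t x) atTop
      (𝓝 (κ * (Y₁ t 0 * F t 0 + Y₂ t 0 * G t 0)))) (s : ℝ) :
    ∫ x, (Y₁ s x * (z * rhs σ u u' u'' s x) * G s x +
        Y₂ s x * (σ * conj (rhs σ u u' u'' s x)) * F s x) =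
      4 * I * z ^ 2 * (κ * (Y₁ s 0 * F s 0 + Y₂ s 0 * G s 0)) := by
  have hσ' : ‖(σ : ℂ)‖ = 1 := by rw [Complex.norm_real, Real.norm_eq_abs, hσ]
  have hM : 0 ≤ M := (norm_nonneg _).trans (bF 0 0)
  have hC := hu.pos
  have cF : Continuous (F s) := continuous_iff_continuousAt.2 fun x => (dF s x).continuousAt
  have cG : Continuous (G s) := continuous_iff_continuousAt.2 fun x => (dG s x).continuousAt
  have cY₁ : Continuous (Y₁ s) := continuous_iff_continuousAt.2 fun x => (dY₁ s x).continuousAt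
  have cY₂ : Continuous (Y₂ s) := continuous_iff_continuousAt.2 fun x => (dY₂ s x).continuousAt
  have hmul0 : ∀ {l : Filter ℝ} {a b v : ℝ → ℂ}, (∀ x, ‖a x‖ ≤ M) → (∀ x, ‖b x‖ ≤ M) →
      Tendsto v l (𝓝 0) → Tendsto (fun x => a x * v x * b x) l (𝓝 0) := by
    intro l a b v ha hb hv
    refine squeeze_zero_norm (a := fun x => M * ‖v x‖ * M) (fun x => ?_) ?_
    · rw [norm_mul, norm_mul]
      have := ha x; have := hb x
      gcongr
    · simpa using ((tendsto_zero_iff_norm_tendsto_zero.1 hv).const_mul M).mul_const M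
  -- These are the entries of the decaying part V of the time matrix of the Lax pair. With U the
  -- spatial matrix and Ṽ = V + diag(0, 4iz²), zero curvature U_t = Ṽ_x + [Ṽ, U] makes (YṼΦ)_x equal
  -- to Y U_t Φ. Since V → 0 at both ends, only the constant part 4iz² Y₂G reaches the boundary.
  set V₁₁ : ℝ → ℂ := fun x => -(I * z * (u s x * (σ * conj (u s x)))) with hV₁₁
  set V₁₂ : ℝ → ℂ := fun x => 2 * z ^ 2 * u s x +
    z * (I * u' s x + u s x ^ 2 * (σ * conj (u s x))) with hV₁₂
  set V₂₁ : ℝ → ℂ := fun x => 2 * z * (σ * conj (u s x)) - I * (σ * conj (u' s x)) +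
    (σ * conj (u s x)) ^ 2 * u s x with hV₂₁
  have hlim : ∀ {l : Filter ℝ}, Tendsto (u s) l (𝓝 0) → Tendsto (u' s) l (𝓝 0) →
      Tendsto (fun x => Y₁ s x * V₁₁ x * F s x + Y₁ s x * V₁₂ x * G s x +
        Y₂ s x * V₂₁ x * F s x - Y₂ s x * V₁₁ x * G s x) l (𝓝 0) := by
    intro l h0 h1
    have h0c := (Complex.continuous_conj.tendsto _).comp h0
    have h1c := (Complex.continuous_conj.tendsto _).comp h1
    rw [map_zero] at h0c h1c
    have e1 : Tendsto V₁₁ l (𝓝 0) := by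
      have := (((h0.mul (h0c.const_mul (σ : ℂ))).const_mul (I * z))).neg
      simpa using this
    have e2 : Tendsto V₁₂ l (𝓝 0) := by
      have := (h0.const_mul (2 * z ^ 2)).add (((h1.const_mul I).add
        ((h0.pow 2).mul (h0c.const_mul (σ : ℂ)))).const_mul z)
      simpa using this
    have e3 : Tendsto V₂₁ l (𝓝 0) := by
      have := (((h0c.const_mul (σ : ℂ)).const_mul (2 * z)).sub
        ((h1c.const_mul (σ : ℂ)).const_mul I)).add (((h0c.const_mul (σ : ℂ)).pow 2).mul h0)
      simpa using this
    have := (((hmul0 (bY₁ s) (bF s) e1).add (hmul0 (bY₁ s) (bG s) e2)).add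
      (hmul0 (bY₂ s) (bF s) e3)).sub (hmul0 (bY₂ s) (bG s) e1)
    simpa using this
  have hu0 := tendsto_zero_atBot_of_decay (hu.bound s)
  have hu0' := tendsto_zero_atBot_of_decay (hu.bound' s)
  have hu1 := tendsto_zero_atTop_of_decay (hu.bound s)
  have hu1' := tendsto_zero_atTop_of_decay (hu.bound' s)
  have key := integral_of_hasDerivAt_of_tendsto
    (f := fun x => (Y₁ s x * V₁₁ x * F s x + Y₁ s x * V₁₂ x * G s x +
        Y₂ s x * V₂₁ x * F s x - Y₂ s x * V₁₁ x * G s x) + 4 * I * z ^ 2 * (Y₂ s x * G s x))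
    (f' := fun x => Y₁ s x * (z * rhs σ u u' u'' s x) * G s x +
        Y₂ s x * (σ * conj (rhs σ u u' u'' s x)) * F s x)
    (m := 0) (n := 4 * I * z ^ 2 * (κ * (Y₁ s 0 * F s 0 + Y₂ s 0 * G s 0)))
    (fun x => ?_) ?_ ?_ ?_
  · rw [key, sub_zero]
  · have d0 := hu.deriv s x
    have d1 := hu.deriv' s x
    have d0c := (HasDerivAt.conj d0).const_mul (σ : ℂ)
    have d1c := (HasDerivAt.conj d1).const_mul (σ : ℂ)
    have e1 : HasDerivAt V₁₁ _ x := ((d0.mul d0c).const_mul (I * z)).neg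
    have e2 : HasDerivAt V₁₂ _ x := (d0.const_mul (2 * z ^ 2)).add
      (((d1.const_mul I).add ((d0.pow 2).mul d0c)).const_mul z)
    have e3 : HasDerivAt V₂₁ _ x := ((d0c.const_mul (2 * z)).sub (d1c.const_mul I)).add
      ((d0c.pow 2).mul d0)
    refine (((((((dY₁ s x).mul e1).mul (dF s x)).add (((dY₁ s x).mul e2).mul (dG s x))).add
      (((dY₂ s x).mul e3).mul (dF s x))).sub (((dY₂ s x).mul e1).mul (dG s x))).add
      (((dY₂ s x).mul (dG s x)).const_mul (4 * I * z ^ 2))).congr_deriv ?_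
    simp only [rhs, hV₁₁, hV₁₂, hV₂₁, Pi.mul_apply, Pi.pow_apply, map_add, map_mul, map_pow,
      Complex.conj_I, Complex.conj_conj, Complex.conj_ofReal, map_ofNat]
    push_cast
    ring_nf
    simp only [Complex.I_sq]
    ring
  · have e0 := hu.cont_x s; have e1 := hu.cont_x' s; have e2 := hu.cont'' s
    have e3 : Continuous (rhs σ u u' u'' s) := by unfold rhs; fun_prop
    refine integrable_of_decay (C := M * (‖z‖ * (C + 3 * C ^ 3)) * M + M * (C + 3 * C ^ 3) * M)
      (by fun_prop) fun x => ?_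
    have hr := norm_rhs_le hσ hu s x
    refine (norm_add_le _ _).trans ?_
    simp only [norm_mul, hσ', one_mul, RCLike.norm_conj]
    calc ‖Y₁ s x‖ * (‖z‖ * ‖rhs σ u u' u'' s x‖) * ‖G s x‖ +
          ‖Y₂ s x‖ * ‖rhs σ u u' u'' s x‖ * ‖F s x‖
        ≤ M * (‖z‖ * ((C + 3 * C ^ 3) * (1 + x ^ 2)⁻¹)) * M +
          M * ((C + 3 * C ^ 3) * (1 + x ^ 2)⁻¹) * M := by
          gcongr
          · exact bY₁ s x
          · exact bG s x
          · exact bY₂ s x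
          · exact bF s x
      _ = _ := by ring
  · have h1 : Tendsto (fun x => Y₂ s x * G s x) atBot (𝓝 0) := by
      refine squeeze_zero_norm (a := fun x => M * ‖G s x‖) (fun x => ?_) ?_
      · rw [norm_mul]
        exact mul_le_mul_of_nonneg_right (bY₂ s x) (norm_nonneg _)
      · simpa using (tendsto_zero_iff_norm_tendsto_zero.1 (lG s)).const_mul M
    simpa using (hlim hu0 hu0').add (h1.const_mul (4 * I * z ^ 2))
  · simpa using (hlim hu1 hu1').add ((lκ s).const_mul (4 * I * z ^ 2))

/-- Time evolution of a Wronskian of solutions of the spatial part of the Lax pair. -/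
theorem wronskian_evolution (hσ : |σ| = 1) (hu : PotentialFamily u u' u'' C)
    (hut : ∀ x, ∀ t ∈ Set.Icc 0 T,
      HasDerivWithinAt (fun s => u s x) (rhs σ u u' u'' t x) (Set.Icc 0 T) t)
    (bF : ∀ t x, ‖F t x‖ ≤ M) (bG : ∀ t x, ‖G t x‖ ≤ M)
    (bY₁ : ∀ t x, ‖Y₁ t x‖ ≤ M) (bY₂ : ∀ t x, ‖Y₂ t x‖ ≤ M)
    (cF : ∀ x, Continuous fun t => F t x) (cG : ∀ x, Continuous fun t => G t x)
    (dF : ∀ t x, HasDerivAt (F t) (z * u t x * G t x) x)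
    (dG : ∀ t x, HasDerivAt (G t) (2 * I * z * G t x + σ * conj (u t x) * F t x) x)
    (dY₁ : ∀ t x, HasDerivAt (Y₁ t) (-(σ * conj (u t x) * Y₂ t x)) x)
    (dY₂ : ∀ t x, HasDerivAt (Y₂ t) (-(z * u t x * Y₁ t x) - 2 * I * z * Y₂ t x) x)
    (lF : ∀ t, Tendsto (F t) atBot (𝓝 1)) (lG : ∀ t, Tendsto (G t) atBot (𝓝 0))
    (lY₁ : ∀ s t, Tendsto (fun x => Y₁ s x - Y₁ t x) atTop (𝓝 0))
    (lY₂ : ∀ s t, Tendsto (fun x => Y₂ s x - Y₂ t x) atTop (𝓝 0))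
    (lκ : ∀ t, Tendsto (fun x => Y₂ t x * G t x) atTop
      (𝓝 (κ * (Y₁ t 0 * F t 0 + Y₂ t 0 * G t 0)))) {t : ℝ} (ht : t ∈ Set.Icc 0 T) :
    Y₁ t 0 * F t 0 + Y₂ t 0 * G t 0 =
      exp (4 * I * z ^ 2 * κ * t) * (Y₁ 0 0 * F 0 0 + Y₂ 0 0 * G 0 0) := by
  have hσ' : ‖(σ : ℂ)‖ = 1 := by rw [Complex.norm_real, Real.norm_eq_abs, hσ]
  have hM : 0 ≤ M := (norm_nonneg _).trans (bF 0 0)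
  have hC := hu.pos
  set w : ℝ → ℂ := fun t => Y₁ t 0 * F t 0 + Y₂ t 0 * G t 0 with hw
  have xF : ∀ t, Continuous (F t) := fun t =>
    continuous_iff_continuousAt.2 fun x => (dF t x).continuousAt
  have xG : ∀ t, Continuous (G t) := fun t =>
    continuous_iff_continuousAt.2 fun x => (dG t x).continuousAt
  have xY₁ : ∀ t, Continuous (Y₁ t) := fun t =>
    continuous_iff_continuousAt.2 fun x => (dY₁ t x).continuousAt
  have xY₂ : ∀ t, Continuous (Y₂ t) := fun t =>
    continuous_iff_continuousAt.2 fun x => (dY₂ t x).continuousAt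
  have hderiv : ∀ s ∈ Set.Icc 0 T, HasDerivWithinAt w (4 * I * z ^ 2 * (κ * w s))
      (Set.Icc 0 T) s := by
    intro s hs
    rw [← integral_wronskian_variation hσ hu bF bG bY₁ bY₂ dF dG dY₁ dY₂ lG lκ s,
      hasDerivWithinAt_iff_tendsto_slope]
    have hsl : ∀ t, slope w s t = ∫ x,
        (Y₁ s x * (z * slope (fun r => u r x) s t) * G t x +
          Y₂ s x * (σ * conj (slope (fun r => u r x) s t)) * F t x) := by
      intro t
      rw [slope, vsub_eq_sub, Complex.real_smul]
      simp only [hw]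
      rw [wronskian_sub_eq_integral hσ hu bF bG bY₁ bY₂ dF dG dY₁ dY₂ lF lG lY₁ lY₂ s t,
        ← integral_const_mul]
      congr 1; ext x
      simp only [slope, vsub_eq_sub, Complex.real_smul, map_mul, Complex.conj_ofReal]
      ring
    refine Tendsto.congr (fun t => (hsl t).symm) ?_
    -- By the mean value inequality the difference quotients in time inherit the spatial decay of
    -- the right-hand side, which dominates the integrals uniformly in t.
    have hslb : ∀ t ∈ Set.Icc 0 T, ∀ x, ‖slope (fun r => u r x) s t‖ ≤
        (C + 3 * C ^ 3) * (1 + x ^ 2)⁻¹ := by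
      intro t ht x
      have h1 := (convex_Icc (0 : ℝ) T).norm_image_sub_le_of_norm_hasDerivWithin_le
        (fun r hr => hut x r hr) (fun r _ => norm_rhs_le hσ hu r x) hs ht
      rw [slope, vsub_eq_sub, norm_smul, norm_inv]
      rcases eq_or_ne t s with rfl | hts
      · simp only [sub_self, norm_zero, mul_zero]; positivity
      · rw [inv_mul_le_iff₀ (norm_pos_iff.2 (sub_ne_zero.2 hts)), mul_comm]
        exact h1
    refine tendsto_integral_filter_of_dominated_convergence
      (fun x => (M * (‖z‖ * (C + 3 * C ^ 3)) * M + M * (C + 3 * C ^ 3) * M) * (1 + x ^ 2)⁻¹)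
      (Eventually.of_forall fun t => ?_) ?_ (integrable_inv_one_add_sq.const_mul _)
      (ae_of_all _ fun x => ?_)
    · have e0 := xF t; have e1 := xG t; have e2 := xY₁ s; have e3 := xY₂ s
      have e4 := hu.cont_x t; have e5 := hu.cont_x s
      simp only [slope, vsub_eq_sub, Complex.real_smul]
      exact Continuous.aestronglyMeasurable (by fun_prop)
    · have : ∀ᶠ t in 𝓝[Set.Icc 0 T \ {s}] s, t ∈ Set.Icc 0 T := by
        filter_upwards [self_mem_nhdsWithin] with t ht using ht.1
      filter_upwards [this] with t ht
      refine ae_of_all _ fun x => ?_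
      have hr := hslb t ht x
      refine (norm_add_le _ _).trans ?_
      simp only [norm_mul, hσ', one_mul, RCLike.norm_conj]
      calc ‖Y₁ s x‖ * (‖z‖ * ‖slope (fun r => u r x) s t‖) * ‖G t x‖ +
            ‖Y₂ s x‖ * ‖slope (fun r => u r x) s t‖ * ‖F t x‖
          ≤ M * (‖z‖ * ((C + 3 * C ^ 3) * (1 + x ^ 2)⁻¹)) * M +
            M * ((C + 3 * C ^ 3) * (1 + x ^ 2)⁻¹) * M := by
            gcongr
            · exact bY₁ s x
            · exact bG t x
            · exact bY₂ s x
            · exact bF t x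
        _ = _ := by ring
    · have h1 := hasDerivWithinAt_iff_tendsto_slope.1 (hut x s hs)
      have h2 : Tendsto (fun t => G t x) (𝓝[Set.Icc 0 T \ {s}] s) (𝓝 (G s x)) :=
        ((cG x).tendsto s).mono_left nhdsWithin_le_nhds
      have h3 : Tendsto (fun t => F t x) (𝓝[Set.Icc 0 T \ {s}] s) (𝓝 (F s x)) :=
        ((cF x).tendsto s).mono_left nhdsWithin_le_nhds
      exact (((h1.const_mul z).const_mul (Y₁ s x)).mul h2).add
        (((((Complex.continuous_conj.tendsto _).comp h1).const_mul (σ : ℂ)).const_mul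
          (Y₂ s x)).mul h3)
  have hexp : ∀ s : ℝ, HasDerivAt (fun s : ℝ => exp (-(4 * I * z ^ 2 * κ * s)))
      (-(4 * I * z ^ 2 * κ) * exp (-(4 * I * z ^ 2 * κ * s))) s := by
    intro s
    have := ((hasDerivAt_id s).ofReal_comp.const_mul (4 * I * z ^ 2 * κ)).neg.cexp
    refine this.congr_deriv ?_
    simp [mul_comm]
  have hprod : ∀ s ∈ Set.Icc 0 T, HasDerivWithinAt
      (fun s : ℝ => exp (-(4 * I * z ^ 2 * κ * s)) * w s) 0 (Set.Icc 0 T) s := by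
    intro s hs
    refine ((hexp s).hasDerivWithinAt.mul (hderiv s hs)).congr_deriv ?_
    ring
  have hconst := constant_of_has_deriv_right_zero
    (f := fun s : ℝ => exp (-(4 * I * z ^ 2 * κ * s)) * w s)
    (fun s hs => (hprod s hs).continuousWithinAt) (fun s hs => by
      have h1 := hprod s ⟨hs.1, hs.2.le⟩
      exact h1.mono_of_mem_nhdsWithin (Icc_mem_nhdsGE_of_mem hs)) t ht
  simp only [Complex.ofReal_zero, mul_zero, neg_zero, Complex.exp_zero, one_mul] at hconst
  change w t = _ * w 0
  rw [← hconst, ← mul_assoc, ← Complex.exp_add]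
  simp

end evolution

/-! ### Time evolution of the scattering coefficients. -/

section scattering

variable {σ T : ℝ} {u u' u'' : ℝ → ℝ → ℂ} {C : ℝ} {f g h c d e : ℝ → ℂ → ℝ → ℂ}

theorem ofReal_mul_self_of_abs_eq_one (hσ : |σ| = 1) : (σ : ℂ) * σ = 1 := by
  rw [← Complex.ofReal_mul, ← abs_mul_abs_self, hσ]; simp

theorem exists_real_phase (σ : ℝ) (u : ℝ → ℝ → ℂ) :
    ∃ δ : ℝ → ℝ → ℝ, ∀ t x, phase σ (u t) x = (δ t x : ℂ) :=
  ⟨fun t x => -leftPhase σ (fun y => u t (-y)) (-x), fun t x => by rw [phase_eq]; push_cast; rfl⟩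

/-- The factor between the Wronskians of the Jost columns and those of the columns in the
original gauge. -/
def gaugeFactor (σ : ℝ) (u : ℝ → ℂ) : ℂ := exp (I * leftPhase σ u 0) * exp (-(I * phase σ u 0))

theorem gaugeFactor_ne_zero (σ : ℝ) (u : ℝ → ℂ) : gaugeFactor σ u ≠ 0 :=
  mul_ne_zero (Complex.exp_ne_zero _) (Complex.exp_ne_zero _)

/-- Time evolution of the pairing of the first Jost column, in the original gauge, with a family
of row solutions. -/
theorem jost_pairing_evolution (hσ : |σ| = 1) (hu : PotentialFamily u u' u'' C)
    (hut : ∀ x, ∀ t ∈ Set.Icc 0 T,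
      HasDerivWithinAt (fun s => u s x) (rhs σ u u' u'' t x) (Set.Icc 0 T) t)
    (hJ : IsJost σ (gauge σ u) f g h) {z : ℂ} (hz : 0 ≤ z.im) {Y₁ Y₂ : ℝ → ℝ → ℂ} {κ : ℂ} {M : ℝ}
    (bY₁ : ∀ t x, ‖Y₁ t x‖ ≤ M) (bY₂ : ∀ t x, ‖Y₂ t x‖ ≤ M)
    (dY₁ : ∀ t x, HasDerivAt (Y₁ t) (-(σ * conj (u t x) * Y₂ t x)) x)
    (dY₂ : ∀ t x, HasDerivAt (Y₂ t) (-(z * u t x * Y₁ t x) - 2 * I * z * Y₂ t x) x)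
    (lY₁ : ∀ s t, Tendsto (fun x => Y₁ s x - Y₁ t x) atTop (𝓝 0))
    (lY₂ : ∀ s t, Tendsto (fun x => Y₂ s x - Y₂ t x) atTop (𝓝 0))
    (hκ : (κ = 0 ∧ ∀ t, Tendsto (Y₂ t) atTop (𝓝 0)) ∨ (κ = 1 ∧ ∀ t, Tendsto (Y₁ t) atTop (𝓝 0)))
    {t : ℝ} (ht : t ∈ Set.Icc 0 T) :
    Y₁ t 0 * (exp (I * leftPhase σ (u t) 0) * f t z 0) +
        Y₂ t 0 * (exp (I * leftPhase σ (u t) 0) * exp (-2 * I * phase σ (u t) 0) * g t z 0) =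
      exp (4 * I * z ^ 2 * κ * t) * (Y₁ 0 0 * (exp (I * leftPhase σ (u 0) 0) * f 0 z 0) +
        Y₂ 0 0 * (exp (I * leftPhase σ (u 0) 0) * exp (-2 * I * phase σ (u 0) 0) * g 0 z 0)) := by
  obtain ⟨M', hM'⟩ := hJ.bound
  have hdθ := hasDerivAt_leftPhase hσ hu
  have hdδ := hasDerivAt_phase hσ hu
  set F : ℝ → ℝ → ℂ := fun t x => exp (I * leftPhase σ (u t) x) * f t z x with hF
  set G : ℝ → ℝ → ℂ := fun t x =>
    exp (I * leftPhase σ (u t) x) * exp (-2 * I * phase σ (u t) x) * g t z x with hG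
  have bF : ∀ t x, ‖F t x‖ ≤ max M M' := fun t x => by
    simp only [hF]
    rw [norm_mul, norm_exp_I_mul_ofReal', one_mul]
    exact le_max_of_le_right (hM' t z x).1
  have bG : ∀ t x, ‖G t x‖ ≤ max M M' := fun t x => by
    simp only [hG]
    rw [norm_mul, norm_mul, norm_exp_I_mul_ofReal', norm_exp_phase, one_mul, one_mul]
    exact le_max_of_le_right (hM' t z x).2
  have hM0 : 0 ≤ max M M' := (norm_nonneg _).trans (bF 0 0)
  have dF : ∀ t x, HasDerivAt (F t) (z * u t x * G t x) x := by
    intro t x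
    refine ((((hdθ t x).const_mul I).cexp).mul (hJ.deriv_f t z x hz)).congr_deriv ?_
    simp only [hG]
    rw [gauge_mul_conj, gauge]
    ring
  have dG : ∀ t x, HasDerivAt (G t) (2 * I * z * G t x + σ * conj (u t x) * F t x) x := by
    intro t x
    refine (((((hdθ t x).const_mul I).cexp).mul (((hdδ t x).const_mul (-2 * I)).cexp)).mul
      (hJ.deriv_g t z x hz)).congr_deriv ?_
    have h1 : exp (2 * I * phase σ (u t) x) * exp (-2 * I * phase σ (u t) x) = 1 := by
      rw [← Complex.exp_add]; ring_nf; simp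
    simp only [hG, hF, Pi.mul_apply]
    rw [gauge_mul_conj, conj_gauge]
    linear_combination (exp (I * leftPhase σ (u t) x) * σ * conj (u t x) * f t z x) * h1
  have hθ1 : ∀ t, Tendsto (fun x => exp (I * leftPhase σ (u t) x)) atBot (𝓝 1) := fun t => by
    have := (Complex.continuous_exp.tendsto _).comp ((tendsto_leftPhase hσ hu t).const_mul I)
    simpa [Function.comp_def] using this
  have lF : ∀ t, Tendsto (F t) atBot (𝓝 1) := fun t => by
    simpa using (hθ1 t).mul (hJ.lim_f t z hz)
  have lG : ∀ t, Tendsto (G t) atBot (𝓝 0) := fun t => by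
    have h1 := hJ.lim_g t z hz
    rw [tendsto_zero_iff_norm_tendsto_zero] at h1 ⊢
    refine h1.congr fun x => ?_
    simp only [hG]
    rw [norm_mul, norm_mul, norm_exp_I_mul_ofReal', norm_exp_phase, one_mul, one_mul]
  have hθc : ∀ x, Continuous fun t => (leftPhase σ (u t) x : ℂ) := fun x =>
    (continuous_leftPhase hσ hu).comp (by fun_prop : Continuous fun t : ℝ => (t, x))
  have hδc : ∀ x, Continuous fun t => phase σ (u t) x := fun x =>
    (continuous_phase hσ hu).comp (by fun_prop : Continuous fun t : ℝ => (t, x))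
  have hfc : ∀ x, Continuous fun t => f t z x := fun x =>
    hJ.cont_f.comp (by fun_prop : Continuous fun t : ℝ => ((t, z), x))
  have hgc : ∀ x, Continuous fun t => g t z x := fun x =>
    hJ.cont_g.comp (by fun_prop : Continuous fun t : ℝ => ((t, z), x))
  have cF : ∀ x, Continuous fun t => F t x := fun x =>
    (Complex.continuous_exp.comp (continuous_const.mul (hθc x))).mul (hfc x)
  have cG : ∀ x, Continuous fun t => G t x := fun x =>
    ((Complex.continuous_exp.comp (continuous_const.mul (hθc x))).mul
      (Complex.continuous_exp.comp (continuous_const.mul (hδc x)))).mul (hgc x)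
  have hmul0 : ∀ {a b : ℝ → ℂ}, (∀ x, ‖b x‖ ≤ max M M') → Tendsto a atTop (𝓝 0) →
      Tendsto (fun x => a x * b x) atTop (𝓝 0) := by
    intro a b hb ha
    refine squeeze_zero_norm (a := fun x => ‖a x‖ * max M M') (fun x => ?_) ?_
    · rw [norm_mul]
      exact mul_le_mul_of_nonneg_left (hb x) (norm_nonneg _)
    · simpa using (tendsto_zero_iff_norm_tendsto_zero.1 ha).mul_const (max M M')
  have lκ : ∀ t, Tendsto (fun x => Y₂ t x * G t x) atTop
      (𝓝 (κ * (Y₁ t 0 * F t 0 + Y₂ t 0 * G t 0))) := by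
    intro t
    rcases hκ with ⟨rfl, hY⟩ | ⟨rfl, hY⟩
    · rw [zero_mul]
      exact hmul0 (bG t) (hY t)
    -- The Wronskian is constant in x and its first term dies at +∞, so the second term alone tends
    -- to all of it: κ = 1.
    · have hconst : ∀ x, Y₁ t x * F t x + Y₂ t x * G t x = Y₁ t 0 * F t 0 + Y₂ t 0 * G t 0 := by
        intro x
        refine eq_of_hasDerivAt_zero (F := fun x => Y₁ t x * F t x + Y₂ t x * G t x)
          (fun x => ?_) x 0
        refine (((dY₁ t x).mul (dF t x)).add ((dY₂ t x).mul (dG t x))).congr_deriv ?_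
        ring
      have h1 := (hmul0 (bF t) (hY t)).const_sub (Y₁ t 0 * F t 0 + Y₂ t 0 * G t 0)
      rw [sub_zero] at h1
      rw [one_mul]
      refine h1.congr fun x => ?_
      rw [← hconst x]; ring
  exact wronskian_evolution hσ hu hut bF bG (fun t x => le_max_of_le_left (bY₁ t x))
    (fun t x => le_max_of_le_left (bY₂ t x)) cF cG dF dG dY₁ dY₂ lF lG lY₁ lY₂ lκ ht

theorem norm_exp_neg_I_phase (σ : ℝ) (u : ℝ → ℝ → ℂ) (t x : ℝ) :
    ‖exp (-(I * phase σ (u t) x))‖ = 1 := by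
  obtain ⟨δ, hδ⟩ := exists_real_phase σ u
  have : -(I * (δ t x : ℂ)) = I * ((-δ t x : ℝ) : ℂ) := by push_cast; ring
  rw [hδ, this, norm_exp_I_mul_ofReal']

theorem norm_exp_I_phase (σ : ℝ) (u : ℝ → ℝ → ℂ) (t x : ℝ) :
    ‖exp (I * phase σ (u t) x)‖ = 1 := by
  obtain ⟨δ, hδ⟩ := exists_real_phase σ u
  rw [hδ, norm_exp_I_mul_ofReal']

theorem tendsto_exp_neg_I_phase (hσ : |σ| = 1) (hu : PotentialFamily u u' u'' C) (t : ℝ) :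
    Tendsto (fun x => exp (-(I * phase σ (u t) x))) atTop (𝓝 1) := by
  have := (Complex.continuous_exp.tendsto _).comp ((tendsto_phase hσ hu t).const_mul I).neg
  simpa [Function.comp_def] using this

theorem tendsto_exp_I_phase (hσ : |σ| = 1) (hu : PotentialFamily u u' u'' C) (t : ℝ) :
    Tendsto (fun x => exp (I * phase σ (u t) x)) atTop (𝓝 1) := by
  have := (Complex.continuous_exp.tendsto _).comp ((tendsto_phase hσ hu t).const_mul I)
  simpa [Function.comp_def] using this

theorem exp_phase_identities (σ : ℝ) (u : ℝ → ℂ) (x : ℝ) :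
    exp (-(I * phase σ u x)) * exp (2 * I * phase σ u x) = exp (I * phase σ u x) ∧
    exp (I * phase σ u x) * exp (-2 * I * phase σ u x) = exp (-(I * phase σ u x)) := by
  constructor <;> · rw [← Complex.exp_add]; ring_nf

/-- The row is (e^{-iδ}d, -z e^{iδ}c), the right Jost column with its gauge removed. Its second
entry vanishes at +∞, so κ = 0 and nothing evolves. -/
theorem gaugeFactor_mul_wronskianA (hσ : |σ| = 1) (hu : PotentialFamily u u' u'' C)
    (hut : ∀ x, ∀ t ∈ Set.Icc 0 T,
      HasDerivWithinAt (fun s => u s x) (rhs σ u u' u'' t x) (Set.Icc 0 T) t)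
    (hJ : IsJost σ (gauge σ u) f g h) (hR : IsRightJost σ (gauge σ u) c d e)
    {z : ℂ} (hz : 0 ≤ z.im) {t : ℝ} (ht : t ∈ Set.Icc 0 T) :
    gaugeFactor σ (u t) * wronskianA f g c d t z =
      gaugeFactor σ (u 0) * wronskianA f g c d 0 z := by
  obtain ⟨M, hM⟩ := hR.bound
  have hM0 : 0 ≤ M := (norm_nonneg _).trans (hM 0 0 0).1
  have hdδ := hasDerivAt_phase hσ hu
  have hzM : 0 ≤ ‖z‖ * M := by positivity
  have lY₂ : ∀ t, Tendsto (fun x => -(z * (exp (I * phase σ (u t) x) * c t z x))) atTop (𝓝 0) :=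
    fun t => by
      simpa using (((tendsto_exp_I_phase hσ hu t).mul (hR.lim_c t z hz)).const_mul z).neg
  have lY₁ : ∀ t, Tendsto (fun x => exp (-(I * phase σ (u t) x)) * d t z x) atTop (𝓝 1) :=
    fun t => by simpa using (tendsto_exp_neg_I_phase hσ hu t).mul (hR.lim_d t z hz)
  have key := jost_pairing_evolution hσ hu hut hJ hz
    (Y₁ := fun t x => exp (-(I * phase σ (u t) x)) * d t z x)
    (Y₂ := fun t x => -(z * (exp (I * phase σ (u t) x) * c t z x))) (κ := 0) (M := M + ‖z‖ * M)
    (fun t x => by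
      rw [norm_mul, norm_exp_neg_I_phase, one_mul]
      linarith [(hM t z x).2])
    (fun t x => by
      rw [norm_neg, norm_mul, norm_mul, norm_exp_I_phase, one_mul]
      nlinarith [(hM t z x).1, norm_nonneg z])
    (fun t x => by
      refine ((((hdδ t x).const_mul I).neg.cexp).mul (hR.deriv_d t z x hz)).congr_deriv ?_
      rw [gauge_mul_conj, conj_gauge]
      simp only [Pi.neg_apply]
      linear_combination (z * σ * conj (u t x) * c t z x) * (exp_phase_identities σ (u t) x).1)
    (fun t x => by
      refine (((((hdδ t x).const_mul I).cexp).mul (hR.deriv_c t z x hz)).const_mul z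
        ).neg.congr_deriv ?_
      rw [gauge_mul_conj, gauge]
      linear_combination (-(z * u t x * d t z x)) * (exp_phase_identities σ (u t) x).2)
    (fun s t => by simpa using (lY₁ s).sub (lY₁ t))
    (fun s t => by simpa using (lY₂ s).sub (lY₂ t))
    (Or.inl ⟨rfl, lY₂⟩) ht
  have hid := fun t => (exp_phase_identities σ (u t) 0).2
  simp only [mul_zero, zero_mul, Complex.exp_zero, one_mul] at key
  simp only [gaugeFactor, wronskianA]
  linear_combination key +
    z * exp (I * leftPhase σ (u t) 0) * g t z 0 * c t z 0 * hid t -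
    z * exp (I * leftPhase σ (u 0) 0) * g 0 z 0 * c 0 z 0 * hid 0

/-- Here the row comes from the conjugated right column, e^{-2ilx}(-e^{-iδ}σc̄, e^{iδ}d̄). Its first
entry vanishes at +∞, so κ = 1 and the factor e^{4il²t} appears. -/
theorem gaugeFactor_mul_wronskianB (hσ : |σ| = 1) (hu : PotentialFamily u u' u'' C)
    (hut : ∀ x, ∀ t ∈ Set.Icc 0 T,
      HasDerivWithinAt (fun s => u s x) (rhs σ u u' u'' t x) (Set.Icc 0 T) t)
    (hJ : IsJost σ (gauge σ u) f g h) (hR : IsRightJost σ (gauge σ u) c d e)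
    (l : ℝ) {t : ℝ} (ht : t ∈ Set.Icc 0 T) :
    gaugeFactor σ (u t) * wronskianB σ f g c d t l =
      exp (4 * I * l ^ 2 * t) * (gaugeFactor σ (u 0) * wronskianB σ f g c d 0 l) := by
  have hl : 0 ≤ (l : ℂ).im := by simp
  have hσ' : ‖(σ : ℂ)‖ = 1 := by rw [Complex.norm_real, Real.norm_eq_abs, hσ]
  have hσ2 := ofReal_mul_self_of_abs_eq_one hσ
  obtain ⟨M, hM⟩ := hR.bound
  have hdδ := hasDerivAt_phase hσ hu
  have hcc := Complex.continuous_conj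
  have hosc : ∀ x : ℝ, ‖exp (-(2 * I * l * x))‖ = 1 := fun x => by
    have : -(2 * I * l * x) = I * ((-(2 * l * x) : ℝ) : ℂ) := by push_cast; ring
    rw [this, norm_exp_I_mul_ofReal']
  have hosc0 : ∀ {b : ℝ → ℂ}, Tendsto b atTop (𝓝 0) →
      Tendsto (fun x : ℝ => exp (-(2 * I * l * x)) * b x) atTop (𝓝 0) := by
    intro b hb
    rw [tendsto_zero_iff_norm_tendsto_zero] at hb ⊢
    exact hb.congr fun x => by rw [norm_mul, hosc, one_mul]
  have lY₁ : ∀ t, Tendsto (fun x : ℝ => exp (-(2 * I * l * x)) *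
      (-(exp (-(I * phase σ (u t) x)) * (σ * conj (c t l x))))) atTop (𝓝 0) := fun t => by
    refine hosc0 ?_
    have := ((tendsto_exp_neg_I_phase hσ hu t).mul
      (((hcc.tendsto _).comp (hR.lim_c t l hl)).const_mul (σ : ℂ))).neg
    simpa [Function.comp_def] using this
  have lY₂ : ∀ t, Tendsto (fun x => exp (I * phase σ (u t) x) * conj (d t l x)) atTop (𝓝 1) :=
    fun t => by
      have := (tendsto_exp_I_phase hσ hu t).mul ((hcc.tendsto _).comp (hR.lim_d t l hl))
      simpa [Function.comp_def] using this
  have hgg : ∀ t x, conj (gauge σ u t x) * gauge σ u t x = conj (u t x) * u t x := fun t x => by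
    have := gauge_mul_conj σ u t x
    linear_combination (σ : ℂ) * this -
      (conj (gauge σ u t x) * gauge σ u t x - conj (u t x) * u t x) * hσ2
  have key := jost_pairing_evolution hσ hu hut hJ hl
    (Y₁ := fun t x => exp (-(2 * I * l * x)) *
      (-(exp (-(I * phase σ (u t) x)) * (σ * conj (c t l x)))))
    (Y₂ := fun t x => exp (-(2 * I * l * x)) * (exp (I * phase σ (u t) x) * conj (d t l x)))
    (κ := 1) (M := M)
    (fun t x => by
      rw [norm_mul, hosc, norm_neg, norm_mul, norm_exp_neg_I_phase, norm_mul, hσ',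
        RCLike.norm_conj, one_mul, one_mul, one_mul]
      exact (hM t l x).1)
    (fun t x => by
      rw [norm_mul, hosc, norm_mul, norm_exp_I_phase, RCLike.norm_conj, one_mul, one_mul]
      exact (hM t l x).2)
    (fun t x => by
      have hc := HasDerivAt.conj (hR.deriv_c t l x hl)
      refine ((hasDerivAt_exp_neg l x).mul ((((hdδ t x).const_mul I).neg.cexp).mul
        (hc.const_mul (σ : ℂ))).neg).congr_deriv ?_
      simp only [map_mul, map_add, map_sub, map_neg, Complex.conj_conj, Complex.conj_I,
        map_div₀, Complex.conj_ofReal, map_ofNat, Pi.neg_apply, Pi.mul_apply]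
      linear_combination (-(exp (-(2 * I * l * x)) * exp (-(I * phase σ (u t) x)) * σ *
        conj (d t l x))) * conj_gauge σ u t x + (-(exp (-(2 * I * l * x)) * σ * conj (u t x) * conj (d t l x))) *
        (exp_phase_identities σ (u t) x).1 -
        (I / 2 * exp (-(2 * I * l * x)) * exp (-(I * phase σ (u t) x)) * σ ^ 2 *
          conj (c t l x)) * hgg t x)
    (fun t x => by
      have hd := HasDerivAt.conj (hR.deriv_d t l x hl)
      refine ((hasDerivAt_exp_neg l x).mul ((((hdδ t x).const_mul I).cexp).mul
        hd)).congr_deriv ?_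
      simp only [map_mul, map_add, Complex.conj_conj, Complex.conj_I,
        map_div₀, Complex.conj_ofReal, map_ofNat, Pi.mul_apply]
      have h2 := (exp_phase_identities σ (u t) x).2
      have h3 : gauge σ u t x = u t x * exp (-2 * I * phase σ (u t) x) := rfl
      linear_combination
        (-(I / 2) * σ * exp (-(2 * I * l * x)) * exp (I * phase σ (u t) x) * conj (d t l x)) *
          hgg t x +
        (l * u t x * σ * conj (c t l x) * exp (-(2 * I * l * x))) * h2 +
        (l * σ * conj (c t l x) * exp (-(2 * I * l * x)) * exp (I * phase σ (u t) x)) * h3)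
    (fun s t => by simpa using (lY₁ s).sub (lY₁ t))
    -- The second entry oscillates and has no limit in general; only differences between two times
    -- tend to zero.
    (fun s t => by
      have := hosc0 (b := fun x => exp (I * phase σ (u s) x) * conj (d s l x) -
        exp (I * phase σ (u t) x) * conj (d t l x)) (by simpa using (lY₂ s).sub (lY₂ t))
      exact this.congr fun x => by ring)
    (Or.inr ⟨rfl, lY₁⟩) ht
  have hid := fun t => (exp_phase_identities σ (u t) 0).2
  simp only [mul_zero, neg_zero, Complex.exp_zero, one_mul, Complex.ofReal_zero, mul_one] at key
  simp only [gaugeFactor, wronskianB]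
  linear_combination key -
    exp (I * leftPhase σ (u t) 0) * g t l 0 * conj (d t l 0) * hid t +
    exp (4 * I * l ^ 2 * t) * exp (I * leftPhase σ (u 0) 0) * g 0 l 0 * conj (d 0 l 0) * hid 0

instance neBot_cocompact_inf_upper : (cocompact ℂ ⊓ 𝓟 {z : ℂ | 0 ≤ z.im}).NeBot := by
  have h1 : Tendsto (fun n : ℕ => (n : ℂ) * I) atTop (cocompact ℂ ⊓ 𝓟 {z : ℂ | 0 ≤ z.im}) := by
    refine tendsto_inf.2 ⟨?_, tendsto_principal.2 (Eventually.of_forall fun n => by simp)⟩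
    rw [← Metric.cobounded_eq_cocompact, ← tendsto_norm_atTop_iff_cobounded]
    simpa using tendsto_natCast_atTop_atTop (R := ℝ)
  exact h1.neBot

/-- The factor is exp((i/2)∫σ|u|²) over the whole line. Its constancy, a form of mass conservation,
follows by letting z → ∞ in `gaugeFactor_mul_wronskianA`, where A → 1 at both times. -/
theorem gaugeFactor_eq (hσ : |σ| = 1) (hu : PotentialFamily u u' u'' C)
    (hut : ∀ x, ∀ t ∈ Set.Icc 0 T,
      HasDerivWithinAt (fun s => u s x) (rhs σ u u' u'' t x) (Set.Icc 0 T) t)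
    (hJ : IsJost σ (gauge σ u) f g h) (hR : IsRightJost σ (gauge σ u) c d e)
    {t : ℝ} (ht : t ∈ Set.Icc 0 T) : gaugeFactor σ (u t) = gaugeFactor σ (u 0) := by
  have h1 := (tendsto_wronskianA hJ hR t).const_mul (gaugeFactor σ (u t))
  have h2 := (tendsto_wronskianA hJ hR 0).const_mul (gaugeFactor σ (u 0))
  rw [mul_one] at h1 h2
  refine tendsto_nhds_unique h1 (h2.congr' ?_)
  filter_upwards [Filter.Eventually.filter_mono inf_le_right (mem_principal_self _)] with z hz
  exact (gaugeFactor_mul_wronskianA hσ hu hut hJ hR hz ht).symm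

/-- The transmission function does not depend on time. -/
theorem wronskianA_evolution (hσ : |σ| = 1) (hu : PotentialFamily u u' u'' C)
    (hut : ∀ x, ∀ t ∈ Set.Icc 0 T,
      HasDerivWithinAt (fun s => u s x) (rhs σ u u' u'' t x) (Set.Icc 0 T) t)
    (hJ : IsJost σ (gauge σ u) f g h) (hR : IsRightJost σ (gauge σ u) c d e)
    {z : ℂ} (hz : 0 ≤ z.im) {t : ℝ} (ht : t ∈ Set.Icc 0 T) :
    wronskianA f g c d t z = wronskianA f g c d 0 z := by
  have h1 := gaugeFactor_mul_wronskianA hσ hu hut hJ hR hz ht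
  rw [gaugeFactor_eq hσ hu hut hJ hR ht] at h1
  exact mul_left_cancel₀ (gaugeFactor_ne_zero _ _) h1

/-- The second scattering coefficient oscillates in time. -/
theorem wronskianB_evolution (hσ : |σ| = 1) (hu : PotentialFamily u u' u'' C)
    (hut : ∀ x, ∀ t ∈ Set.Icc 0 T,
      HasDerivWithinAt (fun s => u s x) (rhs σ u u' u'' t x) (Set.Icc 0 T) t)
    (hJ : IsJost σ (gauge σ u) f g h) (hR : IsRightJost σ (gauge σ u) c d e)
    (l : ℝ) {t : ℝ} (ht : t ∈ Set.Icc 0 T) :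
    wronskianB σ f g c d t l = exp (4 * I * l ^ 2 * t) * wronskianB σ f g c d 0 l := by
  have h1 := gaugeFactor_mul_wronskianB hσ hu hut hJ hR l ht
  rw [gaugeFactor_eq hσ hu hut hJ hR ht] at h1
  refine mul_left_cancel₀ (gaugeFactor_ne_zero σ (u 0)) ?_
  linear_combination h1

end scattering

/-! ### Identification with the columns of μ₁ and μ₂. -/

/-- Grönwall's lemma on a right half line. -/
theorem eq_zero_of_le_integral_Ioi {w : ℝ → ℝ} (hw : Continuous w) (h0 : ∀ x, 0 ≤ w x) {B C : ℝ}
    (hB : ∀ x, w x ≤ B) (hC : 0 < C)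
    (h : ∀ x, w x ≤ ∫ y in Set.Ioi x, C * (1 + y ^ 2)⁻¹ * w y) (x : ℝ) : w x = 0 := by
  have := eq_zero_of_le_integral_Iic (u := fun y => w (-y)) (hw.comp continuous_neg)
    (fun y => h0 _) (fun y => hB _) hC (fun y => by
      refine (h (-y)).trans (le_of_eq ?_)
      have := integral_comp_neg_Ioi (-y) (fun y : ℝ => C * (1 + y ^ 2)⁻¹ * w (-y))
      simpa using this) (-x)
  simpa using this

/-- A function solving `v' = -2 i lam v + φ` which tends to zero at `+∞` is an integral over the
right half line. -/
theorem eq_neg_integral_Ioi_of_hasDerivAt {lam : ℂ} (hl : 0 ≤ lam.im) {φ v : ℝ → ℂ}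
    (hi : Integrable φ) (hv : ∀ x, HasDerivAt v (-(2 * I * lam * v x) + φ x) x)
    (h0 : Tendsto v atTop (𝓝 0)) (x : ℝ) :
    v x = -∫ y in Set.Ioi x, exp (2 * I * lam * (y - x)) * φ y := by
  have h1 := eq_volterra_of_hasDerivAt hl (φ := fun y => -φ (-y)) (v := fun y => v (-y))
    hi.comp_neg.neg (fun y => by
      refine ((hv (-y)).scomp y (hasDerivAt_neg y)).congr_deriv ?_
      simp) (h0.comp tendsto_neg_atBot_atTop) (-x)
  have h2 := integral_comp_neg_Ioi x
    (fun y : ℝ => exp (2 * I * lam * (((-x : ℝ) : ℂ) - y)) * -φ (-y))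
  simp only [neg_neg] at h1 h2
  rw [h1, volterra, ← h2, ← integral_neg]
  congr 1; ext y
  push_cast
  ring_nf

section columns

variable {σ : ℝ} {u u' u'' : ℝ → ℝ → ℂ} {C : ℝ} {f g h c d e : ℝ → ℂ → ℝ → ℂ}

theorem V₁_mulVec (σ : ℝ) (u : ℝ → ℝ → ℂ) (t : ℝ) (k : ℂ) (y : ℝ) (w : Fin 2 → ℂ) :
    (V₁ σ (u t) k y).mulVec w 0 =
      -(I / 2) * (σ * conj (gauge σ u t y) * gauge σ u t y) * w 0 + k * gauge σ u t y * w 1 ∧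
    (V₁ σ (u t) k y).mulVec w 1 =
      k * (σ * conj (gauge σ u t y)) * w 0 +
        (I / 2) * (σ * conj (gauge σ u t y) * gauge σ u t y) * w 1 := by
  rw [gauge_mul_conj, conj_gauge, gauge]
  simp only [V₁, Matrix.mulVec, dotProduct, Fin.sum_univ_two, Matrix.of_apply,
    Matrix.cons_val_zero, Matrix.cons_val_one, Matrix.cons_val', Matrix.cons_val_fin_one]
  constructor <;> ring

theorem norm_V₁_mulVec_le (hσ : |σ| = 1) (hu : PotentialFamily u u' u'' C) (t : ℝ) (k : ℂ) (y : ℝ)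
    (w : Fin 2 → ℂ) (i : Fin 2) :
    ‖(V₁ σ (u t) k y).mulVec w i‖ ≤ (C ^ 2 + ‖k‖ * C) * (1 + y ^ 2)⁻¹ * ‖w‖ := by
  have hσ' : ‖(σ : ℂ)‖ = 1 := by rw [Complex.norm_real, Real.norm_eq_abs, hσ]
  have hC := hu.pos
  have h1 := hu.bound t y
  have h3 := hu.norm_le t y
  have h2 : ‖u t y‖ * ‖u t y‖ ≤ C * (C * (1 + y ^ 2)⁻¹) := by gcongr
  have hw0 := norm_le_pi_norm w 0
  have hw1 := norm_le_pi_norm w 1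
  obtain ⟨e0, e1⟩ := V₁_mulVec σ u t k y w
  have hA : ∀ a : ℂ, ‖a‖ ≤ ‖w‖ → 1 / 2 * (‖u t y‖ * ‖u t y‖) * ‖a‖ ≤
      (C ^ 2 * (1 + y ^ 2)⁻¹) * ‖w‖ := fun a ha => by
    have : 1 / 2 * (‖u t y‖ * ‖u t y‖) ≤ C ^ 2 * (1 + y ^ 2)⁻¹ := by
      nlinarith [mul_nonneg (norm_nonneg (u t y)) (norm_nonneg (u t y))]
    gcongr
  have hB : ∀ a : ℂ, ‖a‖ ≤ ‖w‖ → ‖k‖ * ‖u t y‖ * ‖a‖ ≤ (‖k‖ * (C * (1 + y ^ 2)⁻¹)) * ‖w‖ :=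
    fun a ha => by gcongr
  fin_cases i
  · refine (le_of_eq (congrArg norm e0)).trans ((norm_add_le _ _).trans ?_)
    simp only [norm_mul, norm_neg, norm_div, Complex.norm_I, Complex.norm_ofNat, hσ', one_mul,
      RCLike.norm_conj, norm_gauge]
    linarith [hA _ hw0, hB _ hw1]
  · refine (le_of_eq (congrArg norm e1)).trans ((norm_add_le _ _).trans ?_)
    simp only [norm_mul, norm_div, Complex.norm_I, Complex.norm_ofNat, hσ', one_mul,
      RCLike.norm_conj, norm_gauge]
    linarith [hA _ hw1, hB _ hw0]

theorem continuous_V₁_mulVec (hσ : |σ| = 1) (hu : PotentialFamily u u' u'' C) (t : ℝ) (k : ℂ)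
    {m : ℝ → Fin 2 → ℂ} (hm : Continuous m) (i : Fin 2) :
    Continuous fun y => (V₁ σ (u t) k y).mulVec (m y) i := by
  have hQ := (hu.gauge hσ).cont_x t
  fin_cases i
  · refine Continuous.congr ?_ fun y => (V₁_mulVec σ u t k y (m y)).1.symm
    fun_prop
  · refine Continuous.congr ?_ fun y => (V₁_mulVec σ u t k y (m y)).2.symm
    fun_prop

theorem integrable_V₁_mulVec (hσ : |σ| = 1) (hu : PotentialFamily u u' u'' C) (t : ℝ) (k : ℂ)
    {m : ℝ → Fin 2 → ℂ} (hm : Continuous m) {B : ℝ} (hB : ∀ x, ‖m x‖ ≤ B) (i : Fin 2) :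
    Integrable fun y => (V₁ σ (u t) k y).mulVec (m y) i := by
  have hC := hu.pos
  refine integrable_of_decay (C := (C ^ 2 + ‖k‖ * C) * B) (continuous_V₁_mulVec hσ hu t k hm i)
    fun y => (norm_V₁_mulVec_le hσ hu t k y (m y) i).trans ?_
  calc _ ≤ (C ^ 2 + ‖k‖ * C) * (1 + y ^ 2)⁻¹ * B := by gcongr; exact hB y
    _ = _ := by ring

theorem norm_integral_sub_le (hσ : |σ| = 1) (hu : PotentialFamily u u' u'' C) (t : ℝ) (k : ℂ)
    {m m' : ℝ → Fin 2 → ℂ} (hm : Continuous m) {B : ℝ} (hB : ∀ x, ‖m x‖ ≤ B)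
    (hm' : Continuous m') {B' : ℝ} (hB' : ∀ x, ‖m' x‖ ≤ B') {s : Set ℝ} (hs : MeasurableSet s)
    {E : ℝ → ℂ} (hE : Continuous E) (hE1 : ∀ y ∈ s, ‖E y‖ ≤ 1) (i : Fin 2) :
    ‖(∫ y in s, E y * (V₁ σ (u t) k y).mulVec (m y) i) -
      ∫ y in s, E y * (V₁ σ (u t) k y).mulVec (m' y) i‖ ≤
      ∫ y in s, (C ^ 2 + ‖k‖ * C) * (1 + y ^ 2)⁻¹ * ‖m y - m' y‖ := by
  have hC := hu.pos
  have hintegr : ∀ {n : ℝ → Fin 2 → ℂ} {D : ℝ}, Continuous n → (∀ x, ‖n x‖ ≤ D) →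
      IntegrableOn (fun y => E y * (V₁ σ (u t) k y).mulVec (n y) i) s := by
    intro n D hn hD
    have h1 := integrable_V₁_mulVec hσ hu t k hn hD i
    refine (h1.norm.integrableOn (s := s)).mono'
      (hE.mul (continuous_V₁_mulVec hσ hu t k hn i)).aestronglyMeasurable ?_
    refine (ae_restrict_iff' hs).2 (ae_of_all _ fun y hy => ?_)
    rw [norm_mul]
    exact mul_le_of_le_one_left (norm_nonneg _) (hE1 y hy)
  rw [← integral_sub (hintegr hm hB) (hintegr hm' hB')]
  refine norm_integral_le_of_norm_le ?_ ?_
  · have hi : Integrable fun y : ℝ => (C ^ 2 + ‖k‖ * C) * (1 + y ^ 2)⁻¹ * (B + B') :=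
      (integrable_inv_one_add_sq.const_mul _).mul_const _
    refine (hi.mono' ?_ (ae_of_all _ fun y => ?_)).integrableOn
    · have : ∀ y : ℝ, 1 + y ^ 2 ≠ 0 := fun y => by positivity
      exact Continuous.aestronglyMeasurable (by fun_prop (disch := exact this _))
    · rw [Real.norm_of_nonneg (by positivity)]
      gcongr
      exact (norm_sub_le _ _).trans (add_le_add (hB y) (hB' y))
  · refine (ae_restrict_iff' hs).2 (ae_of_all _ fun y hy => ?_)
    rw [← mul_sub, norm_mul, ← Pi.sub_apply, ← Matrix.mulVec_sub]
    exact (mul_le_of_le_one_left (norm_nonneg _) (hE1 y hy)).trans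
      (norm_V₁_mulVec_le hσ hu t k y _ i)

/-- The kernel is at most 1 on the integration ray, so the norm of the difference of two solutions
satisfies a homogeneous Grönwall inequality. -/
theorem IsJostColumn₂.unique (hσ : |σ| = 1) (hu : PotentialFamily u u' u'' C) {t : ℝ} {k : ℂ}
    {j : Fin 2} (hE : ∀ i (x y : ℝ), y ≤ x →
      ‖exp (-I * k ^ 2 * ((x : ℂ) - y) * (pauli i - pauli j))‖ ≤ 1)
    {m m' : ℝ → Fin 2 → ℂ} (hm : IsJostColumn₂ σ (u t) k j m)
    (hm' : IsJostColumn₂ σ (u t) k j m') : m = m' := by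
  obtain ⟨hc, ⟨B, hB⟩, h⟩ := hm
  obtain ⟨hc', ⟨B', hB'⟩, h'⟩ := hm'
  have hC := hu.pos
  ext1 x
  rw [← sub_eq_zero, ← norm_eq_zero]
  refine eq_zero_of_le_integral_Iic (u := fun x => ‖m x - m' x‖) (B := B + B')
    (C := C ^ 2 + ‖k‖ * C) (by fun_prop) (fun x => norm_nonneg _)
    (fun x => (norm_sub_le _ _).trans (add_le_add (hB x) (hB' x))) (by positivity) (fun x => ?_) x
  refine (pi_norm_le_iff_of_nonneg (integral_nonneg fun y => by positivity)).2 fun i => ?_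
  rw [Pi.sub_apply, h, h', add_sub_add_left_eq_sub]
  exact norm_integral_sub_le hσ hu t k hc hB hc' hB' measurableSet_Iic (by fun_prop)
    (fun y hy => hE i x y hy) i

theorem IsJostColumn₁.unique (hσ : |σ| = 1) (hu : PotentialFamily u u' u'' C) {t : ℝ} {k : ℂ}
    {j : Fin 2} (hE : ∀ i (x y : ℝ), x ≤ y →
      ‖exp (-I * k ^ 2 * ((x : ℂ) - y) * (pauli i - pauli j))‖ ≤ 1)
    {m m' : ℝ → Fin 2 → ℂ} (hm : IsJostColumn₁ σ (u t) k j m)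
    (hm' : IsJostColumn₁ σ (u t) k j m') : m = m' := by
  obtain ⟨hc, ⟨B, hB⟩, h⟩ := hm
  obtain ⟨hc', ⟨B', hB'⟩, h'⟩ := hm'
  have hC := hu.pos
  ext1 x
  rw [← sub_eq_zero, ← norm_eq_zero]
  refine eq_zero_of_le_integral_Ioi (w := fun x => ‖m x - m' x‖) (B := B + B')
    (C := C ^ 2 + ‖k‖ * C) (by fun_prop) (fun x => norm_nonneg _)
    (fun x => (norm_sub_le _ _).trans (add_le_add (hB x) (hB' x))) (by positivity) (fun x => ?_) x
  refine (pi_norm_le_iff_of_nonneg (integral_nonneg fun y => by positivity)).2 fun i => ?_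
  rw [Pi.sub_apply, h, h', sub_sub_sub_cancel_left, norm_sub_rev]
  exact norm_integral_sub_le hσ hu t k hc hB hc' hB' measurableSet_Ioi (by fun_prop)
    (fun y hy => hE i x y (le_of_lt hy)) i

theorem norm_vecCons_le {a b : ℂ} {A B : ℝ} (ha : ‖a‖ ≤ A) (hb : ‖b‖ ≤ B) :
    ‖(![a, b] : Fin 2 → ℂ)‖ ≤ A + B := by
  have hA := (norm_nonneg _).trans ha
  have hB := (norm_nonneg _).trans hb
  refine (pi_norm_le_iff_of_nonneg (by positivity)).2 fun i => ?_
  fin_cases i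
  · simpa using ha.trans (by linarith)
  · simpa using hb.trans (by linarith)

theorem continuous_vecCons {a b : ℝ → ℂ} (ha : Continuous a) (hb : Continuous b) :
    Continuous fun x => (![a x, b x] : Fin 2 → ℂ) := by
  refine continuous_pi fun i => ?_
  fin_cases i
  · simpa using ha
  · simpa using hb

theorem isJostColumn₂_zero (hσ : |σ| = 1) (hu : PotentialFamily u u' u'' C)
    (hJ : IsJost σ (gauge σ u) f g h) (t : ℝ) {k : ℂ} (hk : 0 ≤ (k ^ 2).im) :
    IsJostColumn₂ σ (u t) k 0 fun x => ![f t (k ^ 2) x, k * g t (k ^ 2) x] := by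
  obtain ⟨M, hM⟩ := hJ.bound
  have hi : Continuous fun x : ℝ => (((t, k ^ 2), x) : (ℝ × ℂ) × ℝ) := by fun_prop
  have hc : Continuous fun x => (![f t (k ^ 2) x, k * g t (k ^ 2) x] : Fin 2 → ℂ) :=
    continuous_vecCons (hJ.cont_f.comp hi) (continuous_const.mul (hJ.cont_g.comp hi))
  have hb : ∀ x, ‖(![f t (k ^ 2) x, k * g t (k ^ 2) x] : Fin 2 → ℂ)‖ ≤ M + ‖k‖ * M := fun x =>
    norm_vecCons_le (hM t _ x).1 (by rw [norm_mul]; gcongr; exact (hM t _ x).2)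
  have hintegr := integrable_V₁_mulVec hσ hu t k hc hb
  refine ⟨hc, ⟨_, hb⟩, fun x => Fin.forall_fin_two.2 ?_⟩
  have e := fun y => V₁_mulVec σ u t k y ![f t (k ^ 2) y, k * g t (k ^ 2) y]
  simp only [Matrix.cons_val_zero, Matrix.cons_val_one, Matrix.cons_val_fin_one] at e
  constructor
  · have := eq_volterra_of_hasDerivAt (lam := 0) (by simp) (hintegr 0)
      (v := fun x => f t (k ^ 2) x - 1) (fun y => by
        refine ((hJ.deriv_f t _ y hk).sub_const 1).congr_deriv ?_
        rw [(e y).1]; ring) (by simpa using (hJ.lim_f t _ hk).sub_const 1) x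
    simp only [volterra, mul_zero, zero_mul, Complex.exp_zero] at this
    simp only [Matrix.one_apply_eq, sub_self, mul_zero, Complex.exp_zero,
      Matrix.cons_val_zero]
    rw [← this]; ring
  · have := eq_volterra_of_hasDerivAt hk (hintegr 1)
      (v := fun x => k * g t (k ^ 2) x) (fun y => by
        refine ((hJ.deriv_g t _ y hk).const_mul k).congr_deriv ?_
        rw [(e y).2]; ring) (by simpa using (hJ.lim_g t _ hk).const_mul k) x
    simp only [Matrix.cons_val_one, Matrix.cons_val_fin_one]
    rw [this, volterra]
    simp only [pauli, ne_eq, one_ne_zero, not_false_eq_true, Matrix.one_apply_ne, zero_add,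
      if_false, if_true]
    congr 1; ext y
    ring_nf

theorem isJostColumn₁_one (hσ : |σ| = 1) (hu : PotentialFamily u u' u'' C)
    (hR : IsRightJost σ (gauge σ u) c d e) (t : ℝ) {k : ℂ} (hk : 0 ≤ (k ^ 2).im) :
    IsJostColumn₁ σ (u t) k 1 fun x => ![k * c t (k ^ 2) x, d t (k ^ 2) x] := by
  obtain ⟨M, hM⟩ := hR.bound
  have hi : Continuous fun x : ℝ => (((t, k ^ 2), x) : (ℝ × ℂ) × ℝ) := by fun_prop
  have hc : Continuous fun x => (![k * c t (k ^ 2) x, d t (k ^ 2) x] : Fin 2 → ℂ) :=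
    continuous_vecCons (continuous_const.mul (hR.cont_c.comp hi)) (hR.cont_d.comp hi)
  have hb : ∀ x, ‖(![k * c t (k ^ 2) x, d t (k ^ 2) x] : Fin 2 → ℂ)‖ ≤ ‖k‖ * M + M := fun x =>
    norm_vecCons_le (by rw [norm_mul]; gcongr; exact (hM t _ x).1) (hM t _ x).2
  have hintegr := integrable_V₁_mulVec hσ hu t k hc hb
  refine ⟨hc, ⟨_, hb⟩, fun x => Fin.forall_fin_two.2 ?_⟩
  have e := fun y => V₁_mulVec σ u t k y ![k * c t (k ^ 2) y, d t (k ^ 2) y]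
  simp only [Matrix.cons_val_zero, Matrix.cons_val_one, Matrix.cons_val_fin_one] at e
  constructor
  · have := eq_neg_integral_Ioi_of_hasDerivAt hk (hintegr 0)
      (v := fun x => k * c t (k ^ 2) x) (fun y => by
        refine ((hR.deriv_c t _ y hk).const_mul k).congr_deriv ?_
        rw [(e y).1]; ring) (by simpa using (hR.lim_c t _ hk).const_mul k) x
    simp only [Matrix.cons_val_zero]
    rw [this]
    simp only [pauli, ne_eq, zero_ne_one, one_ne_zero, not_false_eq_true, Matrix.one_apply_ne,
      zero_sub, if_false, if_true]
    congr 2; ext y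
    ring_nf
  · have := eq_neg_integral_Ioi_of_hasDerivAt (lam := 0) (by simp) (hintegr 1)
      (v := fun x => d t (k ^ 2) x - 1) (fun y => by
        refine ((hR.deriv_d t _ y hk).sub_const 1).congr_deriv ?_
        rw [(e y).2]; ring) (by simpa using (hR.lim_d t _ hk).sub_const 1) x
    simp only [mul_zero, zero_mul, Complex.exp_zero] at this
    simp only [Matrix.one_apply_eq, sub_self, mul_zero, Complex.exp_zero,
      Matrix.cons_val_one, Matrix.cons_val_fin_one]
    linear_combination this

/-- On k² ∈ ℝ conjugation exchanges the two columns of μ₁. The factor k stays outside the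
conjugation, since k is imaginary for l < 0. -/
theorem isJostColumn₁_zero (hσ : |σ| = 1) (hu : PotentialFamily u u' u'' C)
    (hR : IsRightJost σ (gauge σ u) c d e) (t : ℝ) {k : ℂ} {l : ℝ} (hk : k ^ 2 = l) :
    IsJostColumn₁ σ (u t) k 0 fun x => ![conj (d t l x), k * (σ * conj (c t l x))] := by
  have hl : 0 ≤ (l : ℂ).im := by simp
  have hσ' : ‖(σ : ℂ)‖ = 1 := by rw [Complex.norm_real, Real.norm_eq_abs, hσ]
  obtain ⟨M, hM⟩ := hR.bound
  have hcc := Complex.continuous_conj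
  have hi : Continuous fun x : ℝ => (((t, (l : ℂ)), x) : (ℝ × ℂ) × ℝ) := by fun_prop
  have hc : Continuous fun x => (![conj (d t l x), k * (σ * conj (c t l x))] : Fin 2 → ℂ) :=
    continuous_vecCons (hcc.comp (hR.cont_d.comp hi))
      (continuous_const.mul (continuous_const.mul (hcc.comp (hR.cont_c.comp hi))))
  have hb : ∀ x, ‖(![conj (d t l x), k * (σ * conj (c t l x))] : Fin 2 → ℂ)‖ ≤ M + ‖k‖ * M :=
    fun x => norm_vecCons_le (by rw [RCLike.norm_conj]; exact (hM t _ x).2)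
      (by rw [norm_mul, norm_mul, hσ', one_mul, RCLike.norm_conj]; gcongr; exact (hM t _ x).1)
  have hintegr := integrable_V₁_mulVec hσ hu t k hc hb
  refine ⟨hc, ⟨_, hb⟩, fun x => Fin.forall_fin_two.2 ?_⟩
  have e := fun y => V₁_mulVec σ u t k y ![conj (d t l y), k * (σ * conj (c t l y))]
  simp only [Matrix.cons_val_zero, Matrix.cons_val_one, Matrix.cons_val_fin_one] at e
  have hlc := (hcc.tendsto _).comp (hR.lim_c t l hl)
  have hld := (hcc.tendsto _).comp (hR.lim_d t l hl)
  rw [map_zero] at hlc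
  rw [map_one] at hld
  constructor
  · have := eq_neg_integral_Ioi_of_hasDerivAt (lam := 0) (by simp) (hintegr 0)
      (v := fun x => conj (d t l x) - 1) (fun y => by
        refine ((HasDerivAt.conj (hR.deriv_d t l y hl)).sub_const 1).congr_deriv ?_
        rw [(e y).1]
        simp only [map_mul, map_add, Complex.conj_conj, Complex.conj_I, map_div₀,
          Complex.conj_ofReal, map_ofNat]
        linear_combination (-(σ * gauge σ u t y * conj (c t l y))) * hk)
      (by simpa using hld.sub_const 1) x
    simp only [mul_zero, zero_mul, Complex.exp_zero] at this
    simp only [Matrix.one_apply_eq, sub_self, mul_zero, Complex.exp_zero,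
      Matrix.cons_val_zero]
    linear_combination this
  -- Conjugation reverses the oscillation, hence the parameter -l, which is admissible because it is
  -- real.
  · have := eq_neg_integral_Ioi_of_hasDerivAt (lam := ((-l : ℝ) : ℂ)) (by simp) (hintegr 1)
      (v := fun x => k * (σ * conj (c t l x))) (fun y => by
        refine (((HasDerivAt.conj (hR.deriv_c t l y hl)).const_mul (σ : ℂ)).const_mul
          k).congr_deriv ?_
        rw [(e y).2]
        simp only [map_mul, map_add, map_sub, map_neg, Complex.conj_conj, Complex.conj_I, map_div₀,
          Complex.conj_ofReal, map_ofNat]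
        push_cast
        ring)
      (by simpa using (hlc.const_mul (σ : ℂ)).const_mul k) x
    simp only [Matrix.cons_val_one, Matrix.cons_val_fin_one]
    rw [this, hk]
    simp only [pauli, ne_eq, one_ne_zero, not_false_eq_true, Matrix.one_apply_ne,
      zero_sub, if_false, if_true]
    congr 2; ext y
    push_cast
    ring_nf

theorem norm_exp_pauli_le {w : ℂ} {s : ℝ} (h0 : 0 ≤ w.im * s) (i : Fin 2) :
    ‖exp (-I * w * s * (pauli i - pauli 0))‖ ≤ 1 := by
  rw [Complex.norm_exp]
  refine Real.exp_le_one_iff.2 ?_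
  fin_cases i
  · simp [pauli]
  · simp [pauli]; nlinarith

theorem norm_exp_pauli_le' {w : ℂ} {s : ℝ} (h0 : w.im * s ≤ 0) (i : Fin 2) :
    ‖exp (-I * w * s * (pauli i - pauli 1))‖ ≤ 1 := by
  rw [Complex.norm_exp]
  refine Real.exp_le_one_iff.2 ?_
  fin_cases i
  · simp [pauli]; nlinarith
  · simp [pauli]

/-- The column is picked by `Classical.epsilon`; existence makes the choice a solution and
uniqueness makes it the constructed one. -/
theorem μ₂_zero_eq (hσ : |σ| = 1) (hu : PotentialFamily u u' u'' C)
    (hJ : IsJost σ (gauge σ u) f g h) (t : ℝ) {k : ℂ} (hk : 0 ≤ (k ^ 2).im) (x : ℝ) :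
    μ₂ σ (u t) k x 0 0 = f t (k ^ 2) x ∧ μ₂ σ (u t) k x 1 0 = k * g t (k ^ 2) x := by
  have h1 := isJostColumn₂_zero hσ hu hJ t hk
  have h2 := IsJostColumn₂.unique hσ hu (fun i x y hxy => by
    have := norm_exp_pauli_le (w := k ^ 2) (s := x - y) (mul_nonneg hk (sub_nonneg.2 hxy)) i
    simpa using this) (Classical.epsilon_spec ⟨_, h1⟩) h1
  simp only [μ₂, Matrix.of_apply, h2]
  simp

theorem μ₁_one_eq (hσ : |σ| = 1) (hu : PotentialFamily u u' u'' C)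
    (hR : IsRightJost σ (gauge σ u) c d e) (t : ℝ) {k : ℂ} (hk : 0 ≤ (k ^ 2).im) (x : ℝ) :
    μ₁ σ (u t) k x 0 1 = k * c t (k ^ 2) x ∧ μ₁ σ (u t) k x 1 1 = d t (k ^ 2) x := by
  have h1 := isJostColumn₁_one hσ hu hR t hk
  have h2 := IsJostColumn₁.unique hσ hu (fun i x y hxy => by
    have := norm_exp_pauli_le' (w := k ^ 2) (s := x - y)
      (mul_nonpos_of_nonneg_of_nonpos hk (sub_nonpos.2 hxy)) i
    simpa using this) (Classical.epsilon_spec ⟨_, h1⟩) h1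
  simp only [μ₁, Matrix.of_apply, h2]
  simp

theorem μ₁_zero_eq (hσ : |σ| = 1) (hu : PotentialFamily u u' u'' C)
    (hR : IsRightJost σ (gauge σ u) c d e) (t : ℝ) {k : ℂ} {l : ℝ} (hk : k ^ 2 = l) (x : ℝ) :
    μ₁ σ (u t) k x 0 0 = conj (d t l x) ∧ μ₁ σ (u t) k x 1 0 = k * (σ * conj (c t l x)) := by
  have h1 := isJostColumn₁_zero hσ hu hR t hk
  have h2 := IsJostColumn₁.unique hσ hu (fun i x y hxy => by
    have := norm_exp_pauli_le (w := k ^ 2) (s := x - y) (by rw [hk]; simp) i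
    simpa using this) (Classical.epsilon_spec ⟨_, h1⟩) h1
  simp only [μ₁, Matrix.of_apply, h2]
  simp

theorem a_eq (hσ : |σ| = 1) (hu : PotentialFamily u u' u'' C)
    (hJ : IsJost σ (gauge σ u) f g h) (hR : IsRightJost σ (gauge σ u) c d e) (t : ℝ) {k : ℂ}
    (hk : 0 ≤ (k ^ 2).im) : a σ (u t) k = wronskianA f g c d t (k ^ 2) := by
  obtain ⟨h1, h2⟩ := μ₂_zero_eq hσ hu hJ t hk 0
  obtain ⟨h3, h4⟩ := μ₁_one_eq hσ hu hR t hk 0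
  rw [a, h1, h2, h3, h4, wronskianA]
  ring

/-- For k² real, det μ₁ = 1, so the inverse in S is the adjugate and the entries of its first column
are A and kB. -/
theorem r_eq (hσ : |σ| = 1) (hu : PotentialFamily u u' u'' C)
    (hJ : IsJost σ (gauge σ u) f g h) (hR : IsRightJost σ (gauge σ u) c d e) (t : ℝ) {k : ℂ}
    {l : ℝ} (hk : k ^ 2 = l) :
    r σ (u t) k = k * wronskianB σ f g c d t l / wronskianA f g c d t l := by
  have hk' : 0 ≤ (k ^ 2).im := by rw [hk]; simp
  obtain ⟨h1, h2⟩ := μ₂_zero_eq hσ hu hJ t hk' 0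
  obtain ⟨h3, h4⟩ := μ₁_one_eq hσ hu hR t hk' 0
  obtain ⟨h5, h6⟩ := μ₁_zero_eq hσ hu hR t hk 0
  rw [hk] at h1 h2 h3 h4
  have hdet : (μ₁ σ (u t) k 0).det = 1 := by
    rw [Matrix.det_fin_two, h3, h4, h5, h6, ← rightJost_det hR t l 0]
    linear_combination (-(σ * c t l 0 * conj (c t l 0))) * hk
  have hS : S σ (u t) k = (μ₁ σ (u t) k 0).adjugate * μ₂ σ (u t) k 0 := by
    rw [S, Matrix.inv_def, hdet, Ring.inverse_one, one_smul]
  have h10 : S σ (u t) k 1 0 = k * wronskianB σ f g c d t l := by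
    rw [hS, Matrix.adjugate_fin_two]
    simp only [Matrix.mul_apply, Fin.sum_univ_two, Matrix.of_apply, Matrix.cons_val_zero,
      Matrix.cons_val_one, Matrix.cons_val', Matrix.cons_val_fin_one, h1, h2, h5, h6, wronskianB]
    ring
  have h00 : S σ (u t) k 0 0 = wronskianA f g c d t l := by
    rw [hS, Matrix.adjugate_fin_two]
    simp only [Matrix.mul_apply, Fin.sum_univ_two, Matrix.of_apply, Matrix.cons_val_zero,
      Matrix.cons_val_one, Matrix.cons_val', Matrix.cons_val_fin_one, h1, h2, h3, h4, wronskianA]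
    linear_combination (-(c t l 0 * g t l 0)) * hk
  rw [r, h10, h00]

end columns

/-! ### Gluing two half planes. -/

/-- The matrix function equal to `U` in the upper half plane and to the Schwarz reflection of `W`
in the lower half plane. -/
def glue (U W : ℂ → Matrix (Fin 2) (Fin 2) ℂ) (z : ℂ) : Matrix (Fin 2) (Fin 2) ℂ :=
  if 0 < z.im then U z else (W (conj z)).map conj

theorem glue_of_pos (U W : ℂ → Matrix (Fin 2) (Fin 2) ℂ) {z : ℂ} (hz : 0 < z.im) :
    glue U W z = U z := if_pos hz

theorem glue_of_neg (U W : ℂ → Matrix (Fin 2) (Fin 2) ℂ) {z : ℂ} (hz : z.im < 0) :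
    glue U W z = (W (conj z)).map conj := if_neg hz.not_gt

theorem isOpen_upper : IsOpen {z : ℂ | 0 < z.im} := isOpen_lt continuous_const continuous_im

theorem upper_subset : {z : ℂ | 0 < z.im} ⊆ {z | 0 ≤ z.im} := fun z hz => by
  have : 0 < z.im := hz
  exact this.le

theorem tendsto_matrix {α : Type*} {F : Filter α} {N : α → Matrix (Fin 2) (Fin 2) ℂ}
    {A : Matrix (Fin 2) (Fin 2) ℂ} (h : ∀ i j, Tendsto (fun z => N z i j) F (𝓝 (A i j))) :
    Tendsto N F (𝓝 A) :=
  tendsto_pi_nhds.2 fun i => tendsto_pi_nhds.2 fun j => h i j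

theorem tendsto_conj_lower :
    Tendsto (conj : ℂ → ℂ) (cocompact ℂ ⊓ 𝓟 {z | z.im < 0}) (cocompact ℂ ⊓ 𝓟 {z | 0 ≤ z.im}) := by
  refine tendsto_inf.2 ⟨?_, tendsto_principal.2 ?_⟩
  · exact (Complex.conjCLE.toHomeomorph.isClosedEmbedding.tendsto_cocompact).mono_left inf_le_left
  · filter_upwards [Filter.Eventually.filter_mono inf_le_right (mem_principal_self _)] with z hz
    have : z.im < 0 := hz
    simpa using this.le

/-- A limit at infinity off the real line is a limit in both half planes. -/
theorem tendsto_cocompact_of_halfPlanes {α : Type*} {G : Filter α} {φ : ℂ → α}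
    (h₁ : Tendsto φ (cocompact ℂ ⊓ 𝓟 {z | 0 < z.im}) G)
    (h₂ : Tendsto φ (cocompact ℂ ⊓ 𝓟 {z | z.im < 0}) G) :
    Tendsto φ (cocompact ℂ ⊓ 𝓟 {z | z.im ≠ 0}) G := by
  have : {z : ℂ | z.im ≠ 0} = {z | 0 < z.im} ∪ {z | z.im < 0} := by
    ext z
    simp only [Set.mem_ofPred_eq, Set.mem_union]
    exact ⟨fun h => (lt_or_gt_of_ne h).symm, fun h => h.elim ne_of_gt ne_of_lt⟩
  rw [this, ← sup_principal, inf_sup_left]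
  exact tendsto_sup.2 ⟨h₁, h₂⟩

theorem tendsto_comp_glue {α : Type*} {G : Filter α}
    {U W : ℂ → Matrix (Fin 2) (Fin 2) ℂ} {Φ : ℂ → Matrix (Fin 2) (Fin 2) ℂ → α}
    (h₁ : Tendsto (fun z => Φ z (U z)) (cocompact ℂ ⊓ 𝓟 {z | 0 ≤ z.im}) G)
    (h₂ : Tendsto (fun w => Φ (conj w) ((W w).map conj)) (cocompact ℂ ⊓ 𝓟 {z | 0 ≤ z.im}) G) :
    Tendsto (fun z => Φ z (glue U W z)) (cocompact ℂ ⊓ 𝓟 {z | z.im ≠ 0}) G := by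
  refine tendsto_cocompact_of_halfPlanes ?_ ?_
  · refine (h₁.mono_left (inf_le_inf_left _ (principal_mono.2 upper_subset))).congr' ?_
    filter_upwards [Filter.Eventually.filter_mono inf_le_right (mem_principal_self _)] with z hz
    rw [glue_of_pos U W hz]
  · refine (h₂.comp tendsto_conj_lower).congr' ?_
    filter_upwards [Filter.Eventually.filter_mono inf_le_right (mem_principal_self _)] with z hz
    simp only [Function.comp_apply, Complex.conj_conj]
    rw [glue_of_neg U W hz]

/-- Schwarz reflection reduces every condition to functions on the closed upper half plane; the
boundary value from below at l is the entrywise conjugate of W(l). -/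
theorem isRHSolution_glue {σ : ℝ} {ρ : ℝ → ℂ} {x t : ℝ} {U W : ℂ → Matrix (Fin 2) (Fin 2) ℂ}
    (hU : ∀ i j, DifferentiableOn ℂ (fun z => U z i j) {z | 0 < z.im})
    (hW : ∀ i j, DifferentiableOn ℂ (fun z => W z i j) {z | 0 < z.im})
    (hUc : ∀ i j, ContinuousOn (fun z => U z i j) {z | 0 ≤ z.im})
    (hWc : ∀ i j, ContinuousOn (fun z => W z i j) {z | 0 ≤ z.im})
    (hUt : ∀ i j, Tendsto (fun z => U z i j) (cocompact ℂ ⊓ 𝓟 {z | 0 ≤ z.im})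
      (𝓝 ((1 : Matrix (Fin 2) (Fin 2) ℂ) i j)))
    (hWt : ∀ i j, Tendsto (fun z => W z i j) (cocompact ℂ ⊓ 𝓟 {z | 0 ≤ z.im})
      (𝓝 ((1 : Matrix (Fin 2) (Fin 2) ℂ) i j)))
    (hjump : ∀ l : ℝ, U l = (W l).map conj * conjExp (-I * (l * x + 2 * l ^ 2 * t)) (JN σ ρ l)) :
    IsRHSolution σ ρ x t (glue U W) := by
  refine ⟨fun i j z hz => ?_, fun l => ⟨U l, (W l).map conj, ?_, ?_, hjump l⟩, ?_⟩
  · rcases lt_or_gt_of_ne (show z.im ≠ 0 from hz) with hz' | hz'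
    · have hc : conj z ∈ {z : ℂ | 0 < z.im} := by simpa using hz'
      have h1 := ((hW i j).differentiableAt (isOpen_upper.mem_nhds hc)).conj_conj
      rw [Complex.conj_conj] at h1
      refine (h1.congr_of_eventuallyEq ?_).differentiableWithinAt
      filter_upwards [(isOpen_lt continuous_im continuous_const).mem_nhds hz'] with w hw
      rw [glue_of_neg U W hw]
      simp
    · refine (((hU i j).differentiableAt
        (isOpen_upper.mem_nhds hz')).congr_of_eventuallyEq ?_).differentiableWithinAt
      filter_upwards [isOpen_upper.mem_nhds hz'] with w hw
      rw [glue_of_pos U W hw]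
  · refine tendsto_matrix fun i j => ?_
    have h1 : Tendsto (fun z => U z i j) (𝓝[{z | 0 < z.im}] (l : ℂ)) (𝓝 (U l i j)) :=
      (hUc i j l (by simp)).mono_left (nhdsWithin_mono _ upper_subset)
    refine h1.congr' ?_
    filter_upwards [self_mem_nhdsWithin] with z hz
    rw [glue_of_pos U W hz]
  · refine tendsto_matrix fun i j => ?_
    have h0 : Tendsto (conj : ℂ → ℂ) (𝓝[{z | z.im < 0}] (l : ℂ)) (𝓝[{z | 0 ≤ z.im}] (l : ℂ)) := by
      refine tendsto_nhdsWithin_iff.2 ⟨?_, ?_⟩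
      · have := Complex.continuous_conj.tendsto (l : ℂ)
        rw [Complex.conj_ofReal] at this
        exact this.mono_left nhdsWithin_le_nhds
      · filter_upwards [self_mem_nhdsWithin] with z hz
        have : z.im < 0 := hz
        simpa using this.le
    have h1 : Tendsto (fun z => conj (W (conj z) i j)) (𝓝[{z | z.im < 0}] (l : ℂ))
        (𝓝 (conj (W l i j))) :=
      (Complex.continuous_conj.tendsto _).comp (Tendsto.comp (hWc i j l (by simp)) h0)
    refine h1.congr' ?_
    filter_upwards [self_mem_nhdsWithin] with z hz
    rw [glue_of_neg U W hz]
    simp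
  · refine tendsto_matrix fun i j => ?_
    refine tendsto_comp_glue (Φ := fun _ A => A i j) (hUt i j) ?_
    have h1 := (Complex.continuous_conj.tendsto _).comp (hWt i j)
    have h2 : conj ((1 : Matrix (Fin 2) (Fin 2) ℂ) i j) = (1 : Matrix (Fin 2) (Fin 2) ℂ) i j := by
      rw [Matrix.one_apply]; split_ifs <;> simp
    rw [h2] at h1
    exact h1

theorem conjExp_JN (σ : ℝ) (ρ : ℝ → ℂ) (l : ℝ) (w : ℂ) :
    conjExp w (JN σ ρ l) = !![1 - σ * l * (ρ l * conj (ρ l)), -σ * conj (ρ l) * exp (2 * w);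
      l * ρ l * exp (-2 * w), 1] := by
  have h1 : exp w * exp (-w) = 1 := by rw [← Complex.exp_add]; simp
  have h2 : exp (2 * w) = exp w * exp w := by rw [← Complex.exp_add]; ring_nf
  have h3 : exp (-2 * w) = exp (-w) * exp (-w) := by rw [← Complex.exp_add]; ring_nf
  rw [h2, h3, Complex.mul_conj']
  ext i j
  fin_cases i <;> fin_cases j <;> simp [conjExp, JN, pauli, Matrix.mul_apply]
  · linear_combination (1 - σ * l * (‖ρ l‖ : ℂ) ^ 2) * h1
  · ring
  · ring
  · linear_combination h1

/-! ### The explicit solution and the reconstruction of the potential. -/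

section solution

variable {σ : ℝ} {Q : ℝ → ℝ → ℂ} {f g h c d e : ℝ → ℂ → ℝ → ℂ}

/-- The solution of the Riemann–Hilbert problem in the upper half plane. -/
def upperSolution (σ : ℝ) (Q : ℝ → ℝ → ℂ) (f g h c d : ℝ → ℂ → ℝ → ℂ) (t x : ℝ) (z : ℂ) :
    Matrix (Fin 2) (Fin 2) ℂ :=
  !![f t z x / wronskianA f g c d t z, c t z x;
    (2 * I)⁻¹ * (h t z x / wronskianA f g c d t z),
    d t z x - I / 2 * (σ * conj (Q t x)) * c t z x]

/-- The Schwarz reflection of the solution of the Riemann–Hilbert problem in the lower half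
plane. -/
def lowerSolution (σ : ℝ) (Q : ℝ → ℝ → ℂ) (f g c d : ℝ → ℂ → ℝ → ℂ) (t x : ℝ) (z : ℂ) :
    Matrix (Fin 2) (Fin 2) ℂ :=
  !![d t z x, σ * (g t z x / wronskianA f g c d t z);
    σ * (z * c t z x + I / 2 * Q t x * d t z x),
    (f t z x + I / 2 * Q t x * g t z x) / wronskianA f g c d t z]

theorem differentiableOn_upperSolution (hJ : IsJost σ Q f g h) (hR : IsRightJost σ Q c d e)
    (t x : ℝ) (hA : ∀ z : ℂ, 0 ≤ z.im → wronskianA f g c d t z ≠ 0) (i j : Fin 2) :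
    DifferentiableOn ℂ (fun z => upperSolution σ Q f g h c d t x z i j) {z | 0 < z.im} := by
  have ha := differentiableOn_wronskianA hJ hR t
  have hA' : ∀ z ∈ {z : ℂ | 0 < z.im}, wronskianA f g c d t z ≠ 0 := fun z hz => hA z (le_of_lt hz)
  fin_cases i <;> fin_cases j
  · exact (hJ.hol_f t x).div ha hA'
  · exact hR.hol_c t x
  · exact ((hJ.hol_h t x).div ha hA').const_mul _
  · exact (hR.hol_d t x).sub ((hR.hol_c t x).const_mul _)

theorem differentiableOn_lowerSolution (hJ : IsJost σ Q f g h) (hR : IsRightJost σ Q c d e)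
    (t x : ℝ) (hA : ∀ z : ℂ, 0 ≤ z.im → wronskianA f g c d t z ≠ 0) (i j : Fin 2) :
    DifferentiableOn ℂ (fun z => lowerSolution σ Q f g c d t x z i j) {z | 0 < z.im} := by
  have ha := differentiableOn_wronskianA hJ hR t
  have hA' : ∀ z ∈ {z : ℂ | 0 < z.im}, wronskianA f g c d t z ≠ 0 := fun z hz => hA z (le_of_lt hz)
  fin_cases i <;> fin_cases j
  · exact hR.hol_d t x
  · exact ((hJ.hol_g t x).div ha hA').const_mul _
  · exact ((differentiableOn_id.mul (hR.hol_c t x)).add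
      ((hR.hol_d t x).const_mul _)).const_mul _
  · exact ((hJ.hol_f t x).add ((hJ.hol_g t x).const_mul _)).div ha hA'

theorem continuousOn_upperSolution (hJ : IsJost σ Q f g h) (hR : IsRightJost σ Q c d e)
    (t x : ℝ) (hA : ∀ z : ℂ, 0 ≤ z.im → wronskianA f g c d t z ≠ 0) (i j : Fin 2) :
    ContinuousOn (fun z => upperSolution σ Q f g h c d t x z i j) {z | 0 ≤ z.im} := by
  have ha := (continuous_wronskianA hJ hR t).continuousOn (s := {z | 0 ≤ z.im})
  have hi : Continuous fun z : ℂ => (((t, z), x) : (ℝ × ℂ) × ℝ) := by fun_prop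
  fin_cases i <;> fin_cases j
  · exact (hJ.cont_f.comp hi).continuousOn.div ha hA
  · exact (hR.cont_c.comp hi).continuousOn
  · exact continuousOn_const.mul ((hJ.cont_h.comp hi).continuousOn.div ha hA)
  · exact ((hR.cont_d.comp hi).sub (continuous_const.mul (hR.cont_c.comp hi))).continuousOn

theorem continuousOn_lowerSolution (hJ : IsJost σ Q f g h) (hR : IsRightJost σ Q c d e)
    (t x : ℝ) (hA : ∀ z : ℂ, 0 ≤ z.im → wronskianA f g c d t z ≠ 0) (i j : Fin 2) :
    ContinuousOn (fun z => lowerSolution σ Q f g c d t x z i j) {z | 0 ≤ z.im} := by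
  have ha := (continuous_wronskianA hJ hR t).continuousOn (s := {z | 0 ≤ z.im})
  have hi : Continuous fun z : ℂ => (((t, z), x) : (ℝ × ℂ) × ℝ) := by fun_prop
  fin_cases i <;> fin_cases j
  · exact (hR.cont_d.comp hi).continuousOn
  · exact continuousOn_const.mul ((hJ.cont_g.comp hi).continuousOn.div ha hA)
  · exact (continuous_const.mul ((continuous_id.mul (hR.cont_c.comp hi)).add
      (continuous_const.mul (hR.cont_d.comp hi)))).continuousOn
  · exact ((hJ.cont_f.comp hi).add (continuous_const.mul (hJ.cont_g.comp hi))).continuousOn.div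
      ha hA

theorem tendsto_upperSolution (hJ : IsJost σ Q f g h) (hR : IsRightJost σ Q c d e)
    (t x : ℝ) (i j : Fin 2) :
    Tendsto (fun z => upperSolution σ Q f g h c d t x z i j) (cocompact ℂ ⊓ 𝓟 {z | 0 ≤ z.im})
      (𝓝 ((1 : Matrix (Fin 2) (Fin 2) ℂ) i j)) := by
  have ha := tendsto_wronskianA hJ hR t
  have hc := tendsto_zero_of_tendsto_mul (hR.tendsto_mul_c t x)
  fin_cases i <;> fin_cases j
  · have h1 := (hJ.tendsto_f t x).div ha one_ne_zero
    simp at h1 ⊢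
    exact h1
  · have h1 := hc
    simp at h1 ⊢
    exact h1
  · have h1 := ((hJ.tendsto_h t x).div ha one_ne_zero).const_mul (2 * I)⁻¹
    rw [zero_div, mul_zero] at h1
    simp only [Fin.mk_one, Fin.zero_eta, ne_eq, one_ne_zero, not_false_eq_true, Matrix.one_apply_ne]
    exact h1
  · simpa [upperSolution] using (hR.tendsto_d t x).sub (hc.const_mul (I / 2 * (σ * conj (Q t x))))

theorem tendsto_lowerSolution (hJ : IsJost σ Q f g h) (hR : IsRightJost σ Q c d e)
    (t x : ℝ) (i j : Fin 2) :
    Tendsto (fun z => lowerSolution σ Q f g c d t x z i j) (cocompact ℂ ⊓ 𝓟 {z | 0 ≤ z.im})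
      (𝓝 ((1 : Matrix (Fin 2) (Fin 2) ℂ) i j)) := by
  have ha := tendsto_wronskianA hJ hR t
  have hg := tendsto_zero_of_tendsto_mul (hJ.tendsto_mul_g t x)
  fin_cases i <;> fin_cases j
  · have h1 := hR.tendsto_d t x
    simp at h1 ⊢
    exact h1
  · have h1 := (hg.div ha one_ne_zero).const_mul (σ : ℂ)
    simp at h1 ⊢
    exact h1
  · have h1 := ((hR.tendsto_mul_c t x).sub ((hR.tendsto_d t x).const_mul (Q t x))).const_mul
      (-(σ * (I / 2)))
    rw [mul_one, sub_self, mul_zero] at h1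
    refine Tendsto.congr (fun z => ?_) h1
    simp [lowerSolution]
    linear_combination (-(σ * (z * c t z x))) * Complex.I_mul_I
  · have h1 := ((hJ.tendsto_f t x).add (hg.const_mul (I / 2 * Q t x))).div ha one_ne_zero
    simp at h1 ⊢
    exact h1

/-- The first row is the scattering relation divided by A. The second row follows because both
half-plane solutions carry the same left factor, with lower left entry σQ̄/(2i), on top of the bare
Jost matrices. -/
theorem upperSolution_eq (hσ : |σ| = 1) (hJ : IsJost σ Q f g h) (hR : IsRightJost σ Q c d e)
    {ρ : ℝ → ℂ} (t x : ℝ) (hA : ∀ z : ℂ, 0 ≤ z.im → wronskianA f g c d t z ≠ 0) (l : ℝ)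
    (hρ : wronskianB σ f g c d t l = exp (4 * I * l ^ 2 * t) * (ρ l * wronskianA f g c d t l)) :
    upperSolution σ Q f g h c d t x l = (lowerSolution σ Q f g c d t x l).map conj *
      conjExp (-I * (l * x + 2 * l ^ 2 * t)) (JN σ ρ l) := by
  have hA' := hA l (by simp)
  have hσσ := ofReal_mul_self_of_abs_eq_one hσ
  set A := wronskianA f g c d t l with hAdef
  set E := exp (-2 * (-I * (l * x + 2 * l ^ 2 * t))) with hE
  have hE' : exp (2 * (-I * (l * x + 2 * l ^ 2 * t))) = conj E := by
    rw [hE, ← Complex.exp_conj]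
    congr 1
    simp [map_ofNat]
  have hEE : E * conj E = 1 := by
    rw [← hE', hE, ← Complex.exp_add]; simp
  -- The x-oscillation of the scattering relation and the time factor of B combine into the
  -- exponential of the jump.
  have hB : wronskianB σ f g c d t l * exp (2 * I * l * x) = E * (ρ l * A) := by
    rw [hρ, hE, show -2 * (-I * ((l : ℂ) * x + 2 * l ^ 2 * t)) = 4 * I * l ^ 2 * t + 2 * I * l * x
      by ring, Complex.exp_add]
    ring
  have hf : f t l x / A = conj (d t l x) + l * (E * ρ l) * c t l x := by
    rw [div_eq_iff hA', jost_first_eq hJ hR t l x, ← hAdef]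
    linear_combination (l * c t l x) * hB
  have hg : g t l x / A = σ * conj (c t l x) + E * ρ l * d t l x := by
    rw [div_eq_iff hA', jost_second_eq hJ hR t l x, ← hAdef]
    linear_combination (d t l x) * hB
  have hh : h t l x / A = 2 * I * l * (g t l x / A) + σ * conj (Q t x) * (f t l x / A) := by
    rw [hJ.rel t l x (by simp)]; ring
  have hI : (2 * I)⁻¹ = -(I / 2) := by
    rw [mul_inv, Complex.inv_I]; ring
  rw [conjExp_JN, hE', ← hE]
  ext i j
  fin_cases i <;> fin_cases j <;>
    simp only [upperSolution, lowerSolution, Matrix.mul_apply, Fin.sum_univ_two, Matrix.map_apply,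
      Matrix.of_apply, Matrix.cons_val', Matrix.cons_val_zero, Matrix.cons_val_one,
      Matrix.cons_val_fin_one, Fin.zero_eta, Fin.mk_one, Fin.isValue, ← hAdef, add_div,
      mul_div_assoc, map_add, map_mul, Complex.conj_ofReal,
      map_div₀, Complex.conj_I, Complex.conj_conj, map_ofNat, hh, hf, hg, hI]
  · linear_combination (-(l * ρ l * E * c t l x)) * hσσ -
      (conj (d t l x) * σ * l * ρ l * conj (ρ l)) * hEE
  · linear_combination (-c t l x) * hσσ
  · linear_combination (l * ρ l * conj (ρ l) *
      (l * conj (c t l x) - I / 2 * conj (Q t x) * conj (d t l x))) * (hσσ - hEE) -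
      (l * (σ * conj (c t l x) + E * ρ l * d t l x)) * Complex.I_mul_I
  · linear_combination ((l * conj (c t l x) - I / 2 * conj (Q t x) * conj (d t l x)) *
      conj (ρ l) * conj E) * hσσ

theorem isRHSolution_of_isJost (hσ : |σ| = 1) (hJ : IsJost σ Q f g h) (hR : IsRightJost σ Q c d e)
    {ρ : ℝ → ℂ} (t x : ℝ) (hA : ∀ z : ℂ, 0 ≤ z.im → wronskianA f g c d t z ≠ 0)
    (hρ : ∀ l : ℝ, wronskianB σ f g c d t l =
      exp (4 * I * l ^ 2 * t) * (ρ l * wronskianA f g c d t l)) :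
    IsRHSolution σ ρ x t
      (glue (upperSolution σ Q f g h c d t x) (lowerSolution σ Q f g c d t x)) :=
  isRHSolution_glue (differentiableOn_upperSolution hJ hR t x hA)
    (differentiableOn_lowerSolution hJ hR t x hA) (continuousOn_upperSolution hJ hR t x hA)
    (continuousOn_lowerSolution hJ hR t x hA) (tendsto_upperSolution hJ hR t x)
    (tendsto_lowerSolution hJ hR t x) fun l => upperSolution_eq hσ hJ hR t x hA l (hρ l)

/-- The potential is recovered from the solution of the Riemann–Hilbert problem. -/
theorem tendsto_mul_solution (hσ : |σ| = 1) (hJ : IsJost σ Q f g h) (hR : IsRightJost σ Q c d e)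
    (t x : ℝ) :
    Tendsto (fun z : ℂ => 2 * I * (z * glue (upperSolution σ Q f g h c d t x)
      (lowerSolution σ Q f g c d t x) z 0 1)) (cocompact ℂ ⊓ 𝓟 {z | z.im ≠ 0}) (𝓝 (Q t x)) := by
  refine tendsto_comp_glue (Φ := fun z A => 2 * I * (z * A 0 1)) (hR.tendsto_mul_c t x) ?_
  -- In the lower half plane the (1,2) entry is the reflection of σg/A; the minus sign compensates
  -- the conjugate of 2i.
  have h1 := (((hJ.tendsto_mul_g t x).div (tendsto_wronskianA hJ hR t) one_ne_zero).const_mul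
    (-σ : ℂ))
  have h2 := (Complex.continuous_conj.tendsto _).comp h1
  have h3 : conj (-σ * (-(σ * conj (Q t x)) / 1)) = Q t x := by
    simp only [map_mul, map_neg, map_div₀, map_one, Complex.conj_ofReal, Complex.conj_conj]
    linear_combination (Q t x) * ofReal_mul_self_of_abs_eq_one hσ
  rw [h3] at h2
  refine h2.congr fun z => ?_
  simp [lowerSolution, map_ofNat]
  ring

end solution

end DNLS

end

/-! ### The inverse scattering theorem. -/

theorem mainTheorem2 (σ : ℝ) (hσ : σ = 1 ∨ σ = -1) (T : ℝ) (hT : 0 < T)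
    (q₀ : ℝ → ℂ) (q : ℝ → ℝ → ℂ) (hq : DNLS.IsSolution σ T q₀ q)
    (ha : ∀ k : ℂ, 0 ≤ (k ^ 2).im → DNLS.a σ q₀ k ≠ 0) :
    ∃ ρ : ℝ → ℂ, Continuous ρ ∧
      (∀ (k : ℂ) (l : ℝ), k ≠ 0 → k ^ 2 = (l : ℂ) → ρ l = DNLS.r σ q₀ k / k) ∧
      ∃ qt : ℝ → ℝ → ℂ, ∀ t ∈ Set.Icc 0 T, ∀ x : ℝ,
        (∃ N, DNLS.IsRHSolution σ ρ x t N) ∧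
        (∀ N N', DNLS.IsRHSolution σ ρ x t N → DNLS.IsRHSolution σ ρ x t N' →
          ∀ z : ℂ, z.im ≠ 0 → N z = N' z) ∧
        (∀ N, DNLS.IsRHSolution σ ρ x t N →
          Tendsto (fun z : ℂ => 2 * I * (z * N z 0 1))
            (cocompact ℂ ⊓ 𝓟 {z | z.im ≠ 0}) (𝓝 (qt x t))) ∧
        IntegrableOn (fun y => ‖qt y t‖ ^ 2) (Set.Ioi x) ∧
        q x t = qt x t *
          exp (σ * I * ((-∫ y in Set.Ioi x, ‖qt y t‖ ^ 2 : ℝ) : ℂ)) := by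
  have hσ1 : |σ| = 1 := by rcases hσ with rfl | rfl <;> simp
  obtain ⟨u, u', u'', C, hu, huq, hut⟩ := hq.exists_family hT
  have hu0 : u 0 = q₀ := funext fun x => (huq 0 ⟨le_rfl, hT.le⟩ x).trans (hq.initial x)
  obtain ⟨f, g, h, hJ⟩ := DNLS.exists_isJost hσ1 (hu.gauge hσ1)
  obtain ⟨c, d, e, hR⟩ := DNLS.exists_isRightJost hσ1 (hu.gauge hσ1)
  have hA : ∀ z : ℂ, 0 ≤ z.im → DNLS.wronskianA f g c d 0 z ≠ 0 := fun z hz => by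
    -- Every z in the closed upper half plane is some k² in the region of the hypothesis, so A never
    -- vanishes there.
    obtain ⟨k, rfl⟩ := IsAlgClosed.exists_pow_nat_eq z (n := 2) two_pos
    rw [← DNLS.a_eq hσ1 hu hJ hR 0 hz, hu0]
    exact ha k hz
  have hAl : ∀ l : ℝ, DNLS.wronskianA f g c d 0 l ≠ 0 := fun l => hA l (by simp)
  -- Since r = kB/A, the quotient r/k is B/A, which is continuous through λ = 0 as well.
  refine ⟨fun l => DNLS.wronskianB σ f g c d 0 l / DNLS.wronskianA f g c d 0 l, ?_, ?_,
    fun x t => DNLS.gauge σ u t x, fun t ht x => ?_⟩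
  · exact (DNLS.continuous_wronskianB hJ hR 0).div
      ((DNLS.continuous_wronskianA hJ hR 0).comp Complex.continuous_ofReal) hAl
  · intro k l hk hkl
    rw [← hu0, DNLS.r_eq hσ1 hu hJ hR 0 hkl]
    have := hAl l
    field_simp
  have hAt : ∀ z : ℂ, 0 ≤ z.im → DNLS.wronskianA f g c d t z = DNLS.wronskianA f g c d 0 z :=
    fun z hz => DNLS.wronskianA_evolution hσ1 hu hut hJ hR hz ht
  have hN := DNLS.isRHSolution_of_isJost hσ1 hJ hR t x (fun z hz => (hAt z hz).symm ▸ hA z hz)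
    (ρ := fun l => DNLS.wronskianB σ f g c d 0 l / DNLS.wronskianA f g c d 0 l) (fun l => by
      rw [hAt l (by simp), div_mul_cancel₀ _ (hAl l),
        DNLS.wronskianB_evolution hσ1 hu hut hJ hR l ht])
  refine ⟨⟨_, hN⟩, fun N N' h1 h2 z hz => h1.unique h2 hz, fun N h1 => ?_, ?_, ?_⟩
  · refine (DNLS.tendsto_mul_solution hσ1 hJ hR t x).congr' ?_
    filter_upwards [Filter.Eventually.filter_mono inf_le_right (mem_principal_self _)] with z hz
    rw [hN.unique h1 hz]
  · simp only [DNLS.norm_gauge]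
    have hc := hu.cont_x t
    refine Integrable.integrableOn ?_
    refine (integrable_inv_one_add_sq.const_mul (C * C)).mono' (by fun_prop)
      (Eventually.of_forall fun y => ?_)
    have h1 := hu.bound t y
    have h2 := hu.norm_le t y
    have h3 : ‖u t y‖ * ‖u t y‖ ≤ C * (C * (1 + y ^ 2)⁻¹) :=
      mul_le_mul h2 h1 (norm_nonneg _) hu.pos.le
    rw [Real.norm_of_nonneg (by positivity)]
    nlinarith
  · simp only [DNLS.norm_gauge]
    -- The gauge preserves the modulus, so the phase that undoes it is expressible through q̃.
    have hp : 2 * I * DNLS.phase σ (u t) x =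
        σ * I * ((-∫ y in Set.Ioi x, ‖u t y‖ ^ 2 : ℝ) : ℂ) := by
      have : ∀ y, (1 / 2) * u t y * (σ * conj (u t y)) = (σ / 2) * ((‖u t y‖ ^ 2 : ℝ) : ℂ) :=
        fun y => by
          rw [Complex.ofReal_pow, ← Complex.mul_conj']
          ring
      rw [DNLS.phase, funext this, integral_const_mul, integral_complex_ofReal]
      push_cast
      ring
    rw [← hp, DNLS.gauge, mul_assoc, ← Complex.exp_add, huq t ht x]
    ring_nf
    simp
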